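/- **Setting (lattice constant $1$).** Let $a_1=\frac12(1,\sqrt3)$, $a_2=\frac12(-1,\sqrt3)$, $b_1=\frac{4\pi}{\sqrt3}(\frac{\sqrt3}{2},\frac12)$, $b_2=\frac{4\pi}{\sqrt3}(-\frac{\sqrt3}{2},\frac12)$, $\tau^A=0$, $\tau^B=(0,\frac1{\sqrt3})$, $\kappa=(\frac{4\pi}3,0)$. For a twist angle $\theta$ and an interlayer displacement $\mathfrak d\in\mathbb R^2$, let $R_1,R_2$ be the counterclockwise rotations by $-\frac\theta2,\frac\theta2$, and put $a_{i,j}=R_ia_j$, $b_{i,j}=R_ib_j$, $\kappa_i=R_i\kappa$, $\tau_1^\sigma=R_1(\tau^\sigma-\frac{\mathfrak d}2)$, $\tau_2^\sigma=R_2(\tau^\sigma+\frac{\mathfrak d}2)$, $\Lambda_i=\mathbb Za_{i,1}+\mathbb Za_{i,2}$. On $\mathcal H=\ell^2(\mathbb Z^2;\mathbb C^2)^2$, with elements $\psi=(\psi^\sigma_{R_i})$, $i\in\{1,2\}$, $R_i\in\Lambda_i$, $\sigma\in\{A,B\}$, the Hamiltonian $H$ of twisted bilayer graphene is $$(H\psi)_{R_i}^\sigma=-\tfrac{2}{\sqrt3}\begin{pmatrix}\psi^B_{R_i}+\psi^B_{R_i-a_{i,1}}+\psi^B_{R_i-a_{i,2}}\\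 \psi^A_{R_i}+\psi^A_{R_i+a_{i,1}}+\psi^A_{R_i+a_{i,2}}\end{pmatrix}^{\sigma}+\tfrac{\sqrt3}2\sum_{R_j\in\Lambda_j}\sum_{\sigma'}h(R_i+\tau_i^\sigma-R_j-\tau_j^{\sigma'};\ell)\,\psi^{\sigma'}_{R_j},\qquad j\ne i .$$ **Hypotheses on $h$.** $h(r;\ell)=h^\sharp(\sqrt{|r|^2+\ell^2})$ with $h^\sharp$ real-valued, and there are constants $C_1,C_2,C_3,D_1,D_2,\ell_0>0$ with $1\le D_1/D_2<2$ such that for all $\ell\ge\ell_0$: $h(\cdot;\ell)$ is integrable, it equals pointwise the inverse Fourier transform of $\hat h(\xi;\ell)=\int_{\mathbb R^2}e^{-i\xi\cdot r}h(r;\ell)\,dr$, and $$\hat h(\kappa;\ell)\ge C_1e^{-D_1\ell|\kappa|},\qquad |\hat h(\xi;\ell)|\le C_2e^{-D_2\ell|\xi|},\qquad |\hat h(\xi;\ell)-\hat h(\xi';\ell)|\le C_3e^{-D_2\ell\,d(0,[\xi,\xi'])}|\xi-\xi'|$$ for all $\xi,\xi'\in\mathbb R^2$, where $d(0,[\xi,\xi'])$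 is the distance from the origin to the segment $[\xi,\xi']$. **Scaling.** For fixed $\lambda_0,\lambda_1>0$, the parameters $\gamma,\theta>0$ and $\ell\ge\ell_0$ satisfy $\hat h(|\kappa|;\ell)=\lambda_0\gamma$ and $\theta\le\lambda_1\gamma$. **Ansatz.** For envelopes $f=(f_i^\sigma(X,T))$, $X\in\mathbb R^2$, $T\ge0$, let $$(\Psi_i)^\sigma_{R_i}(\tau)=\gamma f_i^\sigma\big(\gamma(R_i+\tau_i^\sigma),\gamma\tau\big)e^{i\kappa_i\cdot(R_i+\tau_i^\sigma)},\qquad r=-(i\partial_\tau-H)\Psi .$$ At every time considered, $f(\cdot,T)\in H^8(\mathbb R^2;\mathbb C^4)$ (continuous representative) and $f$ is differentiable in $T$ at every $X$ (one-sidedly at $T=0$). **BM Hamiltonian.** With $\mathfrak s_1=\kappa_1-\kappa_2$, $\mathfrak s_2=\mathfrak s_1-b_{2,2}+b_{1,2}$, $\mathfrak s_3=\mathfrak s_1+b_{2,1}-b_{1,1}$, $T_1^{\sigma\sigma'}=1$, $T_2^{\sigma\sigma'}=e^{i(b_{1,2}\cdot\tau_1^\sigma-b_{2,2}\cdot\tau_2^{\sigma'})}$,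 $T_3^{\sigma\sigma'}=e^{i(-b_{1,1}\cdot\tau_1^\sigma+b_{2,1}\cdot\tau_2^{\sigma'})}$, and $\vec\sigma$ the first two Pauli matrices, $$H_{\rm BM}=\begin{pmatrix}\vec\sigma\cdot(-i\nabla_X)&\mathcal T(X)\\ \mathcal T^\dagger(X)&\vec\sigma\cdot(-i\nabla_X)\end{pmatrix},\qquad \mathcal T(X)=\lambda_0\sum_{j=1}^3T_je^{-i\mathfrak s_j\cdot X/\gamma}.$$ **Claims.** 1. There are $\gamma_0,C,c>0$ depending only on $h^\sharp$ (with the constants in its hypotheses), $\lambda_0$, $\lambda_1$ such that for all $\gamma\le\gamma_0$, all $\theta,\ell$ in the scaling regime, all $\mathfrak d$, $f$ and $\tau\ge0$: $\Psi(\tau)\in\mathcal H$, the sums defining $H\Psi(\tau)$ converge absolutely, and $$r^\sigma_{R_i}(\tau)=\gamma\Big[\gamma\big(-[i\partial_T-H_{\rm BM}]f\big)_i^\sigma(X,T)\Big|_{X=\gamma(R_i+\tau_i^\sigma),\,T=\gamma\tau}e^{i\kappa_i\cdot(R_i+\tau_i^\sigma)}\Big]+\mathfrak r^\sigma_{R_i}(\tau),\qquad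 \|\mathfrak r(\tau)\|_{\mathcal H}\le C\gamma^{1+c}\|f(\cdot,\gamma\tau)\|_{H^8(\mathbb R^2;\mathbb C^4)} .$$ 2. For sequences of parameters in the scaling regime with $\gamma_n\to0$, displacements $\mathfrak d_n$, times $\tau_n\ge0$ and envelopes $f_n$ such that, with $T_n=\gamma_n\tau_n$, the norms $\|f_n(\cdot,T_n)\|_{H^8}$ and $\|\partial_Tf_n(\cdot,T_n)\|_{H^2}$ are bounded in $n$ and $\partial_Tf_n(\cdot,T_n)$ is continuous: the residuals $r_n$ satisfy $\|r_n(\tau_n)\|_{\mathcal H}=o(\gamma_n)$ if and only if $\|(i\partial_T-H_{{\rm BM}})f_n(\cdot,T_n)\|_{L^2}\to0$, where $H_{\rm BM}$ is taken with the $n$-th parameters. 3. For fixed $f$, $\mathfrak d$ and $T\ge0$ with $\partial_Tf(\cdot,T)$ continuous, and sequences of parameters in the scaling regime with $\gamma_n\to0$ along which $2\sin(\theta_n/2)/\gamma_n$ is constant (so that $H_{\rm BM}$ does not depend on $n$): $\|r_n(T/\gamma_n)\|_{\mathcal H}=o(\gamma_n)$ if and only if $i\partial_Tf=H_{\rm BM}f$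 at time $T$. Here $\|\cdot\|_{\mathcal H}=\infty$ outside $\mathcal H$. -/

import Mathlib

open MeasureTheory Filter Topology
open scoped ENNReal NNReal FourierTransform Matrix

noncomputable section

namespace TBG

/-- The plane `ℝ²` with its Euclidean norm. -/
abbrev Plane : Type := EuclideanSpace ℝ (Fin 2)

/-! ### Geometry of twisted bilayer graphene (lattice constant `1`)

Layers are indexed by `Fin 2` (`0` is layer 1, `1` is layer 2), sublattices by `Fin 2`
(`0` is `A`, `1` is `B`), lattice cells by `ℤ × ℤ`. -/

/-- Counterclockwise rotation by the angle `ζ`. -/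
def rot (ζ : ℝ) (v : Plane) : Plane :=
  !₂[Real.cos ζ * v 0 - Real.sin ζ * v 1, Real.sin ζ * v 0 + Real.cos ζ * v 1]

/-- Monolayer lattice vectors `a₁, a₂`. -/
def aVec : Fin 2 → Plane :=
  ![!₂[1 / 2, Real.sqrt 3 / 2], !₂[-(1 / 2), Real.sqrt 3 / 2]]

/-- Monolayer reciprocal lattice vectors `b₁, b₂` (so that `bᵢ · aⱼ = 2π δᵢⱼ`). -/
def bVec : Fin 2 → Plane :=
  ![!₂[2 * Real.pi, 2 * Real.pi / Real.sqrt 3], !₂[-(2 * Real.pi), 2 * Real.pi / Real.sqrt 3]]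

/-- Monolayer site shifts `τ^A = 0`, `τ^B = (0, 1/√3)`. -/
def tauVec : Fin 2 → Plane := ![0, !₂[0, 1 / Real.sqrt 3]]

/-- The Dirac point `κ = (4π/3, 0)` of the monolayer. -/
def kappa : Plane := !₂[4 * Real.pi / 3, 0]

/-- Rotation angle of a layer: `-θ/2` for layer 1, `θ/2` for layer 2. -/
def layerAngle (θ : ℝ) : Fin 2 → ℝ := ![-(θ / 2), θ / 2]

/-- Lattice vectors of layer `i`. -/
def aLayer (θ : ℝ) (i j : Fin 2) : Plane := rot (layerAngle θ i) (aVec j)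

/-- Reciprocal lattice vectors of layer `i`. -/
def bLayer (θ : ℝ) (i j : Fin 2) : Plane := rot (layerAngle θ i) (bVec j)

/-- Dirac point `κᵢ` of layer `i`. -/
def kappaLayer (θ : ℝ) (i : Fin 2) : Plane := rot (layerAngle θ i) kappa

/-- Site shifts of layer `i`, for the interlayer displacement `d`. -/
def tauLayer (θ : ℝ) (d : Plane) (i σ : Fin 2) : Plane :=
  rot (layerAngle θ i) (tauVec σ + (![-(1 / 2), 1 / 2] : Fin 2 → ℝ) i • d)

/-- Position `Rᵢ + τᵢ^σ` of the atom of sublattice `σ` in cell `n` of layer `i`. -/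
def site (θ : ℝ) (d : Plane) (i : Fin 2) (n : ℤ × ℤ) (σ : Fin 2) : Plane :=
  ((n.1 : ℝ) • aLayer θ i 0 + (n.2 : ℝ) • aLayer θ i 1) + tauLayer θ d i σ

/-- The layer other than `i`. -/
def other : Fin 2 → Fin 2 := ![1, 0]

/-! ### Tight-binding model -/

/-- Wave functions `(ψ_{R_i}^σ)`. -/
abbrev State : Type := Fin 2 → ℤ × ℤ → Fin 2 → ℂ

/-- The norm of `𝓗 = ℓ²(ℤ²; ℂ²) ⊕ ℓ²(ℤ²; ℂ²)`; it is `∞` for families outside `𝓗`. -/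
def hNorm (ψ : State) : ℝ≥0∞ :=
  (∑ i : Fin 2, ∑' n : ℤ × ℤ, ∑ σ : Fin 2, ‖ψ i n σ‖ₑ ^ 2) ^ (1 / 2 : ℝ)

/-- Interlayer hopping function `h(r; ℓ) = h♯(√(|r|² + ℓ²))`. -/
def hop (hs : ℝ → ℝ) (r : Plane) (l : ℝ) : ℝ := hs (Real.sqrt (‖r‖ ^ 2 + l ^ 2))

/-- Fourier transform `ĥ(ξ; ℓ) = ∫ e^{-i ξ·r} h(r; ℓ) dr`. -/
def hopHat (hs : ℝ → ℝ) (ξ : Plane) (l : ℝ) : ℂ :=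
  ∫ r : Plane, Complex.exp (-Complex.I * (inner ℝ ξ r : ℝ)) * (hop hs r l : ℂ)

/-- Assumptions on the interlayer hopping function. -/
structure HoppingAssumption (hs : ℝ → ℝ) (C₁ C₂ C₃ D₁ D₂ l₀ : ℝ) : Prop where
  C₁_pos : 0 < C₁
  C₂_pos : 0 < C₂
  C₃_pos : 0 < C₃
  D₂_pos : 0 < D₂
  l₀_pos : 0 < l₀
  D₂_le_D₁ : D₂ ≤ D₁
  D₁_div_D₂_lt : D₁ / D₂ < 2
  /-- the Fourier transform exists -/
  integrable : ∀ l, l₀ ≤ l → Integrable (fun r : Plane => hop hs r l)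
  /-- and the Fourier inversion formula holds -/
  inversion : ∀ l, l₀ ≤ l → ∀ r : Plane,
    (hop hs r l : ℂ) = (1 / (2 * Real.pi) ^ 2 : ℝ) *
      ∫ ξ : Plane, Complex.exp (Complex.I * (inner ℝ ξ r : ℝ)) * hopHat hs ξ l
  /-- exponential lower bound at the Dirac point; imposed at every `ξ` (in particular at `ξ = 0`)
  it could never hold, since `ĥ(0; ℓ) = 2π ∫_ℓ^∞ s h♯(s) ds → 0` as `ℓ → ∞` -/
  lower : ∀ l, l₀ ≤ l → C₁ * Real.exp (-D₁ * l * ‖kappa‖) ≤ (hopHat hs kappa l).re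
  upper : ∀ l, l₀ ≤ l → ∀ ξ : Plane, ‖hopHat hs ξ l‖ ≤ C₂ * Real.exp (-D₂ * l * ‖ξ‖)
  lipschitz : ∀ l, l₀ ≤ l → ∀ ξ ξ' : Plane,
    ‖hopHat hs ξ l - hopHat hs ξ' l‖ ≤
      C₃ * Real.exp (-D₂ * l * Metric.infDist 0 (segment ℝ ξ ξ')) * ‖ξ - ξ'‖

/-- Intralayer Hamiltonian `H_{ii}` (nearest-neighbour hopping in each layer). -/
def intraH (ψ : State) : State := fun i n σ =>
  -((2 / Real.sqrt 3 : ℝ) : ℂ) *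
    (![ψ i n 1 + ψ i (n.1 - 1, n.2) 1 + ψ i (n.1, n.2 - 1) 1,
       ψ i n 0 + ψ i (n.1 + 1, n.2) 0 + ψ i (n.1, n.2 + 1) 0] : Fin 2 → ℂ) σ

/-- The contribution of cell `m` of the other layer to the interlayer hopping into the site
`(i, n, σ)`. -/
def interTerm (hs : ℝ → ℝ) (l θ : ℝ) (d : Plane) (ψ : State)
    (i : Fin 2) (n : ℤ × ℤ) (σ : Fin 2) (m : ℤ × ℤ) : ℂ :=
  ∑ σ' : Fin 2, (hop hs (site θ d i n σ - site θ d (other i) m σ') l : ℂ) * ψ (other i) m σ'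

/-- The Hamiltonian `H` of twisted bilayer graphene. -/
def tbgH (hs : ℝ → ℝ) (l θ : ℝ) (d : Plane) (ψ : State) : State := fun i n σ =>
  intraH ψ i n σ + ((Real.sqrt 3 / 2 : ℝ) : ℂ) * ∑' m : ℤ × ℤ, interTerm hs l θ d ψ i n σ m

/-! ### Envelopes and Sobolev norms -/

/-- Envelopes `f_i^σ : ℝ² → ℂ` at a fixed time. -/
abbrev Envelope : Type := Fin 2 → Fin 2 → Plane → ℂ

/-- The `H^k(ℝ²)` norm `(∫ (1 + |ξ|²)^k |û(ξ)|² dξ)^{1/2}`, through the `L²` Fourier transform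
with the kernel `e^{-2πi ξ·x}`, so that `ξ` stands for `2π` times the integration variable. It is
`∞` for functions outside `H^k`. -/
def sobolevNormScalar (k : ℕ) (u : Plane → ℂ) : ℝ≥0∞ :=
  ⨅ hu : MemLp u 2 (volume : Measure Plane),
    (∫⁻ ξ : Plane, ENNReal.ofReal ((1 + ‖(2 * Real.pi) • ξ‖ ^ 2) ^ k) *
      ‖(𝓕 (hu.toLp u) : Lp ℂ 2 (volume : Measure Plane)) ξ‖ₑ ^ 2) ^ (1 / 2 : ℝ)

/-- The `H^k(ℝ²; ℂ⁴)` norm. -/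
def sobolevNorm (k : ℕ) (u : Envelope) : ℝ≥0∞ :=
  (∑ i : Fin 2, ∑ σ : Fin 2, sobolevNormScalar k (u i σ) ^ 2) ^ (1 / 2 : ℝ)

/-- The `L²(ℝ²; ℂ⁴)` norm. -/
def l2Norm (u : Envelope) : ℝ≥0∞ :=
  (∑ i : Fin 2, ∑ σ : Fin 2, eLpNorm (u i σ) 2 (volume : Measure Plane) ^ 2) ^ (1 / 2 : ℝ)

/-- The time derivative `∂_T f` at `T ≥ 0` (one-sided at `T = 0`). -/
def timeDeriv (f : ℝ → Envelope) (T : ℝ) : Envelope := fun i σ X =>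
  derivWithin (fun t => f t i σ X) (Set.Ici 0) T

/-- At time `T` the envelopes belong to `H⁸` (we take their continuous representatives, so that
they can be sampled) and are differentiable in time. -/
structure RegularAt (f : ℝ → Envelope) (T : ℝ) : Prop where
  continuous : ∀ i σ, Continuous (f T i σ)
  sobolev : sobolevNorm 8 (f T) < ⊤
  differentiable : ∀ i σ X, DifferentiableWithinAt ℝ (fun t => f t i σ X) (Set.Ici 0) T

/-! ### Wave packets and the residual -/

/-- The wave-packet ansatz `Ψ(τ)`. -/
def wavePacket (γ θ : ℝ) (d : Plane) (f : ℝ → Envelope) (τ : ℝ) : State := fun i n σ =>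
  (γ : ℂ) * f (γ * τ) i σ (γ • site θ d i n σ) *
    Complex.exp (Complex.I * (inner ℝ (kappaLayer θ i) (site θ d i n σ) : ℝ))

/-- The residual `r(τ) = -(i ∂_τ - H) Ψ(τ)`. -/
def residual (hs : ℝ → ℝ) (l γ θ : ℝ) (d : Plane) (f : ℝ → Envelope) (τ : ℝ) : State :=
  fun i n σ =>
    -(Complex.I * derivWithin (fun t => wavePacket γ θ d f t i n σ) (Set.Ici 0) τ -
      tbgH hs l θ d (wavePacket γ θ d f τ) i n σ)

/-! ### The Bistritzer-MacDonald Hamiltonian -/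

/-- Momentum hops `𝔰₁, 𝔰₂, 𝔰₃`. -/
def sVec (θ : ℝ) : Fin 3 → Plane :=
  ![kappaLayer θ 0 - kappaLayer θ 1,
    kappaLayer θ 0 - kappaLayer θ 1 - bLayer θ 1 1 + bLayer θ 0 1,
    kappaLayer θ 0 - kappaLayer θ 1 + bLayer θ 1 0 - bLayer θ 0 0]

/-- Hopping matrices `T₁, T₂, T₃`. -/
def hopMat (θ : ℝ) (d : Plane) : Fin 3 → Matrix (Fin 2) (Fin 2) ℂ :=
  ![fun _ _ => 1,
    fun σ σ' => Complex.exp (Complex.I *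
      ((inner ℝ (bLayer θ 0 1) (tauLayer θ d 0 σ) -
        inner ℝ (bLayer θ 1 1) (tauLayer θ d 1 σ') : ℝ) : ℂ)),
    fun σ σ' => Complex.exp (Complex.I *
      ((-inner ℝ (bLayer θ 0 0) (tauLayer θ d 0 σ) +
        inner ℝ (bLayer θ 1 0) (tauLayer θ d 1 σ') : ℝ) : ℂ))]

/-- The moiré potential `T_θ(r) = ∑ⱼ Tⱼ e^{-i 𝔰ⱼ·r}`. -/
def moire (θ : ℝ) (d : Plane) (r : Plane) : Matrix (Fin 2) (Fin 2) ℂ :=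
  ∑ j : Fin 3, Complex.exp (-Complex.I * (inner ℝ (sVec θ j) r : ℝ)) • hopMat θ d j

/-- The scaled moiré potential `𝓣(X) = lam₀ T_θ(X / γ)`. -/
def scaledMoire (lam₀ γ θ : ℝ) (d : Plane) (X : Plane) : Matrix (Fin 2) (Fin 2) ℂ :=
  (lam₀ : ℂ) • moire θ d (γ⁻¹ • X)

/-- The Pauli matrices `σ₁, σ₂`. -/
def pauli : Fin 2 → Matrix (Fin 2) (Fin 2) ℂ :=
  ![!![0, 1; 1, 0], !![0, -Complex.I; Complex.I, 0]]

/-- The Dirac operator `σ·(-i∇)` on two-component functions. -/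
def dirac (u : Fin 2 → Plane → ℂ) (σ : Fin 2) (X : Plane) : ℂ :=
  ∑ k : Fin 2, ∑ σ' : Fin 2,
    pauli k σ σ' * (-Complex.I * fderiv ℝ (u σ') X (EuclideanSpace.single k (1 : ℝ)))

/-- The scaled Bistritzer-MacDonald Hamiltonian `H_BM`. -/
def bmH (lam₀ γ θ : ℝ) (d : Plane) (u : Envelope) : Envelope := fun i σ X =>
  dirac (u i) σ X +
    (![scaledMoire lam₀ γ θ d X *ᵥ (fun σ' => u 1 σ' X),
       (scaledMoire lam₀ γ θ d X)ᴴ *ᵥ (fun σ' => u 0 σ' X)] : Fin 2 → Fin 2 → ℂ) i σ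

/-- `-(i ∂_T - H_BM) f` at time `T`. -/
def bmDefect (lam₀ γ θ : ℝ) (d : Plane) (f : ℝ → Envelope) (T : ℝ) : Envelope := fun i σ X =>
  -(Complex.I * timeDeriv f T i σ X - bmH lam₀ γ θ d (f T) i σ X)

/-- The leading part of the residual: `γ [γ (-(i ∂_T - H_BM) f)]` sampled on the lattice at
`T = γ τ` and modulated by the Dirac-point phases. -/
def leading (lam₀ γ θ : ℝ) (d : Plane) (f : ℝ → Envelope) (τ : ℝ) : State := fun i n σ =>
  (γ : ℂ) * ((γ : ℂ) * bmDefect lam₀ γ θ d f (γ * τ) i σ (γ • site θ d i n σ) *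
    Complex.exp (Complex.I * (inner ℝ (kappaLayer θ i) (site θ d i n σ) : ℝ)))

/-- The scaling regime `ĥ(|κ|; ℓ) = lam₀ γ`, `0 < θ ≤ lam₁ γ`, with `ℓ ≥ ℓ₀`. -/
structure Scaling (hs : ℝ → ℝ) (l₀ lam₀ lam₁ γ θ l : ℝ) : Prop where
  γ_pos : 0 < γ
  θ_pos : 0 < θ
  θ_le : θ ≤ lam₁ * γ
  l₀_le : l₀ ≤ l
  hopHat_eq : hopHat hs kappa l = ((lam₀ * γ : ℝ) : ℂ)

end TBG

end

open TBG

/-! Everything is computed on the Fourier side. An envelope in `H⁸` is a superposition `synth φ` of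
plane waves with `(1 + |ξ|²)⁴ φ` square integrable, and the Hamiltonian acts on the packet `γ f(γx)
e^{iκ·x}` through symbols evaluated at `κ + γξ`.

Within a layer the action is exactly a multiplier (`intraH_packet`). The three bond phases at the
Dirac point are the cube roots of unity, so the constant term cancels and the linear term is `γ(ξ₁ ∓
iξ₂)`, up to the rotation of the layer; the error is `O(γ² + γθ) = O(γ²)`
(`norm_bondSymbol_sub_le`).

Between the layers, Poisson summation replaces the sum over atoms by a sum over reciprocal vectors
`G` of the symbols `ĥ(κ + γξ + G)` (`hasSum_hop_mul_packet`). Exactly three of the points `κ + G`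
lie on the circle `|·| = |κ|`; there `ĥ = λ₀γ` by radial symmetry, and on atomic sites their phases
add up to the moiré potential (`moireCoupling_mul_exp`). All other points satisfy `|κ + G| ≥ 2|κ|`.
The lower bound at `κ` gives `e^{-D₁ℓ|κ|} ≲ γ`, so the far points contribute about `γ^{2D₂/D₁}`, of
exponent above one because `D₁/D₂ < 2`; at the near points the Lipschitz bound gains about
`γ^{D₂/D₁}` over `γ|ξ|`. A small part of these exponents is given up to sum over `G`, and momenta
with `γ|ξ|` comparable to `|κ + G|` are paid for by weights in `ξ`, that is by derivatives of `f`.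
This is `exists_norm_hopDefect_le`.

To pass from symbols to `ℓ²` norms, samples on the lattice of spacing `γ` are read as Fourier
coefficients of a periodized symbol. By Parseval, their scaled norm equals a fixed multiple of the
`L²` norm of the symbol up to an aliasing error `O(γ²)` in the `H²` norm, in both directions and
uniformly in rotation and shift (`sampleNorm_synth_le`, `le_sampleNorm_synth`). The upper bound
controls the remainder. Both bounds, applied to the BM defect, which is again a superposition of
plane waves, give the equivalence for bounded families.

For a fixed envelope `∂_T f` is only continuous, so the lower bound is replaced by an elementary
one: near a point where the defect is nonzero there are of order `γ⁻²` lattice points at which it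
stays away from zero (`exists_le_sampleNorm`). -/

noncomputable section

namespace TBG

/-! ### Fourier series on the unit cell -/

section UnitCell

-- Haar measure of total mass one, for which the characters of the torus are orthonormal.
local instance : MeasureSpace UnitAddCircle := ⟨AddCircle.haarAddCircle⟩

/-- The half-open unit cell centred at the origin. -/
def unitCell : Set (Fin 2 → ℝ) := {x | ∀ i, x i ∈ Set.Ioc (-(1 / 2) : ℝ) (-(1 / 2) + 1)}

/-- The character `x ↦ e^{2πi n·x}`. -/
def latChar (n : Fin 2 → ℤ) (x : Fin 2 → ℝ) : ℂ :=
  Complex.exp (Complex.I * ((2 * Real.pi * ∑ i, (n i : ℝ) * x i : ℝ) : ℂ))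

lemma measurableSet_unitCell : MeasurableSet unitCell :=
  MeasurableSet.univ_pi' (fun _ => measurableSet_Ioc)

lemma mFourier_coe (n : Fin 2 → ℤ) (x : Fin 2 → ℝ) :
    UnitAddTorus.mFourier n (fun i => (x i : UnitAddCircle)) = latChar n x := by
  simp only [UnitAddTorus.mFourier, ContinuousMap.coe_mk, fourier_coe_apply, latChar,
    Fin.prod_univ_two, Fin.sum_univ_two, ← Complex.exp_add]
  congr 1
  push_cast
  ring

lemma continuous_latChar (n : Fin 2 → ℤ) : Continuous (latChar n) := by
  unfold latChar; fun_prop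

lemma norm_latChar (n : Fin 2 → ℤ) (x : Fin 2 → ℝ) : ‖latChar n x‖ = 1 := by
  unfold latChar
  rw [mul_comm]; exact Complex.norm_exp_ofReal_mul_I _

/-- The half-open cell is a measurable fundamental domain: the bijection with the torus preserves
measure, so no compatibility of `f` at the boundary is needed. -/
lemma exists_torus_lift {f : (Fin 2 → ℝ) → ℂ} (hf : MemLp f 2 (volume.restrict unitCell)) :
    ∃ F : UnitAddTorus (Fin 2) → ℂ, MemLp F 2 volume ∧
      ∀ x ∈ unitCell, F (fun i => (x i : UnitAddCircle)) = f x := by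
  let a : Fin 2 → ℝ := fun _ => -(1 / 2)
  have hmp : MeasurePreserving (fun t => ((UnitAddTorus.measurableEquivPiIoc a t).1 : Fin 2 → ℝ))
      volume (volume.restrict unitCell) := by
    have h1 : MeasurePreserving
        (Subtype.val : {x : Fin 2 → ℝ // ∀ i, x i ∈ Set.Ioc (a i) (a i + 1)} → Fin 2 → ℝ)
        (Measure.comap Subtype.val volume) (volume.restrict unitCell) :=
      ⟨measurable_subtype_coe, map_comap_subtype_coe measurableSet_unitCell volume⟩
    exact h1.comp (UnitAddTorus.measurePreserving_equivPiIoc a)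
  refine ⟨fun t => f (UnitAddTorus.measurableEquivPiIoc a t).1, hf.comp_measurePreserving hmp, ?_⟩
  intro x hx
  have := (UnitAddTorus.measurableEquivPiIoc a).apply_symm_apply ⟨x, hx⟩
  rw [UnitAddTorus.coe_symm_measurableEquivPiIoc_apply] at this
  simp only [this]

/-- Parseval's identity on the unit cell. -/
lemma hasSum_conj_coeff_mul_coeff {f g : (Fin 2 → ℝ) → ℂ}
    (hf : MemLp f 2 (volume.restrict unitCell)) (hg : MemLp g 2 (volume.restrict unitCell)) :
    HasSum (fun n => (starRingEnd ℂ) (∫ x in unitCell, latChar n x * f x) *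
      ∫ x in unitCell, latChar n x * g x)
      (∫ x in unitCell, (starRingEnd ℂ) (f x) * g x) := by
  obtain ⟨F, hF, hFf⟩ := exists_torus_lift hf
  obtain ⟨G, hG, hGg⟩ := exists_torus_lift hg
  have key := UnitAddTorus.hasSum_prod_mFourierCoeff (hF.toLp F) (hG.toLp G)
  have hc : ∀ (H : UnitAddTorus (Fin 2) → ℂ) (hH : MemLp H 2 volume) (h : (Fin 2 → ℝ) → ℂ),
      (∀ x ∈ unitCell, H (fun i => (x i : UnitAddCircle)) = h x) → ∀ n,
      UnitAddTorus.mFourierCoeff (hH.toLp H) n = ∫ x in unitCell, latChar (-n) x * h x := by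
    intro H hH h hh n
    have : UnitAddTorus.mFourierCoeff (hH.toLp H) n = UnitAddTorus.mFourierCoeff H n := by
      unfold UnitAddTorus.mFourierCoeff
      apply integral_congr_ae
      filter_upwards [hH.coeFn_toLp] with t ht
      rw [ht]
    rw [this, UnitAddTorus.mFourierCoeff_eq_integral H n (fun _ => -(1 / 2))]
    refine setIntegral_congr_fun measurableSet_unitCell ?_
    intro x hx
    simp only [smul_eq_mul]
    rw [mFourier_coe, hh x hx]
  have hint : (∫ t, (starRingEnd ℂ) (hF.toLp F t) * hG.toLp G t) =
      ∫ x in unitCell, (starRingEnd ℂ) (f x) * g x := by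
    have h1 : (∫ t, (starRingEnd ℂ) (hF.toLp F t) * hG.toLp G t) =
        ∫ t, (starRingEnd ℂ) (F t) * G t := by
      apply integral_congr_ae
      filter_upwards [hF.coeFn_toLp, hG.coeFn_toLp] with t ht ht'
      rw [ht, ht']
    rw [h1, UnitAddTorus.integral_preimage _ (fun _ => -(1 / 2))]
    refine setIntegral_congr_fun measurableSet_unitCell ?_
    intro x hx
    simp only
    rw [hFf x hx, hGg x hx]
  rw [hint] at key
  -- Torus coefficients pair with the conjugate character, whence the reflection of the index.
  rw [← (Equiv.neg (Fin 2 → ℤ)).hasSum_iff] at key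
  refine key.congr_fun ?_
  intro n
  simp only [Function.comp, Equiv.neg_apply]
  rw [hc F hF f hFf, hc G hG g hGg, neg_neg]

end UnitCell

/-! ### Tiling by integer translates of the unit cell -/

/-- An integer vector as a vector of reals. -/
def intVec (k : Fin 2 → ℤ) : Fin 2 → ℝ := fun i => k i

lemma intVec_add (k l : Fin 2 → ℤ) : intVec (k + l) = intVec k + intVec l := by
  ext i; simp [intVec]

lemma latChar_add_intVec (n k : Fin 2 → ℤ) (x : Fin 2 → ℝ) :
    latChar n (x + intVec k) = latChar n x := by
  unfold latChar intVec
  rw [Complex.exp_eq_exp_iff_exists_int]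
  refine ⟨∑ i, n i * k i, ?_⟩
  simp only [Fin.sum_univ_two, Pi.add_apply]
  push_cast
  ring

lemma iUnion_translate_unitCell :
    (⋃ k : Fin 2 → ℤ, (fun x => x + intVec k) ⁻¹' unitCell) = Set.univ := by
  rw [Set.eq_univ_iff_forall]
  intro x
  rw [Set.mem_iUnion]
  -- The cell is open on the left and closed on the right, hence a ceiling rather than a floor.
  refine ⟨fun i => -⌈x i - 1 / 2⌉, fun i => ?_⟩
  simp only [Pi.add_apply, intVec, Set.mem_Ioc]
  have h1 := Int.ceil_lt_add_one (x i - 1 / 2)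
  have h2 := Int.le_ceil (x i - 1 / 2)
  push_cast
  constructor <;> linarith

lemma pairwise_disjoint_translate_unitCell :
    Pairwise (Function.onFun Disjoint
      (fun k : Fin 2 → ℤ => (fun x => x + intVec k) ⁻¹' unitCell)) := by
  intro k l hkl
  rw [Function.onFun, Set.disjoint_left]
  intro x hx hy
  apply hkl
  ext i
  have h1 := hx i
  have h2 := hy i
  simp only [Pi.add_apply, intVec, Set.mem_Ioc] at h1 h2
  have h3 : ((k i - l i : ℤ) : ℝ) < 1 := by push_cast; linarith [h1.2, h2.1]
  have h4 : (-1 : ℝ) < ((k i - l i : ℤ) : ℝ) := by push_cast; linarith [h1.1, h2.2]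
  have h5 : k i - l i < 1 := by exact_mod_cast h3
  have h6 : -1 < k i - l i := by exact_mod_cast h4
  omega

lemma measurableSet_translate_unitCell (k : Fin 2 → ℤ) :
    MeasurableSet ((fun x => x + intVec k) ⁻¹' unitCell) :=
  measurableSet_unitCell.preimage (measurable_add_const _)

lemma lintegral_eq_tsum_unitCell (f : (Fin 2 → ℝ) → ℝ≥0∞) :
    ∫⁻ x, f x = ∑' k : Fin 2 → ℤ, ∫⁻ x in unitCell, f (x + intVec k) := by
  rw [← setLIntegral_univ, ← iUnion_translate_unitCell,
    lintegral_iUnion measurableSet_translate_unitCell pairwise_disjoint_translate_unitCell,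
    -- The preimage of the cell under translation by `intVec k` is the cell shifted by `-k`.
    ← (Equiv.neg (Fin 2 → ℤ)).tsum_eq]
  refine tsum_congr fun k => ?_
  have hmp : MeasurePreserving (fun x : Fin 2 → ℝ => x + intVec k) volume volume :=
    measurePreserving_add_right _ _
  have he : MeasurableEmbedding (fun x : Fin 2 → ℝ => x + intVec k) :=
    measurableEmbedding_addRight _
  have hs : (fun x : Fin 2 → ℝ => x + intVec k) ⁻¹'
      ((fun x => x + intVec ((Equiv.neg (Fin 2 → ℤ)) k)) ⁻¹' unitCell) = unitCell := by
    rw [← Set.preimage_comp]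
    convert Set.preimage_id using 2
    ext x i
    simp [intVec]
  rw [← hmp.setLIntegral_comp_preimage_emb he, hs]

lemma integral_eq_tsum_unitCell {f : (Fin 2 → ℝ) → ℂ} (hf : Integrable f) :
    ∫ x, f x = ∑' k : Fin 2 → ℤ, ∫ x in unitCell, f (x + intVec k) := by
  rw [← setIntegral_univ, ← iUnion_translate_unitCell,
    integral_iUnion measurableSet_translate_unitCell pairwise_disjoint_translate_unitCell
      hf.integrableOn,
    ← (Equiv.neg (Fin 2 → ℤ)).tsum_eq]
  refine tsum_congr fun k => ?_
  have hmp : MeasurePreserving (fun x : Fin 2 → ℝ => x + intVec k) volume volume :=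
    measurePreserving_add_right _ _
  have he : MeasurableEmbedding (fun x : Fin 2 → ℝ => x + intVec k) :=
    measurableEmbedding_addRight _
  have hs : (fun x : Fin 2 → ℝ => x + intVec k) ⁻¹'
      ((fun x => x + intVec ((Equiv.neg (Fin 2 → ℤ)) k)) ⁻¹' unitCell) = unitCell := by
    rw [← Set.preimage_comp]
    convert Set.preimage_id using 2
    ext x i
    simp [intVec]
  rw [← hmp.setIntegral_preimage_emb he f, hs]

/-! ### Periodization -/

lemma eLpNorm_two_sq {α E : Type*} [MeasurableSpace α] [NormedAddCommGroup E] {μ : Measure α}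
    (f : α → E) : eLpNorm f 2 μ ^ 2 = ∫⁻ x, ‖f x‖ₑ ^ 2 ∂μ := by
  have := eLpNorm_nnreal_pow_eq_lintegral (μ := μ) (f := f) (p := 2) two_ne_zero
  simpa using this

lemma eLpNorm_two_count_sq {ι E : Type*} [MeasurableSpace ι] [MeasurableSingletonClass ι]
    [NormedAddCommGroup E] (c : ι → E) : eLpNorm c 2 Measure.count ^ 2 = ∑' n, ‖c n‖ₑ ^ 2 := by
  rw [eLpNorm_two_sq, lintegral_count]

lemma ennreal_le_of_sq_le {a b : ℝ≥0∞} (h : a ^ 2 ≤ b ^ 2) : a ≤ b :=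
  (ENNReal.pow_le_pow_left_iff two_ne_zero).1 h

/-- Cauchy–Schwarz, as Hölder's inequality for counting measure on the discrete σ-algebra; in `ℝ≥0∞`
there is no convergence to check. -/
lemma ennreal_tsum_mul_sq_le {ι : Type*} (a b : ι → ℝ≥0∞) :
    (∑' i, a i * b i) ^ 2 ≤ (∑' i, a i ^ 2) * ∑' i, b i ^ 2 := by
  let _ : MeasurableSpace ι := ⊤
  have h := ENNReal.lintegral_mul_le_Lp_mul_Lq (Measure.count : Measure ι)
    Real.HolderConjugate.two_two (f := a) (g := b) measurable_from_top.aemeasurable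
    measurable_from_top.aemeasurable
  simp only [lintegral_count, Pi.mul_apply, ENNReal.rpow_ofNat] at h
  calc (∑' i, a i * b i) ^ 2 ≤ ((∑' i, a i ^ 2) ^ (1 / 2 : ℝ) * (∑' i, b i ^ 2) ^ (1 / 2 : ℝ)) ^ 2 :=
        by gcongr
    _ = _ := by
        rw [mul_pow, ← ENNReal.rpow_natCast, ← ENNReal.rpow_mul, ← ENNReal.rpow_natCast,
          ← ENNReal.rpow_mul]
        norm_num

/-- The second absolute moment, in `L²`, of a function of lattice coordinates. -/
def quadMoment (Φ : (Fin 2 → ℝ) → ℂ) : ℝ≥0∞ :=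
  eLpNorm (fun η => (‖η‖ ^ 2 : ℝ) • Φ η) 2 volume

/-- The sum of the absolute values over the nonzero integer translates. -/
def tailSum (Φ : (Fin 2 → ℝ) → ℂ) (η : Fin 2 → ℝ) : ℝ≥0∞ :=
  ∑' k : Fin 2 → ℤ, if k = 0 then 0 else ‖Φ (η + intVec k)‖ₑ

/-- The sum of the absolute values over all integer translates. -/
def absSum (Φ : (Fin 2 → ℝ) → ℂ) (η : Fin 2 → ℝ) : ℝ≥0∞ :=
  ∑' k : Fin 2 → ℤ, ‖Φ (η + intVec k)‖ₑ

/-- The periodization of a function. -/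
def periodize (Φ : (Fin 2 → ℝ) → ℂ) (η : Fin 2 → ℝ) : ℂ := ∑' k : Fin 2 → ℤ, Φ (η + intVec k)

lemma intVec_zero : intVec 0 = 0 := by ext; simp [intVec]

lemma absSum_eq (Φ : (Fin 2 → ℝ) → ℂ) (η : Fin 2 → ℝ) :
    absSum Φ η = ‖Φ η‖ₑ + tailSum Φ η := by
  unfold absSum tailSum
  rw [ENNReal.tsum_eq_add_tsum_ite (0 : Fin 2 → ℤ), intVec_zero, add_zero]
  congr! 4

lemma norm_intVec (k : Fin 2 → ℤ) : ‖intVec k‖ = ‖k‖ := by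
  simp only [Pi.norm_def, intVec]
  congr 1

lemma one_le_norm_of_ne_zero {k : Fin 2 → ℤ} (hk : k ≠ 0) : 1 ≤ ‖k‖ := by
  obtain ⟨i, hi⟩ := Function.ne_iff.1 hk
  refine le_trans ?_ (norm_le_pi_norm k i)
  rw [Int.norm_eq_abs]
  exact_mod_cast Int.one_le_abs hi

lemma norm_le_half_of_mem_unitCell {η : Fin 2 → ℝ} (h : η ∈ unitCell) : ‖η‖ ≤ 1 / 2 := by
  rw [pi_norm_le_iff_of_nonneg (by norm_num)]
  intro i
  rw [Real.norm_eq_abs, abs_le]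
  have := h i
  constructor <;> linarith [this.1, this.2]

lemma half_le_norm_of_notMem_unitCell {η : Fin 2 → ℝ} (h : η ∉ unitCell) : 1 / 2 ≤ ‖η‖ := by
  by_contra! hlt
  apply h
  intro i
  have := (norm_le_pi_norm η i).trans_lt hlt
  rw [Real.norm_eq_abs, abs_lt] at this
  exact ⟨this.1, by linarith [this.2]⟩

/-- The lattice sum `∑ ‖k‖⁻⁴`, which controls aliasing errors. -/
def latSum : ℝ≥0∞ := ∑' k : Fin 2 → ℤ, (ENNReal.ofReal ((‖k‖ ^ 2)⁻¹)) ^ 2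

/-- The exponent four exceeds the dimension two. The term at `k = 0` is zero because the inverse of
zero is zero. -/
lemma latSum_lt_top : latSum < ⊤ := by
  have h := EisensteinSeries.summable_one_div_norm_rpow (k := 4) (by norm_num)
  have h2 : latSum = ∑' k : Fin 2 → ℤ, ENNReal.ofReal (‖k‖ ^ (-4 : ℝ)) := by
    refine tsum_congr fun k => ?_
    rw [← ENNReal.ofReal_pow (by positivity)]
    congr 1
    rw [Real.rpow_neg (norm_nonneg _), inv_pow, ← pow_mul]
    norm_cast
  rw [h2, ← ENNReal.ofReal_tsum_of_nonneg (fun k => by positivity) h]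
  exact ENNReal.ofReal_lt_top

/-- For `η` in the cell and `k ≠ 0`, `‖η‖ ≤ 1/2 ≤ ‖k‖/2` forces `‖η + k‖ ≥ ‖k‖/2`, so a factor
`‖k‖⁻² · 4‖η + k‖²` can be inserted at no cost. Cauchy–Schwarz then separates `‖k‖⁻²` from the
moment; the constant 16 is the square of 4. -/
lemma tailSum_sq_le {Φ : (Fin 2 → ℝ) → ℂ} {η : Fin 2 → ℝ} (hη : η ∈ unitCell) :
    tailSum Φ η ^ 2 ≤ latSum * ∑' k : Fin 2 → ℤ,
      16 * ‖(‖η + intVec k‖ ^ 2 : ℝ) • Φ (η + intVec k)‖ₑ ^ 2 := by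
  have hb : ∀ k : Fin 2 → ℤ, 16 * ‖(‖η + intVec k‖ ^ 2 : ℝ) • Φ (η + intVec k)‖ₑ ^ 2 =
      (4 * ‖(‖η + intVec k‖ ^ 2 : ℝ) • Φ (η + intVec k)‖ₑ) ^ 2 := by
    intro k; rw [mul_pow]; norm_num
  simp_rw [hb]
  refine le_trans ?_ (ennreal_tsum_mul_sq_le _ _)
  gcongr
  refine ENNReal.tsum_le_tsum fun k => ?_
  split_ifs with hk
  · simp
  have h1 := one_le_norm_of_ne_zero hk
  have h2 : ‖k‖ / 2 ≤ ‖η + intVec k‖ := by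
    have := norm_sub_norm_le (intVec k) (-η)
    rw [sub_neg_eq_add, norm_neg, norm_intVec, add_comm] at this
    linarith [norm_le_half_of_mem_unitCell hη]
  have h3 : 1 ≤ (‖k‖ ^ 2)⁻¹ * (4 * ‖η + intVec k‖ ^ 2) := by
    rw [inv_mul_eq_div, le_div_iff₀ (by positivity)]
    nlinarith
  have h4 : (4 : ℝ≥0∞) * ‖(‖η + intVec k‖ ^ 2 : ℝ) • Φ (η + intVec k)‖ₑ =
      ENNReal.ofReal (4 * ‖η + intVec k‖ ^ 2) * ‖Φ (η + intVec k)‖ₑ := by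
    rw [enorm_smul, ENNReal.ofReal_mul (by norm_num), Real.enorm_of_nonneg (by positivity),
      mul_assoc]
    norm_num
  rw [h4, ← mul_assoc, ← ENNReal.ofReal_mul (by positivity)]
  calc ‖Φ (η + intVec k)‖ₑ = ENNReal.ofReal 1 * ‖Φ (η + intVec k)‖ₑ := by simp
    _ ≤ _ := by gcongr

lemma aestronglyMeasurable_translate {Φ : (Fin 2 → ℝ) → ℂ} (hΦ : AEStronglyMeasurable Φ volume)
    (k : Fin 2 → ℤ) : AEStronglyMeasurable (fun η => Φ (η + intVec k)) volume :=
  hΦ.comp_measurePreserving (measurePreserving_add_right _ _)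

/-- Integrating the pointwise bound over the cell reassembles its translates into the whole plane.
-/
lemma lintegral_tailSum_sq_le {Φ : (Fin 2 → ℝ) → ℂ} (hΦ : AEStronglyMeasurable Φ volume) :
    ∫⁻ η in unitCell, tailSum Φ η ^ 2 ≤ 16 * latSum * quadMoment Φ ^ 2 := by
  calc ∫⁻ η in unitCell, tailSum Φ η ^ 2
      ≤ ∫⁻ η in unitCell, latSum * ∑' k : Fin 2 → ℤ,
          16 * ‖(‖η + intVec k‖ ^ 2 : ℝ) • Φ (η + intVec k)‖ₑ ^ 2 :=
        setLIntegral_mono' measurableSet_unitCell fun η hη => tailSum_sq_le hη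
    _ = 16 * latSum * quadMoment Φ ^ 2 := by
        have hm : AEStronglyMeasurable (fun η => (‖η‖ ^ 2 : ℝ) • Φ η) volume :=
          (continuous_norm.pow 2).aestronglyMeasurable.smul hΦ
        rw [quadMoment, eLpNorm_two_sq, lintegral_eq_tsum_unitCell,
          lintegral_const_mul'' _ (AEMeasurable.tsum fun k => by
            exact ((((hm.comp_measurePreserving
              (measurePreserving_add_right volume (intVec k))).enorm).pow_const 2).const_mul
                16).restrict),
          lintegral_tsum]
        · simp_rw [lintegral_const_mul' (16 : ℝ≥0∞) _ (by norm_num)]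
          rw [ENNReal.tsum_mul_left]
          ring
        · intro k
          exact ((((hm.comp_measurePreserving
              (measurePreserving_add_right volume (intVec k))).enorm).pow_const 2).const_mul
                16).restrict

/-- Functions whose periodization is square integrable over the unit cell. -/
structure Decaying (Φ : (Fin 2 → ℝ) → ℂ) : Prop where
  memLp : MemLp Φ 2 volume
  quad : quadMoment Φ < ⊤

lemma lintegral_absSum_sq_lt_top {Φ : (Fin 2 → ℝ) → ℂ} (h : Decaying Φ) :
    ∫⁻ η in unitCell, absSum Φ η ^ 2 < ⊤ := by
  have hle : ∀ η, absSum Φ η ^ 2 ≤ 2 * (‖Φ η‖ₑ ^ 2 + tailSum Φ η ^ 2) := by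
    intro η
    rw [absSum_eq]
    have := ENNReal.rpow_add_le_mul_rpow_add_rpow ‖Φ η‖ₑ (tailSum Φ η) (p := 2) (by norm_num)
    norm_num at this
    exact this
  refine (lintegral_mono hle).trans_lt ?_
  rw [lintegral_const_mul' _ _ (by norm_num),
    lintegral_add_left' ((h.memLp.1.enorm.pow_const 2).restrict)]
  refine ENNReal.mul_lt_top (by norm_num) (ENNReal.add_lt_top.2 ⟨?_, ?_⟩)
  · refine (setLIntegral_le_lintegral _ _).trans_lt ?_
    rw [← eLpNorm_two_sq]
    exact ENNReal.pow_lt_top h.memLp.2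
  · refine (lintegral_tailSum_sq_le h.memLp.1).trans_lt ?_
    exact ENNReal.mul_lt_top (ENNReal.mul_lt_top (by norm_num) latSum_lt_top)
      (ENNReal.pow_lt_top h.quad)

lemma aemeasurable_absSum {Φ : (Fin 2 → ℝ) → ℂ} (hΦ : AEStronglyMeasurable Φ volume) :
    AEMeasurable (absSum Φ) volume :=
  AEMeasurable.tsum fun k => (aestronglyMeasurable_translate hΦ k).enorm

lemma volume_unitCell_lt_top : (volume : Measure (Fin 2 → ℝ)) unitCell < ⊤ := by
  refine (measure_mono (t := Metric.closedBall 0 (1 / 2)) fun η hη => ?_).trans_lt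
    measure_closedBall_lt_top
  simpa using norm_le_half_of_mem_unitCell hη

lemma lintegral_absSum_mul_absSum_lt_top {Φ Ψ : (Fin 2 → ℝ) → ℂ} (h : Decaying Φ)
    (h' : Decaying Ψ) : ∫⁻ η in unitCell, absSum Φ η * absSum Ψ η < ⊤ := by
  have := ENNReal.lintegral_mul_le_Lp_mul_Lq (volume.restrict unitCell)
    Real.HolderConjugate.two_two (aemeasurable_absSum h.memLp.1).restrict
    (aemeasurable_absSum h'.memLp.1).restrict
  refine this.trans_lt (ENNReal.mul_lt_top ?_ ?_)
  · refine ENNReal.rpow_lt_top_of_nonneg (by norm_num) (ne_of_lt ?_)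
    simpa using lintegral_absSum_sq_lt_top h
  · refine ENNReal.rpow_lt_top_of_nonneg (by norm_num) (ne_of_lt ?_)
    simpa using lintegral_absSum_sq_lt_top h'

lemma lintegral_absSum_lt_top {Φ : (Fin 2 → ℝ) → ℂ} (h : Decaying Φ) :
    ∫⁻ η in unitCell, absSum Φ η < ⊤ := by
  have := ENNReal.lintegral_mul_le_Lp_mul_Lq (volume.restrict unitCell)
    Real.HolderConjugate.two_two (aemeasurable_absSum h.memLp.1).restrict
    (g := 1) aemeasurable_const
  rw [mul_one] at this
  refine this.trans_lt (ENNReal.mul_lt_top ?_ ?_)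
  · refine ENNReal.rpow_lt_top_of_nonneg (by norm_num) (ne_of_lt ?_)
    simpa using lintegral_absSum_sq_lt_top h
  · refine ENNReal.rpow_lt_top_of_nonneg (by norm_num) (ne_of_lt ?_)
    simpa using volume_unitCell_lt_top

lemma lintegral_enorm_eq_lintegral_absSum {Φ : (Fin 2 → ℝ) → ℂ}
    (hΦ : AEStronglyMeasurable Φ volume) :
    ∫⁻ η, ‖Φ η‖ₑ = ∫⁻ η in unitCell, absSum Φ η := by
  rw [lintegral_eq_tsum_unitCell]
  unfold absSum
  rw [lintegral_tsum fun k => (aestronglyMeasurable_translate hΦ k).enorm.restrict]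

/-- The plane is folded onto the cell, which has finite measure and on which `absSum Φ` is square
integrable. -/
lemma Decaying.integrable {Φ : (Fin 2 → ℝ) → ℂ} (h : Decaying Φ) : Integrable Φ := by
  refine ⟨h.memLp.1, ?_⟩
  rw [hasFiniteIntegral_iff_enorm, lintegral_enorm_eq_lintegral_absSum h.memLp.1]
  exact lintegral_absSum_lt_top h

lemma ae_absSum_lt_top {Φ : (Fin 2 → ℝ) → ℂ} (h : Decaying Φ) :
    ∀ᵐ η ∂(volume.restrict unitCell), absSum Φ η < ⊤ :=
  ae_lt_top' (aemeasurable_absSum h.memLp.1).restrict (lintegral_absSum_lt_top h).ne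

lemma summable_norm_of_absSum_lt_top {Φ : (Fin 2 → ℝ) → ℂ} {η : Fin 2 → ℝ}
    (h : absSum Φ η < ⊤) : Summable fun k => ‖Φ (η + intVec k)‖ := by
  rw [← tsum_enorm_ne_top_iff_summable_norm]
  exact h.ne

lemma aestronglyMeasurable_periodize {Φ : (Fin 2 → ℝ) → ℂ} (h : Decaying Φ) :
    AEStronglyMeasurable (periodize Φ) (volume.restrict unitCell) := by
  refine aestronglyMeasurable_of_tendsto_ae atTop
    (f := fun (s : Finset (Fin 2 → ℤ)) η => ∑ k ∈ s, Φ (η + intVec k)) (fun s => ?_) ?_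
  · exact Finset.aestronglyMeasurable_fun_sum s
      fun k _ => (aestronglyMeasurable_translate h.memLp.1 k).restrict
  · filter_upwards [ae_absSum_lt_top h] with η hη
    exact (summable_norm_of_absSum_lt_top hη).of_norm.hasSum

lemma enorm_periodize_le (Φ : (Fin 2 → ℝ) → ℂ) (η : Fin 2 → ℝ) :
    ‖periodize Φ η‖ₑ ≤ absSum Φ η := enorm_tsum_le_tsum_enorm

lemma enorm_periodize_sub_le {Φ : (Fin 2 → ℝ) → ℂ} {η : Fin 2 → ℝ} (h : absSum Φ η < ⊤) :
    ‖periodize Φ η - Φ η‖ₑ ≤ tailSum Φ η := by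
  have hs := (summable_norm_of_absSum_lt_top h).of_norm
  unfold periodize tailSum
  rw [hs.tsum_eq_add_tsum_ite (0 : Fin 2 → ℤ), intVec_zero, add_zero, add_sub_cancel_left]
  refine enorm_tsum_le_tsum_enorm.trans (ENNReal.tsum_le_tsum fun k => ?_)
  split_ifs <;> simp

lemma memLp_periodize {Φ : (Fin 2 → ℝ) → ℂ} (h : Decaying Φ) :
    MemLp (periodize Φ) 2 (volume.restrict unitCell) := by
  refine ⟨aestronglyMeasurable_periodize h, ?_⟩
  refine (ENNReal.pow_lt_top_iff.1 (?_ : eLpNorm _ 2 _ ^ 2 < ⊤)).resolve_right two_ne_zero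
  · rw [eLpNorm_two_sq]
    refine lt_of_le_of_lt (lintegral_mono fun η => ?_) (lintegral_absSum_sq_lt_top h)
    gcongr
    exact enorm_periodize_le Φ η

/-- The Fourier coefficients of the periodization. -/
lemma integral_latChar_mul_periodize {Φ : (Fin 2 → ℝ) → ℂ} (h : Decaying Φ) (n : Fin 2 → ℤ) :
    ∫ η in unitCell, latChar n η * periodize Φ η = ∫ η, latChar n η * Φ η := by
  have hint : Integrable (fun η => latChar n η * Φ η) :=
    h.integrable.bdd_mul (continuous_latChar n).aestronglyMeasurable
      (ae_of_all _ fun η => (norm_latChar n η).le)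
  rw [integral_eq_tsum_unitCell hint]
  simp_rw [latChar_add_intVec]
  rw [← integral_tsum]
  · simp_rw [periodize, tsum_mul_left]
  · intro k
    exact ((continuous_latChar n).aestronglyMeasurable.mul
      (aestronglyMeasurable_translate h.memLp.1 k)).restrict
  · have : ∀ (k : Fin 2 → ℤ) (η : Fin 2 → ℝ), ‖latChar n η * Φ (η + intVec k)‖ₑ =
        ‖Φ (η + intVec k)‖ₑ := by
      intro k η
      rw [enorm_mul, ← ofReal_norm (latChar n η), norm_latChar]
      simp
    simp_rw [this]
    rw [← lintegral_tsum fun k => (aestronglyMeasurable_translate h.memLp.1 k).enorm.restrict]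
    exact (lintegral_absSum_lt_top h).ne

/-- The Fourier integral of `Φ` at lattice points. -/
def latCoeff (Φ : (Fin 2 → ℝ) → ℂ) (n : Fin 2 → ℤ) : ℂ := ∫ η, latChar n η * Φ η

/-! ### Sampling inequalities from Parseval and aliasing -/

lemma hasSum_conj_latCoeff_mul {Φ Ψ : (Fin 2 → ℝ) → ℂ} (h : Decaying Φ) (h' : Decaying Ψ) :
    HasSum (fun n => (starRingEnd ℂ) (latCoeff Φ n) * latCoeff Ψ n)
      (∫ η in unitCell, (starRingEnd ℂ) (periodize Φ η) * periodize Ψ η) := by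
  have := hasSum_conj_coeff_mul_coeff (memLp_periodize h) (memLp_periodize h')
  simp_rw [integral_latChar_mul_periodize h, integral_latChar_mul_periodize h'] at this
  exact this

/-- Fourier integrals of `Φ` over the plane at lattice points are Fourier coefficients of its
periodization, so Parseval is exact here; the only loss in the sampling inequalities lies in
comparing `periodize Φ` with `Φ`. -/
lemma eLpNorm_latCoeff {Φ : (Fin 2 → ℝ) → ℂ} (h : Decaying Φ) :
    eLpNorm (latCoeff Φ) 2 Measure.count = eLpNorm (periodize Φ) 2 (volume.restrict unitCell) := by
  have hs := hasSum_conj_latCoeff_mul h h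
  have hm := memLp_periodize h
  simp_rw [mul_comm ((starRingEnd ℂ) _), Complex.mul_conj, Complex.normSq_eq_norm_sq] at hs
  rw [integral_complex_ofReal, Complex.hasSum_ofReal] at hs
  rw [← (ENNReal.pow_right_strictMono two_ne_zero).injective.eq_iff, eLpNorm_two_count_sq,
    eLpNorm_two_sq]
  have e1 : ∀ z : ℂ, ‖z‖ₑ ^ 2 = ENNReal.ofReal (‖z‖ ^ 2) := by
    intro z; rw [← ofReal_norm, ENNReal.ofReal_pow (norm_nonneg _)]
  simp_rw [e1]
  rw [← ENNReal.ofReal_tsum_of_nonneg (fun n => by positivity) hs.summable, hs.tsum_eq,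
    ofReal_integral_eq_lintegral_ofReal]
  · exact hm.integrable_norm_pow two_ne_zero
  · exact ae_of_all _ fun η => by positivity

/-- The constant in the aliasing estimates. -/
def aliasConst : ℝ≥0∞ := (16 * latSum) ^ (1 / 2 : ℝ) + 4

lemma aliasConst_lt_top : aliasConst < ⊤ :=
  ENNReal.add_lt_top.2 ⟨ENNReal.rpow_lt_top_of_nonneg (by norm_num)
    (ENNReal.mul_lt_top (by norm_num) latSum_lt_top).ne, by norm_num⟩

lemma eLpNorm_periodize_sub_le {Φ : (Fin 2 → ℝ) → ℂ} (h : Decaying Φ) :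
    eLpNorm (fun η => periodize Φ η - Φ η) 2 (volume.restrict unitCell) ≤
      (16 * latSum) ^ (1 / 2 : ℝ) * quadMoment Φ := by
  apply ennreal_le_of_sq_le
  rw [eLpNorm_two_sq, mul_pow, ← ENNReal.rpow_natCast ((16 * latSum) ^ (1 / 2 : ℝ)),
    ← ENNReal.rpow_mul]
  norm_num
  refine le_trans (lintegral_mono_ae ?_) (lintegral_tailSum_sq_le h.memLp.1)
  filter_upwards [ae_absSum_lt_top h] with η hη
  gcongr
  exact enorm_periodize_sub_le hη

/-- Sampling at lattice points is bounded in `L²`, up to an aliasing error. -/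
lemma eLpNorm_latCoeff_le {Φ : (Fin 2 → ℝ) → ℂ} (h : Decaying Φ) :
    eLpNorm (latCoeff Φ) 2 Measure.count ≤ eLpNorm Φ 2 volume + aliasConst * quadMoment Φ := by
  rw [eLpNorm_latCoeff h]
  have hm := (memLp_periodize h).1
  calc eLpNorm (periodize Φ) 2 (volume.restrict unitCell)
      = eLpNorm (Φ + fun η => periodize Φ η - Φ η) 2 (volume.restrict unitCell) := by
        congr 1; ext η; simp
    _ ≤ eLpNorm Φ 2 (volume.restrict unitCell) +
        eLpNorm (fun η => periodize Φ η - Φ η) 2 (volume.restrict unitCell) :=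
        eLpNorm_add_le h.memLp.1.restrict (hm.sub h.memLp.1.restrict) (by norm_num)
    _ ≤ _ := by
        gcongr
        · exact Measure.restrict_le_self
        · refine (eLpNorm_periodize_sub_le h).trans ?_
          gcongr
          exact le_self_add

/-- Outside the cell `‖η‖ ≥ 1/2`, hence `1 ≤ 4‖η‖²`. This accounts for the summand 4 in
`aliasConst`. -/
lemma eLpNorm_compl_unitCell_le (Φ : (Fin 2 → ℝ) → ℂ) :
    eLpNorm Φ 2 (volume.restrict unitCellᶜ) ≤ 4 * quadMoment Φ := by
  calc eLpNorm Φ 2 (volume.restrict unitCellᶜ)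
      ≤ eLpNorm (fun η => (4 : ℝ) • ((‖η‖ ^ 2 : ℝ) • Φ η)) 2 (volume.restrict unitCellᶜ) := by
        refine eLpNorm_mono_ae ?_
        filter_upwards [ae_restrict_mem measurableSet_unitCell.compl] with η hη
        have := half_le_norm_of_notMem_unitCell hη
        rw [norm_smul, norm_smul, Real.norm_of_nonneg (by norm_num),
          Real.norm_of_nonneg (by positivity), ← mul_assoc]
        exact le_mul_of_one_le_left (norm_nonneg _) (by nlinarith)
    _ ≤ eLpNorm (fun η => (4 : ℝ) • ((‖η‖ ^ 2 : ℝ) • Φ η)) 2 volume :=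
        eLpNorm_mono_measure _ Measure.restrict_le_self
    _ = 4 * quadMoment Φ := by
        have := eLpNorm_const_smul (4 : ℝ) (fun η => (‖η‖ ^ 2 : ℝ) • Φ η) 2
          (volume : Measure (Fin 2 → ℝ))
        rw [quadMoment]
        refine Eq.trans this ?_
        rw [Real.enorm_of_nonneg (by norm_num)]
        norm_num

/-- The `L²` norm is bounded by that of the samples, up to an aliasing error. -/
lemma eLpNorm_le_latCoeff {Φ : (Fin 2 → ℝ) → ℂ} (h : Decaying Φ) :
    eLpNorm Φ 2 volume ≤ eLpNorm (latCoeff Φ) 2 Measure.count + aliasConst * quadMoment Φ := by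
  rw [eLpNorm_latCoeff h]
  have hm := (memLp_periodize h).1
  -- The samples control `Φ` only on the cell; what lies outside has to be charged to the second
  -- moment.
  have h1 : eLpNorm Φ 2 volume ≤ eLpNorm Φ 2 (volume.restrict unitCell) +
      eLpNorm Φ 2 (volume.restrict unitCellᶜ) := by
    rw [← eLpNorm_indicator_eq_eLpNorm_restrict measurableSet_unitCell,
      ← eLpNorm_indicator_eq_eLpNorm_restrict measurableSet_unitCell.compl]
    refine le_trans (le_of_eq ?_) (eLpNorm_add_le (h.memLp.1.indicator measurableSet_unitCell)
      (h.memLp.1.indicator measurableSet_unitCell.compl) (by norm_num))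
    rw [Set.indicator_self_add_compl]
  have h2 : eLpNorm Φ 2 (volume.restrict unitCell) ≤
      eLpNorm (periodize Φ) 2 (volume.restrict unitCell) +
        eLpNorm (fun η => periodize Φ η - Φ η) 2 (volume.restrict unitCell) := by
    refine le_trans (le_of_eq ?_) (eLpNorm_sub_le hm (hm.sub h.memLp.1.restrict) (by norm_num))
    congr 1; ext η; simp
  calc _ ≤ _ := h1
    _ ≤ (eLpNorm (periodize Φ) 2 (volume.restrict unitCell) +
        (16 * latSum) ^ (1 / 2 : ℝ) * quadMoment Φ) + 4 * quadMoment Φ := by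
        gcongr
        · refine h2.trans ?_
          gcongr
          exact eLpNorm_periodize_sub_le h
        · exact eLpNorm_compl_unitCell_le Φ
    _ = _ := by rw [aliasConst, add_mul, add_assoc]

/-! ### Poisson summation in bilinear form -/

/-- The shear `(l, k) ↦ (k + l, k)`. -/
def shearEquiv : (Fin 2 → ℤ) × (Fin 2 → ℤ) ≃ (Fin 2 → ℤ) × (Fin 2 → ℤ) where
  toFun z := (z.2 + z.1, z.2)
  invFun z := (z.1 - z.2, z.2)
  left_inv z := by ext <;> simp
  right_inv z := by ext <;> simp

lemma enorm_conj (z : ℂ) : ‖(starRingEnd ℂ) z‖ₑ = ‖z‖ₑ := by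
  rw [← ofReal_norm, ← ofReal_norm, Complex.norm_conj]

/-- After the shear the two arguments carry independent shifts, and the double sum factors. -/
lemma tsum_shear_eq (Φ Ψ : (Fin 2 → ℝ) → ℂ) (η : Fin 2 → ℝ) :
    ∑' z : (Fin 2 → ℤ) × (Fin 2 → ℤ),
      ‖(starRingEnd ℂ) (Φ (η + intVec z.2 + intVec z.1)) * Ψ (η + intVec z.2)‖ₑ =
      absSum Φ η * absSum Ψ η := by
  have h1 := shearEquiv.tsum_eq (fun z : (Fin 2 → ℤ) × (Fin 2 → ℤ) =>
    ‖Φ (η + intVec z.1)‖ₑ * ‖Ψ (η + intVec z.2)‖ₑ)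
  simp_rw [enorm_mul, enorm_conj]
  simp only [shearEquiv, Equiv.coe_fn_mk, intVec_add, ← add_assoc] at h1
  rw [h1, ENNReal.tsum_prod']
  simp_rw [ENNReal.tsum_mul_left, ENNReal.tsum_mul_right]
  rfl

/-- The Poisson summation formula in bilinear form. -/
lemma hasSum_conj_latCoeff_mul_latCoeff {Φ Ψ : (Fin 2 → ℝ) → ℂ} (h : Decaying Φ)
    (h' : Decaying Ψ) :
    (Summable fun l => ∫ η, (starRingEnd ℂ) (Φ (η + intVec l)) * Ψ η) ∧
    HasSum (fun n => (starRingEnd ℂ) (latCoeff Φ n) * latCoeff Ψ n)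
      (∑' l, ∫ η, (starRingEnd ℂ) (Φ (η + intVec l)) * Ψ η) := by
  -- Here `z.1` is the relative shift of the two factors and `z.2` the cell of their common
  -- argument. Summing over `z.2` alone rebuilds an integral over the plane; summing over both gives
  -- the product of the periodizations.
  set F : (Fin 2 → ℤ) × (Fin 2 → ℤ) → (Fin 2 → ℝ) → ℂ := fun z η =>
    (starRingEnd ℂ) (Φ (η + intVec z.2 + intVec z.1)) * Ψ (η + intVec z.2) with hF
  have hm0 : ∀ l : Fin 2 → ℤ, AEStronglyMeasurable
      (fun η => (starRingEnd ℂ) (Φ (η + intVec l)) * Ψ η) volume := fun l =>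
    (Complex.continuous_conj.comp_aestronglyMeasurable
      (aestronglyMeasurable_translate h.memLp.1 l)).mul h'.memLp.1
  have hm : ∀ z, AEStronglyMeasurable (F z) volume := fun z =>
    (hm0 z.1).comp_measurePreserving (measurePreserving_add_right _ (intVec z.2))
  -- Absolute convergence of the double family, from which all interchanges below follow.
  have hfin : ∑' z, ∫⁻ η in unitCell, ‖F z η‖ₑ < ⊤ := by
    rw [← lintegral_tsum fun z => (hm z).enorm.restrict]
    simp_rw [hF, tsum_shear_eq]
    exact lintegral_absSum_mul_absSum_lt_top h h'
  have hfin' : ∑' l, ∫⁻ η, ‖(starRingEnd ℂ) (Φ (η + intVec l)) * Ψ η‖ₑ < ⊤ := by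
    simp_rw [lintegral_eq_tsum_unitCell (fun η => ‖(starRingEnd ℂ) (Φ (η + intVec _)) * Ψ η‖ₑ)]
    rw [ENNReal.tsum_prod'] at hfin
    exact hfin
  have hint : ∀ l, Integrable (fun η => (starRingEnd ℂ) (Φ (η + intVec l)) * Ψ η) := fun l =>
    ⟨hm0 l, (ENNReal.le_tsum l).trans_lt hfin'⟩
  have hsum : Summable fun z => ∫ η in unitCell, F z η := by
    apply Summable.of_norm
    rw [← tsum_enorm_ne_top_iff_summable_norm]
    exact ((ENNReal.tsum_le_tsum fun z => enorm_integral_le_lintegral_enorm _).trans_lt hfin).ne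
  have hl : ∀ l, ∫ η, (starRingEnd ℂ) (Φ (η + intVec l)) * Ψ η =
      ∑' k, ∫ η in unitCell, F (l, k) η := fun l => integral_eq_tsum_unitCell (hint l)
  have hcell : ∫ η in unitCell, (starRingEnd ℂ) (periodize Φ η) * periodize Ψ η =
      ∑' z, ∫ η in unitCell, F z η := by
    rw [← integral_tsum (fun z => (hm z).restrict) hfin.ne]
    apply integral_congr_ae
    filter_upwards [ae_absSum_lt_top h, ae_absSum_lt_top h'] with η h1 h2
    have s1 : Summable fun k => ‖(starRingEnd ℂ) (Φ (η + intVec k))‖ := by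
      simpa using summable_norm_of_absSum_lt_top h1
    have s2 := summable_norm_of_absSum_lt_top h2
    rw [periodize, periodize, Complex.conj_tsum, tsum_mul_tsum_of_summable_norm s1 s2,
      ← shearEquiv.tsum_eq]
    simp only [shearEquiv, Equiv.coe_fn_mk, intVec_add, ← add_assoc, hF]
  constructor
  · simp_rw [hl]
    exact hsum.prod
  · have := hasSum_conj_latCoeff_mul h h'
    rw [hcell, hsum.tsum_prod] at this
    simp_rw [hl]
    exact this

/-- Summable weights on the reciprocal lattice. -/
def latWeight (k : Fin 2 → ℤ) : ℝ := (max 1 ‖k‖ ^ 3)⁻¹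

lemma latWeight_pos (k : Fin 2 → ℤ) : 0 < latWeight k := by
  unfold latWeight; positivity

/-- The exponent three exceeds the dimension two; the maximum with 1 alters only the term at `k =
0`. -/
lemma summable_latWeight : Summable latWeight := by
  have h := EisensteinSeries.summable_one_div_norm_rpow (k := 3) (by norm_num)
  refine (Summable.congr_cofinite h ?_)
  rw [EventuallyEq, Filter.eventually_cofinite]
  refine (Set.finite_singleton (0 : Fin 2 → ℤ)).subset ?_
  intro k hk
  by_contra hk0
  apply hk
  have := one_le_norm_of_ne_zero hk0
  rw [latWeight, max_eq_right this, Real.rpow_neg (norm_nonneg _)]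
  norm_cast

/-! ### Fourier synthesis on the plane -/

/-- The superposition `∫ e^{i ξ·x} φ(ξ) dξ` of plane waves. -/
def synth (φ : Plane → ℂ) (x : Plane) : ℂ :=
  ∫ ξ, Complex.exp (Complex.I * (inner ℝ ξ x : ℝ)) * φ ξ

/-- The weight `1 + |ξ|²`. -/
def wt (ξ : Plane) : ℝ := 1 + ‖ξ‖ ^ 2

/-- The weighted norm `‖(1 + |ξ|²)^m φ‖_{L²}`. -/
def wNorm (m : ℕ) (φ : Plane → ℂ) : ℝ≥0∞ := eLpNorm (fun ξ => (wt ξ ^ m : ℝ) • φ ξ) 2 volume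

lemma one_le_wt (ξ : Plane) : 1 ≤ wt ξ := by unfold wt; nlinarith [sq_nonneg ‖ξ‖]

lemma wt_pos (ξ : Plane) : 0 < wt ξ := one_pos.trans_le (one_le_wt ξ)

lemma continuous_wt : Continuous wt := by unfold wt; fun_prop

/-- Measurable symbols of finite weighted norm. -/
structure Weighted (m : ℕ) (φ : Plane → ℂ) : Prop where
  aesm : AEStronglyMeasurable φ volume
  lt_top : wNorm m φ < ⊤

lemma wNorm_mono_weight {m n : ℕ} (h : m ≤ n) (φ : Plane → ℂ) : wNorm m φ ≤ wNorm n φ := by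
  refine eLpNorm_mono fun ξ => ?_
  rw [norm_smul, norm_smul, Real.norm_of_nonneg (pow_nonneg (wt_pos ξ).le _),
    Real.norm_of_nonneg (pow_nonneg (wt_pos ξ).le _)]
  gcongr
  exact one_le_wt ξ

lemma wNorm_zero (φ : Plane → ℂ) : wNorm 0 φ = eLpNorm φ 2 volume := by simp [wNorm]

lemma Weighted.mono {m n : ℕ} {φ : Plane → ℂ} (h : Weighted n φ) (hmn : m ≤ n) : Weighted m φ :=
  ⟨h.aesm, (wNorm_mono_weight hmn φ).trans_lt h.lt_top⟩

lemma Weighted.memLp {m : ℕ} {φ : Plane → ℂ} (h : Weighted m φ) : MemLp φ 2 volume :=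
  ⟨h.aesm, by rw [← wNorm_zero]; exact (h.mono (Nat.zero_le m)).lt_top⟩

lemma Weighted.memLp_smul {m : ℕ} {φ : Plane → ℂ} (h : Weighted m φ) :
    MemLp (fun ξ => (wt ξ ^ m : ℝ) • φ ξ) 2 volume :=
  ⟨(continuous_wt.pow m).aestronglyMeasurable.smul h.aesm, h.lt_top⟩

/-- In dimension two `(1 + |ξ|²)⁻²` is integrable. Hence a single weight makes a square integrable
symbol integrable, by Hölder. -/
lemma memLp_inv_wt : MemLp (fun ξ : Plane => (wt ξ)⁻¹) 2 volume := by
  have hm : Continuous (fun ξ : Plane => (wt ξ)⁻¹) :=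
    continuous_wt.inv₀ fun ξ => (wt_pos ξ).ne'
  rw [memLp_two_iff_integrable_sq hm.aestronglyMeasurable]
  have := integrable_rpow_neg_one_add_norm_sq (E := Plane) (μ := volume) (r := 4)
    (by simp; norm_num)
  refine this.congr (ae_of_all _ fun ξ => ?_)
  simp only [wt]
  rw [inv_pow, show (-4 / 2 : ℝ) = -(2 : ℕ) by norm_num, Real.rpow_neg (by positivity),
    Real.rpow_natCast]

lemma Weighted.integrable {φ : Plane → ℂ} (h : Weighted 1 φ) : Integrable φ := by
  have := MemLp.integrable_mul memLp_inv_wt.ofReal (h.memLp_smul)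
  refine this.congr (ae_of_all _ fun ξ => ?_)
  simp only [Pi.mul_apply, pow_one, Complex.real_smul]
  have h0 : ((wt ξ : ℝ) : ℂ) ≠ 0 := by exact_mod_cast (wt_pos ξ).ne'
  rw [← mul_assoc]
  have : ((RCLike.ofReal (wt ξ)⁻¹ : ℂ)) * (wt ξ : ℂ) = 1 := by
    simp [h0]
  rw [this, one_mul]

/-! ### The `L²` Fourier transform of integrable functions -/

lemma continuous_fourierInv {g : Plane → ℂ} (hg : Integrable g) : Continuous (𝓕⁻ g) := by
  have : 𝓕⁻ g = VectorFourier.fourierIntegral Real.fourierChar volume (-innerₗ Plane) g := rfl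
  rw [this]
  refine VectorFourier.fourierIntegral_continuous Real.continuous_fourierChar ?_ hg
  have : Continuous fun p : Plane × Plane => -(inner ℝ p.1 p.2 : ℝ) := by fun_prop
  exact this

/-- Fubini moves the transform onto the test function, the kernel being symmetric in its two
variables. -/
lemma integral_schwartz_fourierInv {g : Plane → ℂ} (hg : Integrable g) (ψ : SchwartzMap Plane ℂ) :
    ∫ x, ψ x • (𝓕⁻ g) x = ∫ ξ, (𝓕⁻ ψ) ξ • g ξ := by
  have hc : Continuous fun p : Plane × Plane => (-innerₗ Plane) p.1 p.2 := by
    have : Continuous fun p : Plane × Plane => -(inner ℝ p.1 p.2 : ℝ) := by fun_prop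
    exact this
  have := VectorFourier.integral_fourierIntegral_smul_eq_flip (L := -innerₗ Plane)
    Real.continuous_fourierChar hc (ψ.integrable (μ := volume)) hg
  have hflip : (-innerₗ Plane).flip = -innerₗ Plane := by
    ext x y
    simp [real_inner_comm]
  rw [hflip] at this
  refine this.symm.trans ?_
  rw [SchwartzMap.fourierInv_coe]
  rfl

/-- On `L¹ ∩ L²` the inverse `L²` Fourier transform is given by the integral. -/
lemma coeFn_fourierInv_toLp {g : Plane → ℂ} (hg : Integrable g) (hg2 : MemLp g 2 volume) :
    ⇑(𝓕⁻ (hg2.toLp g) : Lp ℂ 2 (volume : Measure Plane)) =ᵐ[volume] 𝓕⁻ g := by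
  -- Both sides are locally integrable, so it suffices to test against smooth compactly supported
  -- functions. There the `L²` transform agrees with the transform of tempered distributions, which
  -- is defined by duality.
  refine ae_eq_of_integral_contDiff_smul_eq ?_ (continuous_fourierInv hg).locallyIntegrable ?_
  · exact (Lp.memLp _).locallyIntegrable (by norm_num)
  intro q hq hqc
  have hg₁ : HasCompactSupport (Complex.ofRealCLM ∘ q) := hqc.comp_left rfl
  have hg₂ : ContDiff ℝ ((⊤ : ℕ∞) : WithTop ℕ∞) (Complex.ofRealCLM ∘ q) :=
    Complex.ofRealCLM.contDiff.comp hq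
  set ψ := hg₁.toSchwartzMap hg₂ with hψ
  have hψq : ∀ x, ψ x = (q x : ℂ) := fun x => rfl
  have e1 : ∀ F : Plane → ℂ, ∫ x, q x • F x = ∫ x, ψ x • F x := by
    intro F; simp [hψq]
  rw [e1, e1, integral_schwartz_fourierInv hg]
  have h1 := Lp.fourierInv_toTemperedDistribution_eq (hg2.toLp g)
  have h2 := congrArg (fun D => D ψ) h1
  simp only [TemperedDistribution.fourierInv_apply, Lp.toTemperedDistribution_apply] at h2
  rw [← h2]
  apply integral_congr_ae
  filter_upwards [hg2.coeFn_toLp] with x hx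
  rw [hx]

lemma eLpNorm_fourierInv {g : Plane → ℂ} (hg : Integrable g) (hg2 : MemLp g 2 volume) :
    eLpNorm (𝓕⁻ g) 2 volume = eLpNorm g 2 volume := by
  rw [← eLpNorm_congr_ae (coeFn_fourierInv_toLp hg hg2), ← eLpNorm_congr_ae hg2.coeFn_toLp,
    ← Lp.enorm_def, ← Lp.enorm_def]
  have := (Lp.fourierTransformₗᵢ Plane ℂ).symm.norm_map (hg2.toLp g)
  rw [← ofReal_norm, ← ofReal_norm]
  exact congrArg _ this

/-- Pointwise Fourier inversion for continuous square integrable functions. -/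
lemma fourierInv_fourier_toLp {u : Plane → ℂ} (hu : Continuous u) (hu2 : MemLp u 2 volume)
    (hint : Integrable ⇑(𝓕 (hu2.toLp u) : Lp ℂ 2 (volume : Measure Plane))) :
    𝓕⁻ (⇑(𝓕 (hu2.toLp u) : Lp ℂ 2 (volume : Measure Plane))) = u := by
  set U : Lp ℂ 2 (volume : Measure Plane) := 𝓕 (hu2.toLp u) with hU
  -- Both sides are continuous, so equality almost everywhere is enough.
  rw [← (continuous_fourierInv hint).ae_eq_iff_eq volume hu]
  refine (coeFn_fourierInv_toLp hint (Lp.memLp U)).symm.trans ?_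
  rw [Lp.toLp_coeFn, hU, FourierTransform.fourierInv_fourier_eq]
  exact hu2.coeFn_toLp

/-! ### Rescaling -/

lemma lintegral_comp_smul_plane (f : Plane → ℝ≥0∞) {c : ℝ} (hc : 0 < c) :
    ∫⁻ x, f (c • x) = ENNReal.ofReal ((c ^ 2)⁻¹) * ∫⁻ x, f x := by
  have h1 : ∫⁻ x, f (c • x) = ∫⁻ y, f y ∂(Measure.map (fun x : Plane => c • x) volume) :=
    (lintegral_map_equiv f
      (Homeomorph.smul (isUnit_iff_ne_zero.2 hc.ne').unit).toMeasurableEquiv).symm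
  rw [h1, Measure.map_addHaar_smul volume hc.ne', lintegral_smul_measure, finrank_euclideanSpace,
    Fintype.card_fin, abs_of_nonneg (by positivity), smul_eq_mul]

lemma eLpNorm_comp_smul_plane (g : Plane → ℂ) {c : ℝ} (hc : 0 < c) :
    eLpNorm (fun x => g (c • x)) 2 volume = ENNReal.ofReal c⁻¹ * eLpNorm g 2 volume := by
  rw [← (ENNReal.pow_right_strictMono two_ne_zero).injective.eq_iff, mul_pow, eLpNorm_two_sq,
    eLpNorm_two_sq, lintegral_comp_smul_plane (fun x => ‖g x‖ₑ ^ 2) hc,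
    ← ENNReal.ofReal_pow (by positivity), inv_pow]

lemma synth_eq_fourierInv (φ : Plane → ℂ) (x : Plane) :
    synth φ x = (𝓕⁻ φ) ((2 * Real.pi)⁻¹ • x) := by
  rw [Real.fourierInv_eq', synth]
  congr 1
  ext ξ
  rw [inner_smul_right, smul_eq_mul, mul_inv_cancel_left₀ (by positivity), mul_comm Complex.I]

lemma continuous_synth {φ : Plane → ℂ} (hφ : Integrable φ) : Continuous (synth φ) := by
  have : synth φ = fun x => (𝓕⁻ φ) ((2 * Real.pi)⁻¹ • x) := funext (synth_eq_fourierInv φ)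
  rw [this]
  exact (continuous_fourierInv hφ).comp (continuous_const_smul _)

/-- Plancherel's theorem. -/
lemma eLpNorm_synth {φ : Plane → ℂ} (h : Weighted 1 φ) :
    eLpNorm (synth φ) 2 volume = ENNReal.ofReal (2 * Real.pi) * eLpNorm φ 2 volume := by
  have : synth φ = fun x => (𝓕⁻ φ) ((2 * Real.pi)⁻¹ • x) := funext (synth_eq_fourierInv φ)
  rw [this, eLpNorm_comp_smul_plane _ (by positivity), eLpNorm_fourierInv h.integrable h.memLp,
    inv_inv]

/-- The substitution `ξ ↦ ξ / 2π` converts the kernel `e^{2πi ξ·x}` into `e^{i ξ·x}`, with Jacobian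
`(2π)⁻²`. -/
lemma fourierInv_eq_synth (g : Plane → ℂ) (x : Plane) :
    (𝓕⁻ g) x = synth (fun ξ => (((2 * Real.pi) ^ 2)⁻¹ : ℝ) • g ((2 * Real.pi)⁻¹ • ξ)) x := by
  have h := Measure.integral_comp_smul (volume : Measure Plane)
    (fun ξ : Plane => Complex.exp (((2 * Real.pi * inner ℝ ξ x : ℝ) : ℂ) * Complex.I) * g ξ)
    ((2 * Real.pi)⁻¹)
  rw [Real.fourierInv_eq', synth]
  simp_rw [mul_smul_comm, integral_smul]
  have e : ∀ ξ : Plane, Complex.exp (Complex.I * (inner ℝ ξ x : ℝ)) * g ((2 * Real.pi)⁻¹ • ξ) =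
      Complex.exp (((2 * Real.pi * inner ℝ ((2 * Real.pi)⁻¹ • ξ) x : ℝ) : ℂ) * Complex.I) *
        g ((2 * Real.pi)⁻¹ • ξ) := by
    intro ξ
    rw [real_inner_smul_left, mul_inv_cancel_left₀ (by positivity), mul_comm Complex.I]
  simp_rw [e, h, smul_smul, smul_eq_mul]
  rw [finrank_euclideanSpace, Fintype.card_fin, abs_of_nonneg (by positivity)]
  have : ((2 * Real.pi) ^ 2)⁻¹ * (((2 * Real.pi)⁻¹) ^ 2)⁻¹ = 1 := by
    field_simp
  rw [this, one_smul]

/-- Continuous functions of finite Sobolev norm are superpositions of plane waves. -/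
lemma exists_synth_eq {m : ℕ} (hm : 1 ≤ m) {u : Plane → ℂ} (hu : Continuous u)
    (hfin : sobolevNormScalar (2 * m) u < ⊤) :
    ∃ φ : Plane → ℂ, Weighted m φ ∧ u = synth φ ∧
      ENNReal.ofReal (2 * Real.pi) * wNorm m φ = sobolevNormScalar (2 * m) u := by
  have hu2 : MemLp u 2 (volume : Measure Plane) := by
    by_contra hcon
    simp [sobolevNormScalar, hcon] at hfin
  set U : Lp ℂ 2 (volume : Measure Plane) := 𝓕 (hu2.toLp u) with hU
  have hs : sobolevNormScalar (2 * m) u = (∫⁻ ξ : Plane,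
      ENNReal.ofReal ((1 + ‖(2 * Real.pi) • ξ‖ ^ 2) ^ (2 * m)) * ‖U ξ‖ₑ ^ 2) ^ (1 / 2 : ℝ) := by
    simp [sobolevNormScalar, hu2, hU]
  set φ : Plane → ℂ := fun ξ => (((2 * Real.pi) ^ 2)⁻¹ : ℝ) • U ((2 * Real.pi)⁻¹ • ξ) with hφ
  have h2pi : (0 : ℝ) < 2 * Real.pi := by positivity
  have haesm : AEStronglyMeasurable φ volume := by
    have h1 : Measure.QuasiMeasurePreserving (fun ξ : Plane => (2 * Real.pi)⁻¹ • ξ) := by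
      refine ⟨measurable_const_smul ((2 * Real.pi)⁻¹ : ℝ), ?_⟩
      rw [Measure.map_addHaar_smul volume (by positivity)]
      exact Measure.smul_absolutelyContinuous
    have h2 := (Lp.aestronglyMeasurable U).comp_quasiMeasurePreserving h1
    exact h2.const_smul (((2 * Real.pi) ^ 2)⁻¹ : ℝ)
  set G : Plane → ℂ := fun ξ => (wt ((2 * Real.pi) • ξ) ^ m : ℝ) • U ξ with hG
  have hGs : sobolevNormScalar (2 * m) u = eLpNorm G 2 volume := by
    rw [hs, ← (ENNReal.pow_right_strictMono two_ne_zero).injective.eq_iff, eLpNorm_two_sq,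
      ← ENNReal.rpow_natCast, ← ENNReal.rpow_mul]
    norm_num only [ENNReal.rpow_one]
    refine lintegral_congr fun ξ => ?_
    rw [hG, enorm_smul, mul_pow, Real.enorm_of_nonneg (pow_nonneg (wt_pos _).le _),
      ← ENNReal.ofReal_pow (pow_nonneg (wt_pos _).le _), ← pow_mul, mul_comm m, wt]
  -- The amplitude `(2π)⁻²` and the factor `2π` from rescaling the `L²` norm leave `(2π)⁻¹`.
  have hw : ENNReal.ofReal (2 * Real.pi) * wNorm m φ = sobolevNormScalar (2 * m) u := by
    have e1 : (fun ξ => (wt ξ ^ m : ℝ) • φ ξ) =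
        (((2 * Real.pi) ^ 2)⁻¹ : ℝ) • fun ξ => G ((2 * Real.pi)⁻¹ • ξ) := by
      ext ξ
      simp only [hφ, hG, Pi.smul_apply]
      rw [smul_inv_smul₀ h2pi.ne', smul_comm]
    rw [wNorm, e1, eLpNorm_const_smul, eLpNorm_comp_smul_plane _ (by positivity), hGs,
      Real.enorm_of_nonneg (by positivity), ← mul_assoc, ← mul_assoc,
      ← ENNReal.ofReal_mul (by positivity), ← ENNReal.ofReal_mul (by positivity)]
    have : 2 * Real.pi * ((2 * Real.pi) ^ 2)⁻¹ * ((2 * Real.pi)⁻¹)⁻¹ = 1 := by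
      field_simp
    rw [this]; simp
  have hW : Weighted m φ := by
    refine ⟨haesm, ?_⟩
    rw [← hw] at hfin
    by_contra hcon
    rw [not_lt, top_le_iff] at hcon
    rw [hcon, ENNReal.mul_top (by simpa using Real.pi_pos)] at hfin
    exact lt_irrefl _ hfin
  refine ⟨φ, hW, ?_, hw⟩
  have hφi : Integrable φ := (hW.mono hm).integrable
  have hUi : Integrable ⇑U := by
    have h1 := hφi.comp_smul h2pi.ne'
    have h2 := h1.smul ((2 * Real.pi) ^ 2 : ℝ)
    refine h2.congr (ae_of_all _ fun ξ => ?_)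
    simp only [hφ, Pi.smul_apply]
    rw [inv_smul_smul₀ h2pi.ne', smul_smul, mul_inv_cancel₀ (by positivity), one_smul]
  have h3 := fourierInv_fourier_toLp hu hu2 hUi
  rw [← h3]
  ext x
  exact fourierInv_eq_synth _ x

/-! ### Lattice coordinates on the momentum plane -/

lemma inner_plane (x y : Plane) : (inner ℝ x y : ℝ) = x 0 * y 0 + x 1 * y 1 := by
  simp [PiLp.inner_apply, Fin.sum_univ_two, mul_comm]

lemma norm_sq_plane (x : Plane) : ‖x‖ ^ 2 = x 0 ^ 2 + x 1 ^ 2 := by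
  rw [← real_inner_self_eq_norm_sq, inner_plane]; ring

@[simp] lemma rot_apply_zero (ζ : ℝ) (v : Plane) :
    rot ζ v 0 = Real.cos ζ * v 0 - Real.sin ζ * v 1 := rfl

@[simp] lemma rot_apply_one (ζ : ℝ) (v : Plane) :
    rot ζ v 1 = Real.sin ζ * v 0 + Real.cos ζ * v 1 := rfl

lemma plane_ext {x y : Plane} (h0 : x 0 = y 0) (h1 : x 1 = y 1) : x = y := by
  ext i; fin_cases i <;> assumption

lemma rot_add (ζ : ℝ) (v w : Plane) : rot ζ (v + w) = rot ζ v + rot ζ w := by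
  apply plane_ext <;> simp <;> ring

lemma rot_smul (ζ c : ℝ) (v : Plane) : rot ζ (c • v) = c • rot ζ v := by
  apply plane_ext <;> simp <;> ring

lemma inner_rot_rot (ζ : ℝ) (v w : Plane) : (inner ℝ (rot ζ v) (rot ζ w) : ℝ) = inner ℝ v w := by
  simp only [inner_plane, rot_apply_zero, rot_apply_one]
  linear_combination (v 0 * w 0 + v 1 * w 1) * Real.sin_sq_add_cos_sq ζ

lemma norm_rot (ζ : ℝ) (v : Plane) : ‖rot ζ v‖ = ‖v‖ := by
  rw [← sq_eq_sq₀ (norm_nonneg _) (norm_nonneg _), ← real_inner_self_eq_norm_sq, inner_rot_rot,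
    real_inner_self_eq_norm_sq]

/-- Lattice points of the monolayer lattice rotated by `ζ`. -/
def latPoint (ζ : ℝ) (n : Fin 2 → ℤ) : Plane :=
  (n 0 : ℝ) • rot ζ (aVec 0) + (n 1 : ℝ) • rot ζ (aVec 1)

/-- Points of the reciprocal lattice rotated by `ζ`. -/
def recip (ζ : ℝ) (k : Fin 2 → ℤ) : Plane :=
  rot ζ ((k 0 : ℝ) • bVec 0 + (k 1 : ℝ) • bVec 1)

/-- The momentum with lattice coordinates `η`, for the lattice scaled by `γ`. -/
def latMap (γ ζ : ℝ) (η : Fin 2 → ℝ) : Plane :=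
  γ⁻¹ • rot ζ (η 0 • bVec 0 + η 1 • bVec 1)

lemma inner_bVec_aVec (j k : Fin 2) :
    (inner ℝ (bVec j) (aVec k) : ℝ) = if j = k then 2 * Real.pi else 0 := by
  have h3 : Real.sqrt 3 ≠ 0 := by positivity
  fin_cases j <;> fin_cases k <;> simp [inner_plane, bVec, aVec] <;> field_simp <;> ring

lemma inner_latMap_aVec {γ : ℝ} (hγ : γ ≠ 0) (ζ : ℝ) (η : Fin 2 → ℝ) (k : Fin 2) :
    γ * (inner ℝ (latMap γ ζ η) (rot ζ (aVec k)) : ℝ) = 2 * Real.pi * η k := by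
  rw [latMap, real_inner_smul_left, inner_rot_rot, inner_add_left, real_inner_smul_left,
    real_inner_smul_left, inner_bVec_aVec, inner_bVec_aVec, mul_inv_cancel_left₀ hγ]
  fin_cases k <;> simp [mul_comm]

lemma latMap_add_intVec (γ ζ : ℝ) (η : Fin 2 → ℝ) (k : Fin 2 → ℤ) :
    latMap γ ζ (η + intVec k) = latMap γ ζ η + γ⁻¹ • recip ζ k := by
  unfold latMap recip intVec
  rw [← smul_add, ← rot_add]
  congr 2
  simp only [Pi.add_apply, add_smul]
  abel

/-- The factor `γ⁻¹` of the momentum cancels the `γ` of the point, so on the scaled lattice plane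
waves are the characters `latChar` whatever `γ` and `ζ` are. -/
lemma inner_latMap_latPoint {γ : ℝ} (hγ : γ ≠ 0) (ζ : ℝ) (η : Fin 2 → ℝ) (n : Fin 2 → ℤ) :
    (inner ℝ (latMap γ ζ η) (γ • latPoint ζ n) : ℝ) = 2 * Real.pi * ∑ i, (n i : ℝ) * η i := by
  rw [real_inner_smul_right, latPoint, inner_add_right, real_inner_smul_right,
    real_inner_smul_right, Fin.sum_univ_two]
  linear_combination (n 0 : ℝ) * inner_latMap_aVec hγ ζ η 0 +
    (n 1 : ℝ) * inner_latMap_aVec hγ ζ η 1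

/-- The area of the reciprocal unit cell of the monolayer. -/
def recipArea : ℝ := 8 * Real.pi ^ 2 / Real.sqrt 3

lemma recipArea_pos : 0 < recipArea := by unfold recipArea; positivity

/-- The matrix of `latMap`. -/
def latMatrix (γ ζ : ℝ) : Matrix (Fin 2) (Fin 2) ℝ :=
  Matrix.of fun r k => γ⁻¹ * rot ζ (bVec k) r

lemma latMap_eq (γ ζ : ℝ) (η : Fin 2 → ℝ) :
    latMap γ ζ η = WithLp.toLp 2 (Matrix.toLin' (latMatrix γ ζ) η) := by
  ext r
  simp only [latMap, rot_add, rot_smul, latMatrix, Matrix.toLin'_apply, Matrix.mulVec,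
    dotProduct, Fin.sum_univ_two, Matrix.of_apply, PiLp.smul_apply, PiLp.add_apply, smul_eq_mul]
  ring

lemma det_latMatrix {γ : ℝ} (ζ : ℝ) : (latMatrix γ ζ).det = recipArea / γ ^ 2 := by
  have h3 : Real.sqrt 3 ≠ 0 := by positivity
  rw [Matrix.det_fin_two]
  simp only [latMatrix, Matrix.of_apply, rot_apply_zero, rot_apply_one, bVec, recipArea,
    Matrix.cons_val_zero, Matrix.cons_val_one]
  simp
  have := Real.sin_sq_add_cos_sq ζ
  field_simp
  linear_combination (8 * Real.sqrt 3 * γ⁻¹ ^ 2) * this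

lemma map_latMap {γ : ℝ} (hγ : 0 < γ) (ζ : ℝ) :
    Measure.map (latMap γ ζ) volume =
      ENNReal.ofReal (γ ^ 2 / recipArea) • (volume : Measure Plane) := by
  have hdet : (latMatrix γ ζ).det ≠ 0 := by
    rw [det_latMatrix]; have := recipArea_pos; positivity
  have hf : latMap γ ζ = (fun v : Fin 2 → ℝ => (WithLp.toLp 2 v : Plane)) ∘
      Matrix.toLin' (latMatrix γ ζ) := funext (latMap_eq γ ζ)
  have hmp := PiLp.volume_preserving_toLp (Fin 2)
  rw [hf, ← Measure.map_map hmp.measurable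
    (LinearMap.continuous_of_finiteDimensional _).measurable,
    Real.map_matrix_volume_pi_eq_smul_volume_pi hdet, Measure.map_smul, hmp.map_eq, det_latMatrix,
    inv_div, abs_of_nonneg (by have := recipArea_pos; positivity)]

lemma measurableEmbedding_latMap {γ : ℝ} (hγ : 0 < γ) (ζ : ℝ) :
    MeasurableEmbedding (latMap γ ζ) := by
  have hc : Continuous (latMap γ ζ) := by
    have : latMap γ ζ = (fun v : Fin 2 → ℝ => (WithLp.toLp 2 v : Plane)) ∘
      Matrix.toLin' (latMatrix γ ζ) := funext (latMap_eq γ ζ)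
    rw [this]
    exact (PiLp.continuous_toLp 2 _).comp (LinearMap.continuous_of_finiteDimensional _)
  refine hc.measurableEmbedding fun η η' h => ?_
  ext k
  have h1 := inner_latMap_aVec hγ.ne' ζ η k
  rw [h, inner_latMap_aVec hγ.ne' ζ η' k] at h1
  have := Real.pi_pos
  exact (mul_left_cancel₀ (by positivity) h1).symm

lemma integral_comp_latMap {γ : ℝ} (hγ : 0 < γ) (ζ : ℝ) (f : Plane → ℂ) :
    ∫ η, f (latMap γ ζ η) = (γ ^ 2 / recipArea) • ∫ ξ, f ξ := by
  rw [← (measurableEmbedding_latMap hγ ζ).integral_map, map_latMap hγ, integral_smul_measure,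
    ENNReal.toReal_ofReal (by have := recipArea_pos; positivity)]

lemma lintegral_comp_latMap {γ : ℝ} (hγ : 0 < γ) (ζ : ℝ) (f : Plane → ℝ≥0∞) :
    ∫⁻ η, f (latMap γ ζ η) = ENNReal.ofReal (γ ^ 2 / recipArea) * ∫⁻ ξ, f ξ := by
  rw [← (measurableEmbedding_latMap hγ ζ).lintegral_map, map_latMap hγ, lintegral_smul_measure,
    smul_eq_mul]

/-- The constant relating discrete and continuous `L²` norms. -/
def cellConst : ℝ := Real.sqrt recipArea

lemma cellConst_pos : 0 < cellConst := Real.sqrt_pos.2 recipArea_pos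

lemma cellConst_sq : cellConst ^ 2 = recipArea := Real.sq_sqrt recipArea_pos.le

lemma eLpNorm_comp_latMap {γ : ℝ} (hγ : 0 < γ) (ζ : ℝ) (g : Plane → ℂ) :
    eLpNorm (fun η => g (latMap γ ζ η)) 2 volume =
      ENNReal.ofReal (γ / cellConst) * eLpNorm g 2 volume := by
  have := cellConst_pos
  rw [← (ENNReal.pow_right_strictMono two_ne_zero).injective.eq_iff, mul_pow, eLpNorm_two_sq,
    eLpNorm_two_sq, lintegral_comp_latMap hγ ζ (fun ξ => ‖g ξ‖ₑ ^ 2),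
    ← ENNReal.ofReal_pow (by positivity), div_pow, cellConst_sq]

/-- The pullback of a symbol to lattice coordinates; its Fourier integrals at lattice points are
the values of the synthesis at the points `γ R + y`. -/
def latPull (γ ζ : ℝ) (y : Plane) (φ : Plane → ℂ) (η : Fin 2 → ℝ) : ℂ :=
  ((recipArea / γ ^ 2 : ℝ) : ℂ) *
    (Complex.exp (Complex.I * (inner ℝ (latMap γ ζ η) y : ℝ)) * φ (latMap γ ζ η))

lemma latCoeff_latPull {γ : ℝ} (hγ : 0 < γ) (ζ : ℝ) (y : Plane) (φ : Plane → ℂ)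
    (n : Fin 2 → ℤ) :
    latCoeff (latPull γ ζ y φ) n = synth φ (γ • latPoint ζ n + y) := by
  have h1 := integral_comp_latMap hγ ζ (fun ξ => ((recipArea / γ ^ 2 : ℝ) : ℂ) *
    (Complex.exp (Complex.I * (inner ℝ ξ (γ • latPoint ζ n + y) : ℝ)) * φ ξ))
  have hA := recipArea_pos
  have h2 : ∫ ξ, ((recipArea / γ ^ 2 : ℝ) : ℂ) *
      (Complex.exp (Complex.I * (inner ℝ ξ (γ • latPoint ζ n + y) : ℝ)) * φ ξ) =
      ((recipArea / γ ^ 2 : ℝ) : ℂ) * synth φ (γ • latPoint ζ n + y) := integral_const_mul _ _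
  rw [h2, Complex.real_smul, ← mul_assoc, ← Complex.ofReal_mul,
    show γ ^ 2 / recipArea * (recipArea / γ ^ 2) = 1 by field_simp, Complex.ofReal_one,
    one_mul] at h1
  rw [← h1, latCoeff]
  congr 1
  ext η
  rw [latChar, latPull, inner_add_right, inner_latMap_latPoint hγ.ne', Complex.ofReal_add, mul_add,
    Complex.exp_add]
  ring

lemma norm_exp_I_mul (x : ℝ) : ‖Complex.exp (Complex.I * (x : ℂ))‖ = 1 := by
  rw [mul_comm]; exact Complex.norm_exp_ofReal_mul_I x

lemma norm_latPull {γ : ℝ} (ζ : ℝ) (y : Plane) (φ : Plane → ℂ) (η : Fin 2 → ℝ) :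
    ‖latPull γ ζ y φ η‖ = ‖((recipArea / γ ^ 2 : ℝ) : ℂ) * φ (latMap γ ζ η)‖ := by
  rw [latPull, norm_mul, norm_mul, norm_exp_I_mul, one_mul, norm_mul]

/-- Of the Jacobian `recipArea / γ²` only the square root survives in `L²`; the factor `γ` in
`sampleNorm` will cancel its dependence on `γ`. -/
lemma eLpNorm_latPull {γ : ℝ} (hγ : 0 < γ) (ζ : ℝ) (y : Plane) (φ : Plane → ℂ) :
    eLpNorm (latPull γ ζ y φ) 2 volume =
      ENNReal.ofReal (cellConst / γ) * eLpNorm φ 2 volume := by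
  have h0 := cellConst_pos
  rw [eLpNorm_congr_norm_ae (ae_of_all _ (norm_latPull ζ y φ)),
    eLpNorm_comp_latMap hγ ζ (fun ξ => ((recipArea / γ ^ 2 : ℝ) : ℂ) * φ ξ)]
  have := eLpNorm_const_smul ((recipArea / γ ^ 2 : ℝ) : ℂ) φ 2 (volume : Measure Plane)
  have e : (fun ξ => ((recipArea / γ ^ 2 : ℝ) : ℂ) * φ ξ) =
    ((recipArea / γ ^ 2 : ℝ) : ℂ) • φ := rfl
  rw [e, this, ← ofReal_norm, Complex.norm_real, Real.norm_of_nonneg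
    (by have := recipArea_pos; positivity), ← mul_assoc, ← ENNReal.ofReal_mul (by positivity),
    ← cellConst_sq]
  congr 2
  field_simp

lemma norm_aVec (k : Fin 2) : ‖aVec k‖ = 1 := by
  rw [← sq_eq_sq₀ (norm_nonneg _) zero_le_one, norm_sq_plane]
  have := Real.sq_sqrt (show (0 : ℝ) ≤ 3 by norm_num)
  fin_cases k <;> simp [aVec, div_pow, this] <;> norm_num

/-- Each coordinate is `γ / 2π` times the component of the momentum along a unit lattice vector.
Every power of `η` therefore yields a power of `γ`, which makes the aliasing error `O(γ²)`. -/
lemma norm_latCoord_le {γ : ℝ} (hγ : 0 < γ) (ζ : ℝ) (η : Fin 2 → ℝ) :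
    ‖η‖ ≤ γ * ‖latMap γ ζ η‖ := by
  rw [pi_norm_le_iff_of_nonneg (by positivity)]
  intro k
  have h1 := inner_latMap_aVec hγ.ne' ζ η k
  have h2 := abs_real_inner_le_norm (latMap γ ζ η) (rot ζ (aVec k))
  rw [norm_rot, norm_aVec, mul_one] at h2
  have h3 : 2 * Real.pi * |η k| ≤ γ * ‖latMap γ ζ η‖ := by
    rw [← abs_of_pos (show 0 < 2 * Real.pi by positivity), ← abs_mul, ← h1, abs_mul,
      abs_of_pos hγ]
    gcongr
  have h4 := Real.pi_gt_three
  rw [Real.norm_eq_abs]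
  nlinarith [abs_nonneg (η k)]

lemma quadMoment_latPull_le {γ : ℝ} (hγ : 0 < γ) (ζ : ℝ) (y : Plane) (φ : Plane → ℂ) :
    quadMoment (latPull γ ζ y φ) ≤
      ENNReal.ofReal (cellConst / γ) * (ENNReal.ofReal (γ ^ 2) * wNorm 1 φ) := by
  have h0 := cellConst_pos
  have e : ENNReal.ofReal (γ ^ 2) * wNorm 1 φ =
      eLpNorm (fun ξ => ((γ ^ 2 : ℝ) : ℂ) • ((wt ξ ^ 1 : ℝ) • φ ξ)) 2 volume := by
    have := eLpNorm_const_smul ((γ ^ 2 : ℝ) : ℂ) (fun ξ => (wt ξ ^ 1 : ℝ) • φ ξ) 2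
      (volume : Measure Plane)
    refine Eq.trans ?_ this.symm
    rw [← ofReal_norm, Complex.norm_real, Real.norm_of_nonneg (by positivity), wNorm]
  rw [e, ← eLpNorm_latPull hγ ζ y]
  refine eLpNorm_mono fun η => ?_
  rw [norm_smul, norm_latPull, norm_latPull, norm_mul, norm_mul, mul_left_comm]
  refine mul_le_mul_of_nonneg_left ?_ (norm_nonneg _)
  rw [norm_smul, norm_smul, ← mul_assoc, pow_one, Real.norm_of_nonneg (by positivity),
    Complex.norm_real, Real.norm_of_nonneg (by positivity), Real.norm_of_nonneg (wt_pos _).le]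
  refine mul_le_mul_of_nonneg_right ?_ (norm_nonneg _)
  have h1 := norm_latCoord_le hγ ζ η
  calc ‖η‖ ^ 2 ≤ (γ * ‖latMap γ ζ η‖) ^ 2 := by gcongr
    _ = γ ^ 2 * ‖latMap γ ζ η‖ ^ 2 := by ring
    _ ≤ γ ^ 2 * wt (latMap γ ζ η) := by gcongr; unfold wt; linarith

lemma decaying_latPull {γ : ℝ} (hγ : 0 < γ) (ζ : ℝ) (y : Plane) {φ : Plane → ℂ}
    (h : Weighted 1 φ) : Decaying (latPull γ ζ y φ) := by
  have hq : Measure.QuasiMeasurePreserving (latMap γ ζ) volume volume := by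
    refine ⟨(measurableEmbedding_latMap hγ ζ).measurable, ?_⟩
    rw [map_latMap hγ]
    exact Measure.smul_absolutelyContinuous
  have hm : AEStronglyMeasurable (latPull γ ζ y φ) volume := by
    have h1 : AEStronglyMeasurable (fun ξ => ((recipArea / γ ^ 2 : ℝ) : ℂ) *
        (Complex.exp (Complex.I * (inner ℝ ξ y : ℝ)) * φ ξ)) volume := by
      refine AEStronglyMeasurable.const_mul (AEStronglyMeasurable.mul ?_ h.aesm) _
      exact Continuous.aestronglyMeasurable (by fun_prop)
    exact h1.comp_quasiMeasurePreserving hq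
  refine ⟨⟨hm, ?_⟩, ?_⟩
  · rw [eLpNorm_latPull hγ]
    exact ENNReal.mul_lt_top ENNReal.ofReal_lt_top h.memLp.2
  · refine (quadMoment_latPull_le hγ ζ y φ).trans_lt ?_
    exact ENNReal.mul_lt_top ENNReal.ofReal_lt_top
      (ENNReal.mul_lt_top ENNReal.ofReal_lt_top h.lt_top)

/-- The scaled discrete `L²` norm of the samples of a synthesis on a shifted, scaled lattice. -/
def sampleNorm (γ ζ : ℝ) (y : Plane) (u : Plane → ℂ) : ℝ≥0∞ :=
  ENNReal.ofReal γ * eLpNorm (fun n : Fin 2 → ℤ => u (γ • latPoint ζ n + y)) 2 Measure.count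

/-- The shift `y` enters the symbol only through a unimodular factor, so the bound is uniform in `y`
and in the rotation. -/
lemma sampleNorm_synth_le {γ : ℝ} (hγ : 0 < γ) (ζ : ℝ) (y : Plane) {φ : Plane → ℂ}
    (h : Weighted 1 φ) :
    sampleNorm γ ζ y (synth φ) ≤ ENNReal.ofReal cellConst *
      (eLpNorm φ 2 volume + aliasConst * (ENNReal.ofReal (γ ^ 2) * wNorm 1 φ)) := by
  have h0 := cellConst_pos
  have h1 := eLpNorm_latCoeff_le (decaying_latPull hγ ζ y h)
  simp_rw [funext (latCoeff_latPull hγ ζ y φ), eLpNorm_latPull hγ] at h1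
  calc sampleNorm γ ζ y (synth φ) ≤ ENNReal.ofReal γ * _ := mul_le_mul_right h1 _
    _ ≤ ENNReal.ofReal γ * (ENNReal.ofReal (cellConst / γ) * eLpNorm φ 2 volume +
        aliasConst * (ENNReal.ofReal (cellConst / γ) * (ENNReal.ofReal (γ ^ 2) * wNorm 1 φ))) := by
        gcongr
        exact quadMoment_latPull_le hγ ζ y φ
    _ = ENNReal.ofReal γ * ENNReal.ofReal (cellConst / γ) *
      (eLpNorm φ 2 volume + aliasConst * (ENNReal.ofReal (γ ^ 2) * wNorm 1 φ)) := by ring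
    _ = _ := by
        rw [← ENNReal.ofReal_mul hγ.le, mul_div_cancel₀ _ hγ.ne']

/-- The converse bound, by which a small residual forces a small defect. -/
lemma le_sampleNorm_synth {γ : ℝ} (hγ : 0 < γ) (ζ : ℝ) (y : Plane) {φ : Plane → ℂ}
    (h : Weighted 1 φ) :
    ENNReal.ofReal cellConst * eLpNorm φ 2 volume ≤ sampleNorm γ ζ y (synth φ) +
      ENNReal.ofReal cellConst * (aliasConst * (ENNReal.ofReal (γ ^ 2) * wNorm 1 φ)) := by
  have h0 := cellConst_pos
  have h1 := eLpNorm_le_latCoeff (decaying_latPull hγ ζ y h)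
  simp_rw [funext (latCoeff_latPull hγ ζ y φ), eLpNorm_latPull hγ] at h1
  have e : ENNReal.ofReal cellConst = ENNReal.ofReal γ * ENNReal.ofReal (cellConst / γ) := by
    rw [← ENNReal.ofReal_mul hγ.le, mul_div_cancel₀ _ hγ.ne']
  rw [e, mul_assoc]
  calc _ ≤ ENNReal.ofReal γ * _ := mul_le_mul_right h1 _
    _ ≤ ENNReal.ofReal γ * (eLpNorm (fun n => synth φ (γ • latPoint ζ n + y)) 2 Measure.count +
        aliasConst * (ENNReal.ofReal (cellConst / γ) * (ENNReal.ofReal (γ ^ 2) * wNorm 1 φ))) := by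
        gcongr
        exact quadMoment_latPull_le hγ ζ y φ
    _ = _ := by rw [sampleNorm]; ring

/-! ### Poisson summation for the interlayer hopping -/

lemma hopHat_eq_synth (hs : ℝ → ℝ) (l : ℝ) (ξ : Plane) :
    hopHat hs ξ l = synth (fun r => (hop hs r l : ℂ)) (-ξ) := by
  unfold hopHat synth
  congr 1
  ext r
  rw [inner_neg_right, real_inner_comm]
  congr 2
  push_cast
  ring

variable {hs : ℝ → ℝ} {C₁ C₂ C₃ D₁ D₂ l₀ : ℝ}

lemma HoppingAssumption.D₁_pos (hh : HoppingAssumption hs C₁ C₂ C₃ D₁ D₂ l₀) : 0 < D₁ :=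
  hh.D₂_pos.trans_le hh.D₂_le_D₁

lemma continuous_hopHat (hh : HoppingAssumption hs C₁ C₂ C₃ D₁ D₂ l₀) {l : ℝ} (hl : l₀ ≤ l) :
    Continuous fun ξ => hopHat hs ξ l := by
  have : (fun ξ => hopHat hs ξ l) = fun ξ => synth (fun r => (hop hs r l : ℂ)) (-ξ) :=
    funext (hopHat_eq_synth hs l)
  rw [this]
  exact (continuous_synth (hh.integrable l hl).ofReal).comp continuous_neg

lemma pow_le_factorial_mul_exp {x : ℝ} (hx : 0 ≤ x) (n : ℕ) :
    x ^ n ≤ n.factorial * Real.exp x := by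
  have := Real.pow_div_factorial_le_exp x hx n
  rwa [div_le_iff₀' (by positivity)] at this

lemma weighted_hopHat (hh : HoppingAssumption hs C₁ C₂ C₃ D₁ D₂ l₀) {l : ℝ} (hl : l₀ ≤ l) :
    Weighted 1 (fun ξ => hopHat hs ξ l) := by
  have hc := continuous_hopHat hh hl
  refine ⟨hc.aestronglyMeasurable, ?_⟩
  have ha : 0 < D₂ * l := mul_pos hh.D₂_pos (hh.l₀_pos.trans_le hl)
  set a := D₂ * l
  -- Comparison with `1 / wt` calls for a bound on `wt² |ĥ|`. The constant comes from `wt² ≤ 2 +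
  -- 2‖ξ‖⁴` and `‖ξ‖⁴ ≤ (4! / a⁴) e^{a‖ξ‖}`.
  refine lt_of_le_of_lt ?_ (memLp_inv_wt.const_mul (C₂ * (2 + 48 / a ^ 4))).2
  refine eLpNorm_mono fun ξ => ?_
  have hw := wt_pos ξ
  have h1 := hh.upper l hl ξ
  rw [norm_smul, Real.norm_of_nonneg (by positivity), pow_one, Real.norm_of_nonneg
    (by have := hh.C₂_pos; positivity), ← div_eq_mul_inv, le_div_iff₀ hw]
  have h2 : ‖ξ‖ ^ 4 ≤ 24 / a ^ 4 * Real.exp (a * ‖ξ‖) := by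
    have := pow_le_factorial_mul_exp (x := a * ‖ξ‖) (by positivity) 4
    rw [mul_pow] at this
    rw [div_mul_eq_mul_div, le_div_iff₀ (by positivity)]
    norm_num [Nat.factorial] at this ⊢
    linarith
  have h3 : wt ξ ^ 2 ≤ (2 + 48 / a ^ 4) * Real.exp (a * ‖ξ‖) := by
    have h4 : 1 ≤ Real.exp (a * ‖ξ‖) := Real.one_le_exp (by positivity)
    have h5 : wt ξ ^ 2 ≤ 2 + 2 * ‖ξ‖ ^ 4 := by unfold wt; nlinarith [sq_nonneg (1 - ‖ξ‖ ^ 2)]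
    calc wt ξ ^ 2 ≤ 2 + 2 * ‖ξ‖ ^ 4 := h5
      _ ≤ 2 * Real.exp (a * ‖ξ‖) + 2 * (24 / a ^ 4 * Real.exp (a * ‖ξ‖)) := by gcongr; linarith
      _ = _ := by ring
  have h6 : Real.exp (-D₂ * l * ‖ξ‖) * Real.exp (a * ‖ξ‖) = 1 := by
    rw [← Real.exp_add]; simp [a]
  calc wt ξ * ‖hopHat hs ξ l‖ * wt ξ = wt ξ ^ 2 * ‖hopHat hs ξ l‖ := by ring
    _ ≤ ((2 + 48 / a ^ 4) * Real.exp (a * ‖ξ‖)) * (C₂ * Real.exp (-D₂ * l * ‖ξ‖)) := by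
        gcongr
    _ = C₂ * (2 + 48 / a ^ 4) * (Real.exp (-D₂ * l * ‖ξ‖) * Real.exp (a * ‖ξ‖)) := by ring
    _ = C₂ * (2 + 48 / a ^ 4) := by rw [h6, mul_one]

lemma hop_eq_synth (hh : HoppingAssumption hs C₁ C₂ C₃ D₁ D₂ l₀) {l : ℝ} (hl : l₀ ≤ l)
    (r : Plane) :
    (hop hs r l : ℂ) = ((1 / (2 * Real.pi) ^ 2 : ℝ) : ℂ) * synth (fun ξ => hopHat hs ξ l) r :=
  hh.inversion l hl r

/-- The symbol whose synthesis is `y ↦ h(x - y)`. -/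
def hopSymbol (hs : ℝ → ℝ) (l : ℝ) (x ξ : Plane) : ℂ :=
  ((1 / (2 * Real.pi) ^ 2 : ℝ) : ℂ) *
    (starRingEnd ℂ) (Complex.exp (Complex.I * (inner ℝ ξ x : ℝ)) * hopHat hs ξ l)

lemma conj_exp_I_mul (x : ℝ) :
    (starRingEnd ℂ) (Complex.exp (Complex.I * (x : ℂ))) = Complex.exp (Complex.I * ((-x : ℝ) : ℂ)) := by
  rw [← Complex.exp_conj, map_mul, Complex.conj_I, Complex.conj_ofReal]
  congr 1
  push_cast
  ring

lemma exp_I_mul_add (x y : ℝ) : Complex.exp (Complex.I * ((x + y : ℝ) : ℂ)) =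
    Complex.exp (Complex.I * (x : ℂ)) * Complex.exp (Complex.I * (y : ℂ)) := by
  rw [← Complex.exp_add]; push_cast; ring_nf

/-- This is the conjugated inversion formula, `h` being real. The symbol carries a conjugate so that
`ĥ` itself appears in the bilinear Poisson formula. -/
lemma synth_hopSymbol (hh : HoppingAssumption hs C₁ C₂ C₃ D₁ D₂ l₀) {l : ℝ} (hl : l₀ ≤ l)
    (x y : Plane) : synth (hopSymbol hs l x) y = (hop hs (x - y) l : ℂ) := by
  have h1 : synth (hopSymbol hs l x) y = (starRingEnd ℂ) (hop hs (x - y) l : ℂ) := by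
    rw [hop_eq_synth hh hl, map_mul, Complex.conj_ofReal, synth, synth, ← integral_conj,
      ← integral_const_mul]
    congr 1
    ext ξ
    rw [hopSymbol, inner_sub_right, sub_eq_add_neg, exp_I_mul_add, map_mul, map_mul, map_mul,
      conj_exp_I_mul, conj_exp_I_mul, neg_neg]
    ring
  rw [h1, Complex.conj_ofReal]

lemma weighted_hopSymbol (hh : HoppingAssumption hs C₁ C₂ C₃ D₁ D₂ l₀) {l : ℝ} (hl : l₀ ≤ l)
    (x : Plane) : Weighted 1 (hopSymbol hs l x) := by
  have hc := continuous_hopHat hh hl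
  have hcs : Continuous (hopSymbol hs l x) := by
    unfold hopSymbol
    exact continuous_const.mul (Complex.continuous_conj.comp (by fun_prop))
  refine ⟨hcs.aestronglyMeasurable, ?_⟩
  have h := (weighted_hopHat hh hl).memLp_smul.const_smul ((1 / (2 * Real.pi) ^ 2 : ℝ) : ℂ)
  refine lt_of_le_of_lt (eLpNorm_mono fun ξ => ?_) h.2
  rw [Pi.smul_apply, smul_comm, norm_smul, norm_smul _ (_ • hopHat hs ξ l), hopSymbol, norm_mul,
    norm_smul, Complex.norm_conj, norm_mul, norm_exp_I_mul, one_mul]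

/-- Number of lattice points per unit area, the inverse of the cell area `√3 / 2`. The prefactor of
the interlayer Hamiltonian is chosen to cancel it. -/
lemma recipArea_div : recipArea * (1 / (2 * Real.pi) ^ 2) = 2 / Real.sqrt 3 := by
  have h3 : Real.sqrt 3 ≠ 0 := by positivity
  unfold recipArea
  field_simp
  norm_num

/-- Poisson summation for the interlayer hopping applied to a superposition of plane waves. -/
lemma hasSum_hop_mul_synth (hh : HoppingAssumption hs C₁ C₂ C₃ D₁ D₂ l₀) {l : ℝ} (hl : l₀ ≤ l)
    (ζ : ℝ) (x y : Plane) {χ : Plane → ℂ} (hχ : Weighted 1 χ) :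
    (Summable fun k : Fin 2 → ℤ => Complex.exp (Complex.I * (inner ℝ (recip ζ k) (x - y) : ℝ)) *
      synth (fun ξ => hopHat hs (ξ + recip ζ k) l * χ ξ) x) ∧
    HasSum (fun n : Fin 2 → ℤ => (hop hs (x - (latPoint ζ n + y)) l : ℂ) *
        synth χ (latPoint ζ n + y))
      (((2 / Real.sqrt 3 : ℝ) : ℂ) * ∑' k : Fin 2 → ℤ,
        Complex.exp (Complex.I * (inner ℝ (recip ζ k) (x - y) : ℝ)) *
          synth (fun ξ => hopHat hs (ξ + recip ζ k) l * χ ξ) x) := by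
  -- Poisson summation at scale one for `h(x - ·)` and `synth χ`, both sampled on the lattice
  -- shifted by `y`.
  have h1 := hasSum_conj_latCoeff_mul_latCoeff
    (decaying_latPull one_pos ζ y (weighted_hopSymbol hh hl x)) (decaying_latPull one_pos ζ y hχ)
  have hA := recipArea_pos
  have hterm : ∀ k : Fin 2 → ℤ,
      ∫ η, (starRingEnd ℂ) (latPull 1 ζ y (hopSymbol hs l x) (η + intVec k)) * latPull 1 ζ y χ η =
      ((2 / Real.sqrt 3 : ℝ) : ℂ) *
        (Complex.exp (Complex.I * (inner ℝ (recip ζ k) (x - y) : ℝ)) *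
          synth (fun ξ => hopHat hs (ξ + recip ζ k) l * χ ξ) x) := by
    intro k
    have h2 := integral_comp_latMap one_pos ζ (fun ξ => ((recipArea : ℝ) : ℂ) ^ 2 *
      ((starRingEnd ℂ) (Complex.exp (Complex.I * (inner ℝ (ξ + recip ζ k) y : ℝ)) *
        hopSymbol hs l x (ξ + recip ζ k)) * (Complex.exp (Complex.I * (inner ℝ ξ y : ℝ)) * χ ξ)))
    have h3 : ∀ η, (starRingEnd ℂ) (latPull 1 ζ y (hopSymbol hs l x) (η + intVec k)) *
        latPull 1 ζ y χ η = ((recipArea : ℝ) : ℂ) ^ 2 *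
      ((starRingEnd ℂ) (Complex.exp (Complex.I * (inner ℝ (latMap 1 ζ η + recip ζ k) y : ℝ)) *
        hopSymbol hs l x (latMap 1 ζ η + recip ζ k)) *
          (Complex.exp (Complex.I * (inner ℝ (latMap 1 ζ η) y : ℝ)) * χ (latMap 1 ζ η))) := by
      intro η
      rw [latPull, latPull, latMap_add_intVec, map_mul, Complex.conj_ofReal]
      simp only [one_pow, div_one, inv_one, one_smul]
      ring
    simp_rw [h3]
    rw [h2, one_pow, synth, ← integral_const_mul, ← integral_const_mul, ← integral_smul]
    congr 1
    ext ξ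
    -- The momentum `ξ` drops out of the phase at `y`: only the reciprocal vector remembers the
    -- shift of the lattice.
    have e1 : Complex.exp (Complex.I * (inner ℝ (recip ζ k) (x - y) : ℝ)) *
        Complex.exp (Complex.I * (inner ℝ ξ x : ℝ)) =
        Complex.exp (Complex.I * ((-inner ℝ (ξ + recip ζ k) y : ℝ) : ℂ)) *
        Complex.exp (Complex.I * (inner ℝ ξ y : ℝ)) *
        Complex.exp (Complex.I * (inner ℝ (ξ + recip ζ k) x : ℝ)) := by
      rw [← exp_I_mul_add, ← exp_I_mul_add, ← exp_I_mul_add]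
      congr 3
      rw [inner_sub_right, inner_add_left, inner_add_left]
      ring
    rw [hopSymbol, map_mul, map_mul, Complex.conj_ofReal, Complex.conj_conj, conj_exp_I_mul,
      Complex.real_smul]
    have e2 : ((1 / recipArea : ℝ) : ℂ) * (recipArea : ℂ) ^ 2 *
        ((1 / (2 * Real.pi) ^ 2 : ℝ) : ℂ) = ((2 / Real.sqrt 3 : ℝ) : ℂ) := by
      rw [← recipArea_div]
      push_cast
      have : (recipArea : ℂ) ≠ 0 := by exact_mod_cast hA.ne'
      field_simp
    rw [← e2]
    linear_combination (-(((1 / recipArea : ℝ) : ℂ) * (recipArea : ℂ) ^ 2 *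
        ((1 / (2 * Real.pi) ^ 2 : ℝ) : ℂ)) * hopHat hs (ξ + recip ζ k) l * χ ξ) * e1
  simp_rw [hterm, latCoeff_latPull one_pos, synth_hopSymbol hh hl, Complex.conj_ofReal, one_smul,
    tsum_mul_left] at h1
  refine ⟨?_, h1.2⟩
  have h4 : ((2 / Real.sqrt 3 : ℝ) : ℂ) ≠ 0 := by
    have : (2 / Real.sqrt 3 : ℝ) ≠ 0 := by positivity
    exact_mod_cast this
  exact (summable_mul_left_iff h4).1 h1.1

/-! ### Wave packets -/

/-- The symbol `γ⁻¹ φ((ξ - κ) / γ)` of a wave packet at `κ`. -/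
def packetSymbol (γ : ℝ) (κ : Plane) (φ : Plane → ℂ) (ξ : Plane) : ℂ :=
  ((γ⁻¹ : ℝ) : ℂ) * φ (γ⁻¹ • (ξ - κ))

lemma integral_packet {γ : ℝ} (hγ : 0 < γ) (κ : Plane) (F : Plane → ℂ) :
    ∫ ξ, F (γ⁻¹ • (ξ - κ)) = ((γ ^ 2 : ℝ) : ℂ) * ∫ ξ, F ξ := by
  rw [integral_sub_right_eq_self (fun ξ => F (γ⁻¹ • ξ)) κ, Measure.integral_comp_inv_smul,
    finrank_euclideanSpace, Fintype.card_fin, abs_of_nonneg (by positivity), Complex.real_smul]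

/-- The amplitude `γ` of the packet is the prefactor `γ⁻¹` times the Jacobian `γ²`. -/
lemma synth_packetSymbol {γ : ℝ} (hγ : 0 < γ) (κ : Plane) (φ : Plane → ℂ) (x : Plane) :
    synth (packetSymbol γ κ φ) x =
      (γ : ℂ) * Complex.exp (Complex.I * (inner ℝ κ x : ℝ)) * synth φ (γ • x) := by
  have h := integral_packet hγ κ (fun ξ =>
    Complex.exp (Complex.I * (inner ℝ (κ + γ • ξ) x : ℝ)) * (((γ⁻¹ : ℝ) : ℂ) * φ ξ))
  have e : ∀ ξ : Plane, κ + γ • γ⁻¹ • (ξ - κ) = ξ := by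
    intro ξ; rw [smul_inv_smul₀ hγ.ne']; abel
  simp_rw [e] at h
  rw [synth]
  unfold packetSymbol
  rw [h, synth, ← integral_const_mul, ← integral_const_mul]
  congr 1
  ext ξ
  rw [inner_add_left, exp_I_mul_add, real_inner_smul_left, real_inner_smul_right]
  have : (γ : ℂ) ≠ 0 := by exact_mod_cast hγ.ne'
  push_cast
  field_simp

lemma quasiMeasurePreserving_packet {γ : ℝ} (hγ : 0 < γ) (κ : Plane) :
    Measure.QuasiMeasurePreserving (fun ξ : Plane => γ⁻¹ • (ξ - κ)) := by
  have h1 : Measure.QuasiMeasurePreserving (fun ξ : Plane => γ⁻¹ • ξ) := by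
    refine ⟨measurable_const_smul (γ⁻¹ : ℝ), ?_⟩
    rw [Measure.map_addHaar_smul volume (by positivity)]
    exact Measure.smul_absolutelyContinuous
  exact h1.comp (measurePreserving_sub_right volume κ).quasiMeasurePreserving

lemma wt_add_le (ξ κ : Plane) : wt (ξ + κ) ≤ 2 * wt κ * wt ξ := by
  unfold wt
  have h := norm_add_le ξ κ
  have h2 : ‖ξ + κ‖ ^ 2 ≤ (‖ξ‖ + ‖κ‖) ^ 2 := by gcongr
  nlinarith [sq_nonneg (‖ξ‖ - ‖κ‖), mul_nonneg (sq_nonneg ‖ξ‖) (sq_nonneg ‖κ‖)]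

lemma wt_smul_le (γ : ℝ) (ξ : Plane) : wt (γ • ξ) ≤ (1 + γ ^ 2) * wt ξ := by
  unfold wt
  rw [norm_smul, mul_pow, Real.norm_eq_abs, sq_abs]
  nlinarith [sq_nonneg γ, sq_nonneg ‖ξ‖]

/-- Qualitative only: the constants involved degenerate as `γ → 0`, and the lemma serves just to
license Poisson summation. -/
lemma weighted_packetSymbol {γ : ℝ} (hγ : 0 < γ) (κ : Plane) {φ : Plane → ℂ}
    (h : Weighted 1 φ) : Weighted 1 (packetSymbol γ κ φ) := by
  have hq := quasiMeasurePreserving_packet hγ κ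
  refine ⟨(h.aesm.comp_quasiMeasurePreserving hq).const_mul _, ?_⟩
  have hG : MemLp (fun ξ => ((2 * wt κ * (1 + γ ^ 2) * γ⁻¹ : ℝ) : ℂ) • (wt ξ ^ 1 : ℝ) • φ ξ) 2
      volume := h.memLp_smul.const_smul ((2 * wt κ * (1 + γ ^ 2) * γ⁻¹ : ℝ) : ℂ)
  have h1 : eLpNorm (fun ξ : Plane => ((2 * wt κ * (1 + γ ^ 2) * γ⁻¹ : ℝ) : ℂ) •
      (wt (γ⁻¹ • (ξ - κ)) ^ 1 : ℝ) • φ (γ⁻¹ • (ξ - κ))) 2 volume < ⊤ := by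
    have h2 := eLpNorm_comp_smul_plane (fun ξ => ((2 * wt κ * (1 + γ ^ 2) * γ⁻¹ : ℝ) : ℂ) •
      (wt ξ ^ 1 : ℝ) • φ ξ) (inv_pos.2 hγ)
    have h3 : MemLp (fun ξ : Plane => ((2 * wt κ * (1 + γ ^ 2) * γ⁻¹ : ℝ) : ℂ) •
      (wt (γ⁻¹ • ξ) ^ 1 : ℝ) • φ (γ⁻¹ • ξ)) 2 volume := by
      refine ⟨?_, ?_⟩
      · have := hG.1.comp_quasiMeasurePreserving (quasiMeasurePreserving_packet hγ 0)
        simpa [Function.comp_def] using this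
      · rw [h2]; exact ENNReal.mul_lt_top ENNReal.ofReal_lt_top hG.2
    exact (h3.comp_measurePreserving (measurePreserving_sub_right volume κ)).2
  refine lt_of_le_of_lt (eLpNorm_mono fun ξ => ?_) h1
  have hw := wt_pos κ
  have hw2 := wt_pos ξ
  have hw3 := wt_pos (γ⁻¹ • (ξ - κ))
  rw [packetSymbol, norm_smul, norm_mul, norm_smul, norm_smul, Complex.norm_real,
    Complex.norm_real, pow_one, pow_one, Real.norm_of_nonneg hw2.le, Real.norm_of_nonneg hw3.le,
    Real.norm_of_nonneg (by positivity), Real.norm_of_nonneg (by positivity)]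
  have e : wt ξ ≤ 2 * wt κ * ((1 + γ ^ 2) * wt (γ⁻¹ • (ξ - κ))) := by
    have e1 : ξ = γ • (γ⁻¹ • (ξ - κ)) + κ := by rw [smul_inv_smul₀ hγ.ne']; abel
    calc wt ξ = wt (γ • (γ⁻¹ • (ξ - κ)) + κ) := by rw [← e1]
      _ ≤ 2 * wt κ * wt (γ • (γ⁻¹ • (ξ - κ))) := wt_add_le _ _
      _ ≤ _ := by gcongr; exact wt_smul_le _ _
  calc wt ξ * (γ⁻¹ * ‖φ (γ⁻¹ • (ξ - κ))‖)
      ≤ (2 * wt κ * ((1 + γ ^ 2) * wt (γ⁻¹ • (ξ - κ)))) * (γ⁻¹ * ‖φ (γ⁻¹ • (ξ - κ))‖) := by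
        gcongr
    _ = _ := by ring

/-- Poisson summation for the interlayer hopping applied to a wave packet. -/
lemma hasSum_hop_mul_packet (hh : HoppingAssumption hs C₁ C₂ C₃ D₁ D₂ l₀) {l : ℝ} (hl : l₀ ≤ l)
    {γ : ℝ} (hγ : 0 < γ) (ζ : ℝ) (κ x y : Plane) {φ : Plane → ℂ} (hφ : Weighted 1 φ) :
    (Summable fun k : Fin 2 → ℤ => Complex.exp (Complex.I * (inner ℝ (recip ζ k) (x - y) : ℝ)) *
      ((γ : ℂ) * Complex.exp (Complex.I * (inner ℝ κ x : ℝ)) *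
        synth (fun ξ => hopHat hs (κ + γ • ξ + recip ζ k) l * φ ξ) (γ • x))) ∧
    HasSum (fun n : Fin 2 → ℤ => (hop hs (x - (latPoint ζ n + y)) l : ℂ) *
        ((γ : ℂ) * Complex.exp (Complex.I * (inner ℝ κ (latPoint ζ n + y) : ℝ)) *
          synth φ (γ • (latPoint ζ n + y))))
      (((2 / Real.sqrt 3 : ℝ) : ℂ) * ∑' k : Fin 2 → ℤ,
        Complex.exp (Complex.I * (inner ℝ (recip ζ k) (x - y) : ℝ)) *
          ((γ : ℂ) * Complex.exp (Complex.I * (inner ℝ κ x : ℝ)) *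
            synth (fun ξ => hopHat hs (κ + γ • ξ + recip ζ k) l * φ ξ) (γ • x))) := by
  have h := hasSum_hop_mul_synth hh hl ζ x y (weighted_packetSymbol hγ κ hφ)
  have e : ∀ k : Fin 2 → ℤ,
      synth (fun ξ => hopHat hs (ξ + recip ζ k) l * packetSymbol γ κ φ ξ) x =
      (γ : ℂ) * Complex.exp (Complex.I * (inner ℝ κ x : ℝ)) *
        synth (fun ξ => hopHat hs (κ + γ • ξ + recip ζ k) l * φ ξ) (γ • x) := by
    intro k
    rw [← synth_packetSymbol hγ]
    congr 1
    ext ξ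
    rw [packetSymbol, packetSymbol, smul_inv_smul₀ hγ.ne', add_sub_cancel]
    ring
  simp_rw [e, synth_packetSymbol hγ] at h
  exact h

/-! ### Momentum hops and bounds for the interlayer symbols -/

/-- The momentum hops to the three equivalent Dirac points. -/
def nearHops : Finset (Fin 2 → ℤ) := {0, ![0, 1], ![-1, 0]}

/-- The points of the reciprocal lattice translated by the Dirac point. -/
def valley (k : Fin 2 → ℤ) : Plane := kappa + ((k 0 : ℝ) • bVec 0 + (k 1 : ℝ) • bVec 1)

lemma rot_valley (ζ : ℝ) (k : Fin 2 → ℤ) : rot ζ (valley k) = rot ζ kappa + recip ζ k := by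
  rw [valley, rot_add, recip]

/-- The quadratic polynomial describing the distances of the Dirac points from the origin. -/
def hopForm (k : Fin 2 → ℤ) : ℤ := k 0 ^ 2 + k 1 ^ 2 - k 0 * k 1 + k 0 - k 1

lemma norm_valley_sq (k : Fin 2 → ℤ) :
    ‖valley k‖ ^ 2 = (4 * Real.pi / 3) ^ 2 * (1 + 3 * (hopForm k : ℝ)) := by
  have h3 := Real.sq_sqrt (show (0 : ℝ) ≤ 3 by norm_num)
  have h3' : Real.sqrt 3 ≠ 0 := by positivity
  rw [norm_sq_plane]
  simp only [valley, kappa, bVec, hopForm, PiLp.add_apply, PiLp.smul_apply, smul_eq_mul,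
    Matrix.cons_val_zero, Matrix.cons_val_one]
  push_cast
  have e : 2 * Real.pi / Real.sqrt 3 = 2 * Real.pi * Real.sqrt 3 / 3 := by
    field_simp
    linear_combination -h3
  simp only [e]
  linear_combination (4 * Real.pi ^ 2 / 9 * (k 0 + k 1 : ℝ) ^ 2) * h3

lemma norm_kappa : ‖kappa‖ = 4 * Real.pi / 3 := by
  rw [← sq_eq_sq₀ (norm_nonneg _) (by positivity), norm_sq_plane]
  simp [kappa]

lemma norm_kappa_pos : 0 < ‖kappa‖ := by rw [norm_kappa]; positivity

lemma norm_valley_sq' (k : Fin 2 → ℤ) : ‖valley k‖ ^ 2 = ‖kappa‖ ^ 2 * (1 + 3 * (hopForm k : ℝ)) := by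
  rw [norm_valley_sq, norm_kappa]

lemma hopForm_of_mem {k : Fin 2 → ℤ} (hk : k ∈ nearHops) : hopForm k = 0 := by
  simp only [nearHops, Finset.mem_insert, Finset.mem_singleton] at hk
  rcases hk with rfl | rfl | rfl <;> simp [hopForm]

/-- Completing the square, `4 hopForm k = (2k₁ - k₀ - 1)² + 3k₀² + 2k₀ - 1`, and similarly with the
roles exchanged. Nonpositive values are thus confined to a finite box, where inspection leaves only
the three near hops. -/
lemma one_le_hopForm {k : Fin 2 → ℤ} (hk : k ∉ nearHops) : 1 ≤ hopForm k := by
  by_contra! h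
  apply hk
  have h' : hopForm k ≤ 0 := by omega
  unfold hopForm at h'
  have h0 : -2 ≤ k 0 := by nlinarith [sq_nonneg (2 * k 1 - k 0 - 1)]
  have h0' : k 0 ≤ 1 := by nlinarith [sq_nonneg (2 * k 1 - k 0 - 1)]
  have h1 : -1 ≤ k 1 := by nlinarith [sq_nonneg (2 * k 0 - k 1 + 1)]
  have h1' : k 1 ≤ 2 := by nlinarith [sq_nonneg (2 * k 0 - k 1 + 1)]
  have hk' : k = ![k 0, k 1] := by ext i; fin_cases i <;> rfl
  rw [hk']
  generalize k 0 = p at *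
  generalize k 1 = q at *
  interval_cases p <;> interval_cases q <;> simp_all [nearHops]

lemma norm_valley_of_mem {k : Fin 2 → ℤ} (hk : k ∈ nearHops) : ‖valley k‖ = ‖kappa‖ := by
  rw [← sq_eq_sq₀ (norm_nonneg _) (norm_nonneg _), norm_valley_sq', hopForm_of_mem hk]
  simp

/-- The form is integral, so `1 + 3 hopForm` jumps from 1 to at least 4. The resulting factor 2 is
what the hypothesis `D₁ / D₂ < 2` is matched to. -/
lemma two_mul_le_norm_valley {k : Fin 2 → ℤ} (hk : k ∉ nearHops) :
    2 * ‖kappa‖ ≤ ‖valley k‖ := by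
  rw [← sq_le_sq₀ (by positivity) (norm_nonneg _), norm_valley_sq']
  have : (1 : ℝ) ≤ hopForm k := by exact_mod_cast one_le_hopForm hk
  nlinarith [sq_nonneg ‖kappa‖]

/-- Growth linear in `k`, needed to sum over the far hops; the constant is not sharp. -/
lemma norm_le_norm_valley {k : Fin 2 → ℤ} (hk : k ∉ nearHops) :
    ‖kappa‖ * max 1 ‖k‖ / 4 ≤ ‖valley k‖ := by
  have h2 := two_mul_le_norm_valley hk
  have hκ := norm_kappa_pos
  rcases le_total ‖k‖ 1 with h1 | h1
  · rw [max_eq_left h1]; linarith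
  rw [max_eq_right h1, ← sq_le_sq₀ (by positivity) (norm_nonneg _), norm_valley_sq']
  have hq : (1 : ℝ) ≤ hopForm k := by exact_mod_cast one_le_hopForm hk
  have hform : (hopForm k : ℝ) = (k 0 : ℝ) ^ 2 + (k 1 : ℝ) ^ 2 - k 0 * k 1 + k 0 - k 1 := by
    unfold hopForm; push_cast; ring
  have hK : ‖k‖ ^ 2 ≤ 16 * (1 + 3 * (hopForm k : ℝ)) := by
    have hb : ∀ i, |(k i : ℝ)| ≤ ‖k‖ := fun i => by
      have := norm_le_pi_norm k i
      rwa [Int.norm_eq_abs] at this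
    have hmax : ‖k‖ ^ 2 ≤ (k 0 : ℝ) ^ 2 + (k 1 : ℝ) ^ 2 := by
      have : ‖k‖ ≤ Real.sqrt ((k 0 : ℝ) ^ 2 + (k 1 : ℝ) ^ 2) := by
        rw [pi_norm_le_iff_of_nonneg (Real.sqrt_nonneg _)]
        intro i
        rw [Int.norm_eq_abs]
        apply Real.abs_le_sqrt
        fin_cases i <;> simp <;> positivity
      calc ‖k‖ ^ 2 ≤ _ := pow_le_pow_left₀ (norm_nonneg _) this 2
        _ = _ := Real.sq_sqrt (by positivity)
    nlinarith [sq_nonneg ((k 0 : ℝ) - k 1), sq_nonneg ((k 0 : ℝ) + k 1),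
      sq_nonneg ((k 0 : ℝ) - k 1 + 1), sq_nonneg ((k 0 : ℝ) + 1), sq_nonneg ((k 1 : ℝ) - 1)]
  nlinarith [sq_nonneg ‖kappa‖]

lemma norm_le_one_of_mem {k : Fin 2 → ℤ} (hk : k ∈ nearHops) : ‖k‖ ≤ 1 := by
  simp only [nearHops, Finset.mem_insert, Finset.mem_singleton] at hk
  rw [pi_norm_le_iff_of_nonneg zero_le_one]
  intro i
  rcases hk with rfl | rfl | rfl <;> fin_cases i <;> simp

lemma latWeight_of_mem {k : Fin 2 → ℤ} (hk : k ∈ nearHops) : latWeight k = 1 := by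
  rw [latWeight, max_eq_left (norm_le_one_of_mem hk)]; simp

lemma inv_cube_le_latWeight {k : Fin 2 → ℤ} {R : ℝ} (hR : ‖kappa‖ * max 1 ‖k‖ / 4 ≤ R) :
    (R ^ 3)⁻¹ ≤ 64 / ‖kappa‖ ^ 3 * latWeight k := by
  have hκ := norm_kappa_pos
  have hm : (0 : ℝ) < max 1 ‖k‖ := by positivity
  have e : 64 / ‖kappa‖ ^ 3 * latWeight k = ((‖kappa‖ * max 1 ‖k‖ / 4) ^ 3)⁻¹ := by
    unfold latWeight
    field_simp
    norm_num
  rw [e]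
  gcongr

/-- The Fourier transform of the hopping function is radial. -/
lemma hopHat_eq_of_norm_eq (hs : ℝ → ℝ) (l : ℝ) {ξ ξ' : Plane} (h : ‖ξ‖ = ‖ξ'‖) :
    hopHat hs ξ l = hopHat hs ξ' l := by
  -- Vectors of equal length are exchanged by a reflection, which preserves Lebesgue measure and the
  -- radial function `h`.
  obtain ⟨A, hA⟩ : ∃ A : Plane ≃ₗᵢ[ℝ] Plane, A ξ = ξ' :=
    ⟨(ℝ ∙ (ξ - ξ'))ᗮ.reflection, Submodule.reflection_sub h⟩
  unfold hopHat
  rw [← A.measurePreserving.integral_comp A.toHomeomorph.measurableEmbedding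
    (fun r => Complex.exp (-Complex.I * (inner ℝ ξ' r : ℝ)) * (hop hs r l : ℂ))]
  congr 1
  ext r
  rw [← hA, A.inner_map_map, hop, hop, A.norm_map]

variable {lam₀ lam₁ : ℝ}

lemma hopHat_rot_valley_of_mem {γ θ l : ℝ} (hS : Scaling hs l₀ lam₀ lam₁ γ θ l) (ζ : ℝ)
    {k : Fin 2 → ℤ} (hk : k ∈ nearHops) :
    hopHat hs (rot ζ (valley k)) l = ((lam₀ * γ : ℝ) : ℂ) := by
  rw [hopHat_eq_of_norm_eq hs l (ξ' := kappa) (by rw [norm_rot, norm_valley_of_mem hk])]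
  exact hS.hopHat_eq

lemma norm_hopHat_le (hh : HoppingAssumption hs C₁ C₂ C₃ D₁ D₂ l₀) {l : ℝ} (hl : l₀ ≤ l)
    (ξ : Plane) : ‖hopHat hs ξ l‖ ≤ C₂ := by
  refine (hh.upper l hl ξ).trans (mul_le_of_le_one_right hh.C₂_pos.le ?_)
  rw [Real.exp_le_one_iff]
  have := mul_nonneg (mul_pos hh.D₂_pos (hh.l₀_pos.trans_le hl)).le (norm_nonneg ξ)
  linarith

/-! ### Size of the interlayer symbols -/

/-- The decay rate of the hopping function expressed through the scaling parameter. -/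
lemma exp_le_rpow (hh : HoppingAssumption hs C₁ C₂ C₃ D₁ D₂ l₀) (hlam₀ : 0 < lam₀) {γ θ l : ℝ}
    (hS : Scaling hs l₀ lam₀ lam₁ γ θ l) {t : ℝ} (ht : 0 ≤ t) :
    Real.exp (-(t * (D₁ * l * ‖kappa‖))) ≤ (lam₀ / C₁) ^ t * γ ^ t := by
  -- With the scaling relation this reads `C₁ e^{-D₁ℓ|κ|} ≤ λ₀γ`, and the claim is its `t`-th power.
  -- Nowhere else is decay in `ℓ` converted into a power of `γ`.
  have h1 := hh.lower l hS.l₀_le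
  have hC := hh.C₁_pos
  rw [hS.hopHat_eq, Complex.ofReal_re, ← le_div_iff₀' hC, mul_div_right_comm] at h1
  have hγ := hS.γ_pos
  rw [← Real.mul_rpow (by positivity) hγ.le]
  calc Real.exp (-(t * (D₁ * l * ‖kappa‖))) = Real.exp (-D₁ * l * ‖kappa‖) ^ t := by
        rw [← Real.exp_mul]; ring_nf
    _ ≤ _ := Real.rpow_le_rpow (Real.exp_pos _).le h1 ht

/-- The interlayer symbol after subtraction of its leading part. -/
def hopDefect (hs : ℝ → ℝ) (l lam₀ γ ζ : ℝ) (k : Fin 2 → ℤ) (ξ : Plane) : ℂ :=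
  hopHat hs (rot ζ kappa + γ • ξ + recip ζ k) l -
    if k ∈ nearHops then ((lam₀ * γ : ℝ) : ℂ) else 0

lemma norm_le_wt (ξ : Plane) : ‖ξ‖ ≤ wt ξ := by unfold wt; nlinarith [sq_nonneg (‖ξ‖ - 1)]

/-- At such momenta `(γ‖ξ‖ / εR)³ ≥ 1` may be inserted for free: `γ³` beats `γ^s`, `R⁻³` supplies
the summable weight, and `‖ξ‖³` is absorbed by `wt³`. -/
lemma large_momentum_bound {γ ε R s : ℝ} {k : Fin 2 → ℤ} {ξ : Plane} (hγ : 0 < γ) (hγ1 : γ ≤ 1)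
    (hε : 0 < ε) (hR0 : 0 < R) (hs3 : s ≤ 3) (hR : (R ^ 3)⁻¹ ≤ 64 / ‖kappa‖ ^ 3 * latWeight k)
    (h : ε * R ≤ γ * ‖ξ‖) :
    1 ≤ (64 / (ε ^ 3 * ‖kappa‖ ^ 3)) * γ ^ s * latWeight k * wt ξ ^ 3 := by
  have hκ := norm_kappa_pos
  have hw := latWeight_pos k
  have h1 : (ε * R) ^ 3 ≤ (γ * ‖ξ‖) ^ 3 := by gcongr
  have h2 : γ ^ (3 : ℕ) ≤ γ ^ s := by
    rw [← Real.rpow_natCast]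
    exact Real.rpow_le_rpow_of_exponent_ge hγ hγ1 (by exact_mod_cast hs3)
  calc (1 : ℝ) = (ε * R) ^ 3 * ((ε ^ 3)⁻¹ * (R ^ 3)⁻¹) := by field_simp
    _ ≤ (γ * ‖ξ‖) ^ 3 * ((ε ^ 3)⁻¹ * (64 / ‖kappa‖ ^ 3 * latWeight k)) := by gcongr
    _ = γ ^ 3 * ‖ξ‖ ^ 3 * ((ε ^ 3)⁻¹ * (64 / ‖kappa‖ ^ 3 * latWeight k)) := by ring
    _ ≤ γ ^ s * wt ξ ^ 3 * ((ε ^ 3)⁻¹ * (64 / ‖kappa‖ ^ 3 * latWeight k)) := by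
        gcongr
        exact norm_le_wt ξ
    _ = _ := by field_simp

/-- Points of the segment are `p + t v` with `0 ≤ t ≤ 1`, so none is more than `r` closer to the
origin than `p`. -/
lemma le_infDist_segment {p v : Plane} {r : ℝ} (h : ‖v‖ ≤ r) :
    ‖p‖ - r ≤ Metric.infDist 0 (segment ℝ (p + v) p) := by
  rw [Metric.le_infDist ⟨p, right_mem_segment ℝ _ _⟩]
  intro q hq
  rw [segment_symm, segment_eq_image'] at hq
  obtain ⟨t, ⟨ht0, ht1⟩, rfl⟩ := hq
  rw [dist_zero_left, add_sub_cancel_left]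
  have h1 := norm_sub_norm_le p (-(t • v))
  rw [sub_neg_eq_add, norm_neg, norm_smul, Real.norm_of_nonneg ht0] at h1
  nlinarith [norm_nonneg v]

/-- The interlayer symbols agree with their leading parts up to `O(γ^{1+c})`, with a bound that is
summable over momentum hops. -/
lemma exists_norm_hopDefect_le (hh : HoppingAssumption hs C₁ C₂ C₃ D₁ D₂ l₀) (hlam₀ : 0 < lam₀)
    (lam₁ : ℝ) :
    ∃ C c : ℝ, 0 < C ∧ 0 < c ∧ c ≤ 1 ∧ ∀ γ θ l ζ : ℝ, Scaling hs l₀ lam₀ lam₁ γ θ l → γ ≤ 1 →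
      ∀ (k : Fin 2 → ℤ) (ξ : Plane),
        ‖hopDefect hs l lam₀ γ ζ k ξ‖ ≤ C * γ ^ (1 + c) * latWeight k * wt ξ ^ 3 := by
  have hD₁ := hh.D₁_pos
  have hD₂ := hh.D₂_pos
  have hC₁ := hh.C₁_pos
  have hC₂ := hh.C₂_pos
  have hC₃ := hh.C₃_pos
  have hl₀ := hh.l₀_pos
  have hκ := norm_kappa_pos
  set x := D₂ / D₁ with hx
  have hx0 : 0 < x := by positivity
  have hx1 : x ≤ 1 := (div_le_one hD₁).2 hh.D₂_le_D₁
  have hx2 : 1 < 2 * x := by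
    have := hh.D₁_div_D₂_lt
    rw [div_lt_iff₀ hD₂] at this
    rw [hx, ← mul_div_assoc, lt_div_iff₀ hD₁]; linarith
  have hxD : x * D₁ = D₂ := div_mul_cancel₀ _ hD₁.ne'
  -- Chosen so that `2x(1 - 2ε) = 1`, which makes `s = 2x(1 - ε)² = 1 + 2xε²` exceed one.
  set ε := (1 - 1 / (2 * x)) / 2 with hε
  have hε0 : 0 < ε := by
    have : 1 / (2 * x) < 1 := (div_lt_one (by positivity)).2 hx2
    linarith
  have hε1 : ε < 1 := by
    have : 0 < 1 / (2 * x) := by positivity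
    linarith
  -- Exponent left for a far hop: one factor `1 - ε` allows for the displacement `γξ`, the other
  -- sets decay aside for the sum over hops.
  set s := 2 * x * (1 - ε) ^ 2 with hs'
  have hs1 : 1 < s := by
    have e1 : 2 * x * (1 - 2 * ε) = 1 := by rw [hε]; field_simp; ring
    nlinarith [mul_pos hx0 (mul_pos hε0 hε0)]
  have hs2 : s ≤ 2 := by
    have : (1 - ε) ^ 2 ≤ 1 := by nlinarith
    nlinarith
  -- The near hops yield the exponent `1 + x(1 - ε)`, so `s` serves in every case.
  have hsx : s ≤ 1 + x * (1 - ε) := by nlinarith [mul_pos hx0 (sub_pos.2 hε1)]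
  -- Rate of the decay set aside, uniform in `ℓ ≥ ℓ₀`.
  set a := D₂ * l₀ * (1 - ε) * ε with ha'
  have ha : 0 < a := by have := sub_pos.2 hε1; positivity
  set B₁ := C₂ * (lam₀ / C₁) ^ s * (6 / a ^ 3 * (64 / ‖kappa‖ ^ 3)) with hB₁
  set B₂ := 2 * C₂ * (64 / (ε ^ 3 * ‖kappa‖ ^ 3)) with hB₂
  set B₃ := C₃ * (lam₀ / C₁) ^ (x * (1 - ε)) with hB₃
  have hB₁0 : 0 < B₁ := by positivity
  have hB₂0 : 0 < B₂ := by positivity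
  have hB₃0 : 0 < B₃ := by positivity
  refine ⟨B₁ + B₂ + B₃, s - 1, by positivity, by linarith, by linarith, ?_⟩
  intro γ θ l ζ hS hγ1 k ξ
  have hγ := hS.γ_pos
  have hl := hS.l₀_le
  have hl0 : 0 < l := hl₀.trans_le hl
  rw [add_sub_cancel]
  set W := γ ^ s * latWeight k * wt ξ ^ 3 with hW
  have hwk := latWeight_pos k
  have hwt := one_le_wt ξ
  have hwt0 := wt_pos ξ
  have hW0 : 0 < W := by positivity
  -- The constants belong to a far hop at small momentum, to any hop at large momentum, and to a
  -- near hop at small momentum, respectively.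
  suffices ‖hopDefect hs l lam₀ γ ζ k ξ‖ ≤ B₁ * W ∨ ‖hopDefect hs l lam₀ γ ζ k ξ‖ ≤ B₂ * W ∨
      ‖hopDefect hs l lam₀ γ ζ k ξ‖ ≤ B₃ * W by
    have e : (B₁ + B₂ + B₃) * γ ^ s * latWeight k * wt ξ ^ 3 = B₁ * W + B₂ * W + B₃ * W := by
      rw [hW]; ring
    rw [e]
    have h1 := mul_pos hB₁0 hW0
    have h2 := mul_pos hB₂0 hW0
    have h3 := mul_pos hB₃0 hW0
    rcases this with h | h | h <;> linarith
  have harg : rot ζ kappa + γ • ξ + recip ζ k = rot ζ (valley k) + γ • ξ := by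
    rw [rot_valley]; abel
  have hnv : ‖rot ζ (valley k)‖ = ‖valley k‖ := norm_rot ζ _
  set R := ‖valley k‖ with hR
  have hnξ : ‖γ • ξ‖ = γ * ‖ξ‖ := by rw [norm_smul, Real.norm_of_nonneg hγ.le]
  rw [hopDefect, harg]
  have h2C : ‖hopHat hs (rot ζ (valley k) + γ • ξ) l -
      if k ∈ nearHops then ((lam₀ * γ : ℝ) : ℂ) else 0‖ ≤ 2 * C₂ := by
    refine (norm_sub_le _ _).trans ?_
    have h1 := norm_hopHat_le hh hl (rot ζ (valley k) + γ • ξ)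
    have h2 : ‖(if k ∈ nearHops then ((lam₀ * γ : ℝ) : ℂ) else 0)‖ ≤ C₂ := by
      split_ifs
      · rw [← hS.hopHat_eq]; exact norm_hopHat_le hh hl _
      · simpa using hC₂.le
    linarith
  have hlarge : 0 < R → (R ^ 3)⁻¹ ≤ 64 / ‖kappa‖ ^ 3 * latWeight k → ε * R ≤ γ * ‖ξ‖ →
      ‖hopHat hs (rot ζ (valley k) + γ • ξ) l -
        if k ∈ nearHops then ((lam₀ * γ : ℝ) : ℂ) else 0‖ ≤ B₂ * W := by
    intro hR0 hRw hlt
    have h1 := large_momentum_bound (s := s) (ξ := ξ) hγ hγ1 hε0 hR0 (by linarith) hRw hlt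
    calc _ ≤ 2 * C₂ := h2C
      _ = 2 * C₂ * 1 := by ring
      _ ≤ 2 * C₂ * _ := mul_le_mul_of_nonneg_left h1 (by positivity)
      _ = B₂ * W := by rw [hB₂, hW]; ring
  by_cases hk : k ∈ nearHops
  · have hRκ : R = ‖kappa‖ := norm_valley_of_mem hk
    have hw1 := latWeight_of_mem hk
    rcases le_total (γ * ‖ξ‖) (ε * R) with hsm | hbig
    · right; right
      -- By radial symmetry the subtracted constant is the value of `ĥ` at the rotated Dirac point
      -- itself, so the Lipschitz bound applies, along a segment at distance at least `(1 - ε)|κ|`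
      -- from the origin.
      rw [if_pos hk, ← hopHat_rot_valley_of_mem hS ζ hk]
      refine (hh.lipschitz l hl _ _).trans ?_
      rw [add_sub_cancel_left, hnξ]
      have hd := le_infDist_segment (p := rot ζ (valley k)) (v := γ • ξ) (r := ε * R)
        (by rw [hnξ]; exact hsm)
      rw [hnv, hRκ] at hd
      have h3 : Real.exp (-D₂ * l * Metric.infDist 0
          (segment ℝ (rot ζ (valley k) + γ • ξ) (rot ζ (valley k)))) ≤
          (lam₀ / C₁) ^ (x * (1 - ε)) * γ ^ (x * (1 - ε)) := by
        refine le_trans ?_ (exp_le_rpow hh hlam₀ hS (t := x * (1 - ε))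
          (mul_nonneg hx0.le (by linarith)))
        rw [Real.exp_le_exp]
        have : D₂ * l * (‖kappa‖ - ε * ‖kappa‖) ≤ D₂ * l * Metric.infDist 0
          (segment ℝ (rot ζ (valley k) + γ • ξ) (rot ζ (valley k))) := by gcongr
        have e : x * (1 - ε) * (D₁ * l * ‖kappa‖) = D₂ * l * (‖kappa‖ - ε * ‖kappa‖) := by
          rw [← hxD]; ring
        rw [e]; linarith
      have h4 : γ ^ (x * (1 - ε)) * γ ≤ γ ^ s := by
        nth_rewrite 2 [← Real.rpow_one γ]
        rw [← Real.rpow_add hγ]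
        exact Real.rpow_le_rpow_of_exponent_ge hγ hγ1 (by linarith)
      have h5 : ‖ξ‖ ≤ wt ξ ^ 3 := (norm_le_wt ξ).trans (le_self_pow₀ hwt (by norm_num))
      calc _ ≤ C₃ * ((lam₀ / C₁) ^ (x * (1 - ε)) * γ ^ (x * (1 - ε))) * (γ * ‖ξ‖) := by gcongr
        _ = B₃ * ((γ ^ (x * (1 - ε)) * γ) * ‖ξ‖) := by rw [hB₃]; ring
        _ ≤ B₃ * (γ ^ s * wt ξ ^ 3) := by gcongr
        _ = B₃ * W := by rw [hW, hw1, mul_one]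
    · right; left
      refine hlarge (by rw [hRκ]; exact hκ) ?_ hbig
      refine inv_cube_le_latWeight ?_
      rw [max_eq_left (norm_le_one_of_mem hk), hRκ]
      linarith
  · have hR2 := two_mul_le_norm_valley hk
    have hR0 : 0 < R := by rw [hR]; linarith
    have hRw := inv_cube_le_latWeight (norm_le_norm_valley hk)
    rcases le_total (γ * ‖ξ‖) (ε * R) with hsm | hbig
    · left
      rw [if_neg hk, sub_zero]
      refine (hh.upper l hl _).trans ?_
      have hn : (1 - ε) * R ≤ ‖rot ζ (valley k) + γ • ξ‖ := by
        have h1 := norm_sub_norm_le (rot ζ (valley k)) (-(γ • ξ))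
        rw [sub_neg_eq_add, norm_neg, hnv, hnξ] at h1
        linarith
      -- Split `(1 - ε)R = (1 - ε)²R + (1 - ε)εR`: the first part with `R ≥ 2|κ|` produces `γ^s`,
      -- the second keeps decay in `k`.
      have hexp : Real.exp (-D₂ * l * ‖rot ζ (valley k) + γ • ξ‖) ≤
          Real.exp (-(s * (D₁ * l * ‖kappa‖))) * Real.exp (-(a * R)) := by
        rw [← Real.exp_add, Real.exp_le_exp]
        have h1 : D₂ * l * ((1 - ε) * R) ≤ D₂ * l * ‖rot ζ (valley k) + γ • ξ‖ := by gcongr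
        have h2 : D₂ * l * ((1 - ε) * ((1 - ε) * (2 * ‖kappa‖))) ≤
            D₂ * l * ((1 - ε) * ((1 - ε) * R)) := by
          have := sub_pos.2 hε1
          gcongr
        have h3 : a * R ≤ D₂ * l * ((1 - ε) * (ε * R)) := by
          have := sub_pos.2 hε1
          calc a * R = D₂ * l₀ * ((1 - ε) * (ε * R)) := by rw [ha']; ring
            _ ≤ _ := by gcongr
        have e : s * (D₁ * l * ‖kappa‖) = D₂ * l * ((1 - ε) * ((1 - ε) * (2 * ‖kappa‖))) := by
          rw [hs', ← hxD]; ring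
        rw [e]
        linarith
      have h1 := exp_le_rpow hh hlam₀ hS (t := s) (by linarith)
      have h2 : Real.exp (-(a * R)) ≤ 6 / a ^ 3 * (64 / ‖kappa‖ ^ 3 * latWeight k) := by
        have h3 := pow_le_factorial_mul_exp (x := a * R) (by positivity) 3
        have h4 : Real.exp (-(a * R)) ≤ 6 / a ^ 3 * (R ^ 3)⁻¹ := by
          rw [Real.exp_neg, ← div_eq_mul_inv, div_div, ← mul_pow, inv_eq_one_div,
            div_le_div_iff₀ (Real.exp_pos _) (by positivity)]
          norm_num [Nat.factorial] at h3 ⊢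
          linarith
        refine h4.trans ?_
        gcongr
      have h3 : 1 ≤ wt ξ ^ 3 := one_le_pow₀ hwt
      calc C₂ * Real.exp (-D₂ * l * ‖rot ζ (valley k) + γ • ξ‖)
          ≤ C₂ * (((lam₀ / C₁) ^ s * γ ^ s) *
            (6 / a ^ 3 * (64 / ‖kappa‖ ^ 3 * latWeight k))) := by
            gcongr
            exact hexp.trans (by gcongr)
        _ = B₁ * (γ ^ s * latWeight k * 1) := by rw [hB₁]; ring
        _ ≤ B₁ * W := by rw [hW]; gcongr
    · right; left
      exact hlarge hR0 hRw hbig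

/-! ### Calculus of superpositions of plane waves -/

/-- Cauchy–Schwarz for the factorization `‖v‖ = √w · (‖v‖ / √w)`. -/
lemma enorm_sq_tsum_le {ι : Type*} {w : ι → ℝ} (hw : ∀ k, 0 < w k) (v : ι → ℂ) :
    ‖∑' k, v k‖ₑ ^ 2 ≤ (∑' k, ENNReal.ofReal (w k)) *
      ∑' k, ENNReal.ofReal (w k)⁻¹ * ‖v k‖ₑ ^ 2 := by
  have h1 : ∀ k, ‖v k‖ₑ = ENNReal.ofReal (Real.sqrt (w k)) *
      (ENNReal.ofReal (Real.sqrt (w k))⁻¹ * ‖v k‖ₑ) := by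
    intro k
    have := Real.sqrt_pos.2 (hw k)
    rw [← mul_assoc, ← ENNReal.ofReal_mul this.le, mul_inv_cancel₀ this.ne']
    simp
  calc ‖∑' k, v k‖ₑ ^ 2 ≤ (∑' k, ‖v k‖ₑ) ^ 2 := by gcongr; exact enorm_tsum_le_tsum_enorm
    _ = (∑' k, ENNReal.ofReal (Real.sqrt (w k)) *
      (ENNReal.ofReal (Real.sqrt (w k))⁻¹ * ‖v k‖ₑ)) ^ 2 := by simp_rw [← h1]
    _ ≤ _ := ennreal_tsum_mul_sq_le _ _
    _ = _ := by
        congr 1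
        · refine tsum_congr fun k => ?_
          rw [← ENNReal.ofReal_pow (Real.sqrt_nonneg _), Real.sq_sqrt (hw k).le]
        · refine tsum_congr fun k => ?_
          rw [mul_pow, ← ENNReal.ofReal_pow (by positivity), inv_pow, Real.sq_sqrt (hw k).le]

/-- Minkowski's inequality for weighted series of square summable sequences. -/
lemma eLpNorm_count_tsum_le {ι κ : Type*} [MeasurableSpace κ] [MeasurableSingletonClass κ]
    {w : ι → ℝ} (hw : ∀ k, 0 < w k) {A : ℝ≥0∞} (v : ι → κ → ℂ)
    (hv : ∀ k, eLpNorm (v k) 2 Measure.count ≤ A * ENNReal.ofReal (w k)) :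
    eLpNorm (fun n => ∑' k, v k n) 2 Measure.count ≤ A * ∑' k, ENNReal.ofReal (w k) := by
  apply ennreal_le_of_sq_le
  rw [eLpNorm_two_count_sq]
  calc ∑' n, ‖∑' k, v k n‖ₑ ^ 2
      ≤ ∑' n, (∑' k, ENNReal.ofReal (w k)) * ∑' k, ENNReal.ofReal (w k)⁻¹ * ‖v k n‖ₑ ^ 2 :=
        ENNReal.tsum_le_tsum fun n => enorm_sq_tsum_le hw _
    _ = (∑' k, ENNReal.ofReal (w k)) *
        ∑' k, ENNReal.ofReal (w k)⁻¹ * eLpNorm (v k) 2 Measure.count ^ 2 := by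
        rw [ENNReal.tsum_mul_left, ENNReal.tsum_comm]
        simp_rw [ENNReal.tsum_mul_left, eLpNorm_two_count_sq]
    _ ≤ (∑' k, ENNReal.ofReal (w k)) *
        ∑' k, ENNReal.ofReal (w k)⁻¹ * (A * ENNReal.ofReal (w k)) ^ 2 := by
        gcongr with k
        exact hv k
    _ = (A * ∑' k, ENNReal.ofReal (w k)) ^ 2 := by
        have : ∀ k, ENNReal.ofReal (w k)⁻¹ * (A * ENNReal.ofReal (w k)) ^ 2 =
            A ^ 2 * ENNReal.ofReal (w k) := by
          intro k
          have : ENNReal.ofReal (w k)⁻¹ * ENNReal.ofReal (w k) = 1 := by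
            rw [← ENNReal.ofReal_mul (by have := hw k; positivity), inv_mul_cancel₀ (hw k).ne']
            simp
          calc _ = A ^ 2 * ENNReal.ofReal (w k) *
              (ENNReal.ofReal (w k)⁻¹ * ENNReal.ofReal (w k)) := by ring
            _ = _ := by rw [this, mul_one]
        simp_rw [this, ENNReal.tsum_mul_left]
        ring

/-- A multiplier of growth `wt^p` costs `p` weights, or `2p` derivatives. The interlayer error takes
`p = 3` and sampling takes one weight more; the four together are the `H⁸` norm. -/
lemma wNorm_mul_le {m φ : Plane → ℂ} {A : ℝ} (hA : 0 ≤ A) {p : ℕ}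
    (hm : ∀ ξ, ‖m ξ‖ ≤ A * wt ξ ^ p) (q : ℕ) :
    wNorm q (fun ξ => m ξ * φ ξ) ≤ ENNReal.ofReal A * wNorm (q + p) φ := by
  have h := eLpNorm_const_smul (A : ℝ) (fun ξ => (wt ξ ^ (q + p) : ℝ) • φ ξ) 2
    (volume : Measure Plane)
  rw [Real.enorm_of_nonneg hA] at h
  rw [wNorm, wNorm, ← h]
  refine eLpNorm_mono fun ξ => ?_
  have hw := wt_pos ξ
  rw [Pi.smul_apply, norm_smul, norm_mul, norm_smul, norm_smul,
    Real.norm_of_nonneg (by positivity), Real.norm_of_nonneg (by positivity),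
    Real.norm_of_nonneg (by positivity)]
  calc wt ξ ^ q * (‖m ξ‖ * ‖φ ξ‖) ≤ wt ξ ^ q * ((A * wt ξ ^ p) * ‖φ ξ‖) := by
        gcongr; exact hm ξ
    _ = _ := by rw [pow_add]; ring

lemma Weighted.mul {m φ : Plane → ℂ} {A : ℝ} (hA : 0 ≤ A) {p q : ℕ} (hmm : Continuous m)
    (hm : ∀ ξ, ‖m ξ‖ ≤ A * wt ξ ^ p) (h : Weighted (q + p) φ) :
    Weighted q (fun ξ => m ξ * φ ξ) :=
  ⟨hmm.aestronglyMeasurable.mul h.aesm,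
    (wNorm_mul_le hA hm q).trans_lt (ENNReal.mul_lt_top ENNReal.ofReal_lt_top h.lt_top)⟩

lemma integrable_exp_mul {φ : Plane → ℂ} (h : Integrable φ) (x : Plane) :
    Integrable (fun ξ => Complex.exp (Complex.I * (inner ℝ ξ x : ℝ)) * φ ξ) := by
  refine h.bdd_mul (c := 1) (Continuous.aestronglyMeasurable (by fun_prop)) ?_
  exact ae_of_all _ fun ξ => (norm_exp_I_mul _).le

lemma synth_add {φ ψ : Plane → ℂ} (hφ : Integrable φ) (hψ : Integrable ψ) (x : Plane) :
    synth (fun ξ => φ ξ + ψ ξ) x = synth φ x + synth ψ x := by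
  simp only [synth, mul_add]
  exact integral_add (integrable_exp_mul hφ x) (integrable_exp_mul hψ x)

lemma synth_const_mul (c : ℂ) (φ : Plane → ℂ) (x : Plane) :
    synth (fun ξ => c * φ ξ) x = c * synth φ x := by
  simp only [synth]
  rw [← integral_const_mul]
  congr 1; ext ξ; ring

lemma synth_finset_sum {ι : Type*} (s : Finset ι) {φ : ι → Plane → ℂ}
    (hφ : ∀ k ∈ s, Integrable (φ k)) (x : Plane) :
    synth (fun ξ => ∑ k ∈ s, φ k ξ) x = ∑ k ∈ s, synth (φ k) x := by
  simp only [synth, Finset.mul_sum]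
  exact integral_finsetSum s fun k hk => integrable_exp_mul (hφ k hk) x

lemma synth_apply_add (φ : Plane → ℂ) (x y : Plane) :
    synth φ (x + y) = synth (fun ξ => Complex.exp (Complex.I * (inner ℝ ξ y : ℝ)) * φ ξ) x := by
  simp only [synth]
  congr 1; ext ξ
  rw [inner_add_right, exp_I_mul_add]; ring

/-- Modulation of a superposition translates its symbol. -/
lemma exp_mul_synth (φ : Plane → ℂ) (s x : Plane) :
    Complex.exp (-Complex.I * (inner ℝ s x : ℝ)) * synth φ x = synth (fun ξ => φ (ξ + s)) x := by
  simp only [synth]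
  rw [← integral_add_right_eq_self
    (fun ξ => Complex.exp (Complex.I * (inner ℝ ξ x : ℝ)) * φ ξ) s, ← integral_const_mul]
  congr 1; ext ξ
  rw [inner_add_left, exp_I_mul_add]
  have : Complex.exp (-Complex.I * (inner ℝ s x : ℝ)) * Complex.exp (Complex.I * (inner ℝ s x : ℝ)) = 1 := by
    rw [← Complex.exp_add]; simp
  linear_combination (Complex.exp (Complex.I * (inner ℝ ξ x : ℝ)) * φ (ξ + s)) * this

/-- The real-linear form `v ↦ ⟨ξ, v⟩`, with complex values. -/
def innerForm (ξ : Plane) : Plane →L[ℝ] ℂ := Complex.ofRealCLM.comp (innerSL ℝ ξ)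

lemma innerForm_apply (ξ v : Plane) : innerForm ξ v = ((inner ℝ ξ v : ℝ) : ℂ) := rfl

lemma continuous_innerForm : Continuous innerForm := by
  unfold innerForm
  exact continuous_const.clm_comp (innerSL ℝ).continuous

lemma norm_innerForm_le (ξ : Plane) : ‖innerForm ξ‖ ≤ ‖ξ‖ := by
  refine ContinuousLinearMap.opNorm_le_bound _ (norm_nonneg _) fun v => ?_
  rw [innerForm_apply, Complex.norm_real]
  exact norm_inner_le_norm ξ v

lemma integrable_norm_mul {φ : Plane → ℂ} (h : Weighted 2 φ) :
    Integrable (fun ξ => ‖ξ‖ * ‖φ ξ‖) := by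
  have h1 : Weighted 1 (fun ξ => ((‖ξ‖ : ℝ) : ℂ) * φ ξ) := by
    refine Weighted.mul (p := 1) (A := 1) zero_le_one (by fun_prop) (fun ξ => ?_) h
    rw [Complex.norm_real, norm_norm, one_mul, pow_one]
    exact norm_le_wt ξ
  refine h1.integrable.norm.congr (ae_of_all _ fun ξ => ?_)
  simp

/-- The derivative of the integrand of `synth`. -/
def gradIntegrand (φ : Plane → ℂ) (x ξ : Plane) : Plane →L[ℝ] ℂ :=
  (Complex.I * (Complex.exp (Complex.I * (inner ℝ ξ x : ℝ)) * φ ξ)) • innerForm ξ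

lemma norm_gradIntegrand_le (φ : Plane → ℂ) (x ξ : Plane) :
    ‖gradIntegrand φ x ξ‖ ≤ ‖ξ‖ * ‖φ ξ‖ := by
  rw [gradIntegrand, norm_smul, norm_mul, norm_mul, norm_exp_I_mul, Complex.norm_I, one_mul,
    one_mul, mul_comm]
  exact mul_le_mul_of_nonneg_right (norm_innerForm_le ξ) (norm_nonneg _)

lemma integrable_gradIntegrand {φ : Plane → ℂ} (h : Weighted 2 φ) (x : Plane) :
    Integrable (gradIntegrand φ x) :=
  (integrable_norm_mul h).mono'
    (((integrable_exp_mul (h.mono one_le_two).integrable x).1.const_mul _).smul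
      continuous_innerForm.aestronglyMeasurable)
    (ae_of_all _ fun ξ => norm_gradIntegrand_le φ x ξ)

lemma hasFDerivAt_synth {φ : Plane → ℂ} (h : Weighted 2 φ) (x : Plane) :
    HasFDerivAt (synth φ) (∫ ξ, gradIntegrand φ x ξ) x := by
  have hi : Integrable φ := (h.mono one_le_two).integrable
  refine hasFDerivAt_integral_of_dominated_of_fderiv_le (s := Set.univ)
    (F' := gradIntegrand φ) (bound := fun ξ => ‖ξ‖ * ‖φ ξ‖) univ_mem
    (Eventually.of_forall fun x => (integrable_exp_mul hi x).1) (integrable_exp_mul hi x)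
    (integrable_gradIntegrand h x).1
    (ae_of_all _ fun ξ y _ => norm_gradIntegrand_le φ y ξ) (integrable_norm_mul h) ?_
  refine ae_of_all _ fun ξ y _ => ?_
  have h1 : HasFDerivAt (fun y : Plane => Complex.I * ((inner ℝ ξ y : ℝ) : ℂ))
      (Complex.I • innerForm ξ) y := (innerForm ξ).hasFDerivAt.const_mul Complex.I
  have h2 := (h1.cexp).mul_const (φ ξ)
  have e : gradIntegrand φ y ξ =
      φ ξ • Complex.exp (Complex.I * ((inner ℝ ξ y : ℝ) : ℂ)) • Complex.I • innerForm ξ := by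
    rw [gradIntegrand, smul_smul, smul_smul]
    congr 1
    ring
  rw [e]
  exact h2

lemma fderiv_synth {φ : Plane → ℂ} (h : Weighted 2 φ) (x v : Plane) :
    fderiv ℝ (synth φ) x v = synth (fun ξ => Complex.I * (inner ℝ ξ v : ℝ) * φ ξ) x := by
  rw [(hasFDerivAt_synth h x).fderiv,
    ContinuousLinearMap.integral_apply (integrable_gradIntegrand h x), synth]
  congr 1; ext ξ
  simp only [gradIntegrand, smul_apply, smul_eq_mul, innerForm_apply]
  ring

/-! ### Atomic sites -/

/-- Lattice cells as integer vectors. -/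
def cellEquiv : ℤ × ℤ ≃ (Fin 2 → ℤ) := (finTwoArrowEquiv ℤ).symm

lemma site_eq (θ : ℝ) (d : Plane) (i : Fin 2) (n : ℤ × ℤ) (σ : Fin 2) :
    site θ d i n σ = latPoint (layerAngle θ i) (cellEquiv n) + tauLayer θ d i σ := rfl

/-- The `ℓ²` norm of one component of a wave function. -/
def compNorm (ψ : State) (i σ : Fin 2) : ℝ≥0∞ :=
  eLpNorm (fun n : ℤ × ℤ => ψ i n σ) 2 Measure.count

lemma hNorm_sq (ψ : State) : hNorm ψ ^ 2 = ∑ i : Fin 2, ∑ σ : Fin 2, compNorm ψ i σ ^ 2 := by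
  rw [hNorm, ← ENNReal.rpow_natCast, ← ENNReal.rpow_mul]
  norm_num only [ENNReal.rpow_one]
  refine Finset.sum_congr rfl fun i _ => ?_
  simp_rw [compNorm, eLpNorm_two_count_sq, Fin.sum_univ_two]
  rw [ENNReal.tsum_add]

lemma compNorm_le_hNorm (ψ : State) (i σ : Fin 2) : compNorm ψ i σ ≤ hNorm ψ := by
  apply ennreal_le_of_sq_le
  rw [hNorm_sq]
  refine le_trans ?_ (Finset.single_le_sum (f := fun i => ∑ σ, compNorm ψ i σ ^ 2)
    (fun _ _ => zero_le) (Finset.mem_univ i))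
  exact Finset.single_le_sum (f := fun σ => compNorm ψ i σ ^ 2)
    (fun _ _ => zero_le) (Finset.mem_univ σ)

lemma ennreal_sq_add_sq_le (a b : ℝ≥0∞) : a ^ 2 + b ^ 2 ≤ (a + b) ^ 2 :=
  calc a ^ 2 + b ^ 2 ≤ a ^ 2 + b ^ 2 + 2 * a * b := le_self_add
    _ = _ := by ring

lemma hNorm_le_sum (ψ : State) : hNorm ψ ≤ ∑ i : Fin 2, ∑ σ : Fin 2, compNorm ψ i σ := by
  apply ennreal_le_of_sq_le
  rw [hNorm_sq]
  simp only [Fin.sum_univ_two]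
  refine le_trans ?_ (ennreal_sq_add_sq_le _ _)
  gcongr <;> exact ennreal_sq_add_sq_le _ _

/-- Only absolute values matter, so carrier waves and hop phases disappear from the norms. -/
lemma eLpNorm_eq_sampleNorm {γ : ℝ} (hγ : 0 < γ) (θ : ℝ) (d : Plane) (i σ : Fin 2)
    {w : ℤ × ℤ → ℂ} {u : Plane → ℂ} (hw : ∀ n, ‖w n‖ = γ * ‖u (γ • site θ d i n σ)‖) :
    eLpNorm w 2 Measure.count =
      sampleNorm γ (layerAngle θ i) (γ • tauLayer θ d i σ) u := by
  rw [← (ENNReal.pow_right_strictMono two_ne_zero).injective.eq_iff, sampleNorm, mul_pow,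
    eLpNorm_two_count_sq, eLpNorm_two_count_sq, ← ENNReal.tsum_mul_left,
    ← cellEquiv.tsum_eq (fun n => ENNReal.ofReal γ ^ 2 * _)]
  refine tsum_congr fun n => ?_
  rw [← mul_pow, ← smul_add, ← site_eq, ← ofReal_norm, hw, ENNReal.ofReal_mul hγ.le, ofReal_norm]

/-! ### Phases -/

lemma exp_I_eq_of_sub {x y : ℝ} (m : ℤ) (h : x - y = 2 * Real.pi * m) :
    Complex.exp (Complex.I * (x : ℂ)) = Complex.exp (Complex.I * (y : ℂ)) := by
  rw [Complex.exp_eq_exp_iff_exists_int]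
  refine ⟨m, ?_⟩
  have : x = y + 2 * Real.pi * m := by linarith
  rw [this]
  push_cast
  ring

/-- Direct and reciprocal lattice vectors pair to multiples of `2π`, so on atomic sites such phases
see only the sublattice shift. This is the origin of the matrices `T_j`. -/
lemma inner_bLayer_site (θ : ℝ) (d : Plane) (i j : Fin 2) (n : ℤ × ℤ) (σ : Fin 2) :
    (inner ℝ (bLayer θ i j) (site θ d i n σ) : ℝ) =
      inner ℝ (bLayer θ i j) (tauLayer θ d i σ) + 2 * Real.pi * (cellEquiv n j : ℤ) := by
  rw [site_eq, inner_add_right, latPoint, inner_add_right, real_inner_smul_right,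
    real_inner_smul_right, bLayer, inner_rot_rot, inner_rot_rot, inner_bVec_aVec,
    inner_bVec_aVec]
  fin_cases j <;> simp <;> ring

lemma recip_zero (ζ : ℝ) : recip ζ 0 = 0 := by
  apply plane_ext <;> simp [recip]

lemma recip_layer_one (θ : ℝ) (i : Fin 2) :
    recip (layerAngle θ i) ![0, 1] = bLayer θ i 1 := by
  simp [recip, bLayer]

lemma recip_layer_neg_zero (θ : ℝ) (i : Fin 2) :
    recip (layerAngle θ i) ![-1, 0] = -bLayer θ i 0 := by
  have : ((-1 : ℤ) : ℝ) • bVec 0 + ((0 : ℤ) : ℝ) • bVec 1 = (-1 : ℝ) • bVec 0 := by simp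
  simp only [recip, bLayer, Matrix.cons_val_zero, Matrix.cons_val_one, this, rot_smul]
  simp

lemma sum_nearHops (F : (Fin 2 → ℤ) → ℂ) :
    ∑ k ∈ nearHops, F k = F 0 + F ![0, 1] + F ![-1, 0] := by
  have h1 : (0 : Fin 2 → ℤ) ≠ ![0, 1] := fun h => by simpa using congrFun h 1
  have h2 : (0 : Fin 2 → ℤ) ≠ ![-1, 0] := fun h => by simpa using congrFun h 0
  have h3 : (![0, 1] : Fin 2 → ℤ) ≠ ![-1, 0] := fun h => by simpa using congrFun h 0
  rw [nearHops, Finset.sum_insert (by simp [h1, h2]), Finset.sum_insert (by simp [h3]),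
    Finset.sum_singleton, add_assoc]

/-- The phase of a momentum hop `k` of layer `j`, seen from sublattice `σ'` of that layer at `x`. -/
def hopPhase (θ : ℝ) (d : Plane) (j σ' : Fin 2) (x : Plane) (k : Fin 2 → ℤ) : ℂ :=
  Complex.exp (Complex.I * (inner ℝ (recip (layerAngle θ j) k) (x - tauLayer θ d j σ') : ℝ))

/-- The interlayer matrix elements of the BM Hamiltonian. -/
def moireCoupling (θ : ℝ) (d : Plane) (i σ σ' : Fin 2) (x : Plane) : ℂ :=
  (![moire θ d x σ σ', (starRingEnd ℂ) (moire θ d x σ' σ)] : Fin 2 → ℂ) i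

lemma moire_apply (θ : ℝ) (d : Plane) (x : Plane) (σ σ' : Fin 2) :
    moire θ d x σ σ' = ∑ j : Fin 3,
      Complex.exp (Complex.I * ((-inner ℝ (sVec θ j) x : ℝ) : ℂ)) * hopMat θ d j σ σ' := by
  rw [moire, Matrix.sum_apply]
  refine Finset.sum_congr rfl fun j _ => ?_
  rw [Matrix.smul_apply, smul_eq_mul]
  congr 2
  push_cast
  ring

lemma sVec_two (θ : ℝ) :
    sVec θ 2 = kappaLayer θ 0 - kappaLayer θ 1 + bLayer θ 1 0 - bLayer θ 0 0 := rfl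

lemma sVec_one (θ : ℝ) :
    sVec θ 1 = kappaLayer θ 0 - kappaLayer θ 1 - bLayer θ 1 1 + bLayer θ 0 1 := rfl

lemma sVec_zero (θ : ℝ) : sVec θ 0 = kappaLayer θ 0 - kappaLayer θ 1 := rfl

/-- On the atomic sites the moiré potential is the superposition of the three nearest momentum
hops. -/
lemma moireCoupling_mul_exp (θ : ℝ) (d : Plane) (i : Fin 2) (n : ℤ × ℤ) (σ σ' : Fin 2) :
    moireCoupling θ d i σ σ' (site θ d i n σ) *
        Complex.exp (Complex.I * (inner ℝ (kappaLayer θ i) (site θ d i n σ) : ℝ)) =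
      (∑ k ∈ nearHops, hopPhase θ d (other i) σ' (site θ d i n σ) k) *
        Complex.exp (Complex.I * (inner ℝ (kappaLayer θ (other i)) (site θ d i n σ) : ℝ)) := by
  have hb0 := inner_bLayer_site θ d i 0 n σ
  have hb1 := inner_bLayer_site θ d i 1 n σ
  set x := site θ d i n σ with hx
  rw [sum_nearHops]
  unfold hopPhase
  rw [recip_zero, recip_layer_one, recip_layer_neg_zero]
  have hi : i = 0 ∨ i = 1 := by omega
  rcases hi with rfl | rfl
  · have ho : other 0 = 1 := rfl
    simp only [moireCoupling, Matrix.cons_val_zero, ho, moire_apply, Fin.sum_univ_three, hopMat,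
      Matrix.cons_val, sVec_zero, sVec_one, sVec_two, mul_one, add_mul,
      ← exp_I_mul_add]
    congr 1
    · congr 1
      -- Without a reciprocal vector the two phases agree exactly; for the other two hops they
      -- differ by the pairing of a reciprocal vector with the lattice cell, which gives the integer
      -- witnesses.
      · apply exp_I_eq_of_sub 0
        simp only [inner_sub_left, inner_zero_left, Int.cast_zero]
        ring
      · apply exp_I_eq_of_sub (-(cellEquiv n 1))
        simp only [inner_sub_left, inner_add_left, inner_sub_right, hb1]
        push_cast
        ring
    · apply exp_I_eq_of_sub (cellEquiv n 0)
      simp only [inner_sub_left, inner_add_left, inner_sub_right, inner_neg_left, hb0]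
      ring
  · have ho : other 1 = 0 := rfl
    simp only [moireCoupling, Matrix.cons_val_zero, ho, moire_apply, Fin.sum_univ_three, hopMat,
      Matrix.cons_val_one, Matrix.cons_val, sVec_zero, sVec_one, sVec_two, mul_one, add_mul,
      map_add, conj_exp_I_mul, ← exp_I_mul_add]
    congr 1
    · congr 1
      · apply exp_I_eq_of_sub 0
        simp only [inner_sub_left, inner_zero_left, Int.cast_zero]
        ring
      · apply exp_I_eq_of_sub (-(cellEquiv n 1))
        simp only [inner_sub_left, inner_add_left, inner_sub_right, hb1]
        push_cast
        ring
    · apply exp_I_eq_of_sub (cellEquiv n 0)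
      simp only [inner_sub_left, inner_add_left, inner_sub_right, inner_neg_left, hb0]
      ring

/-! ### The intralayer symbol -/

/-- Vectors from an `A` site to its three nearest neighbours. -/
def bondVec : Fin 3 → Plane := ![tauVec 1, tauVec 1 - aVec 0, tauVec 1 - aVec 1]

/-- The intralayer symbol, for hopping from `B` to `A`. -/
def bondSymbol (γ ζ : ℝ) (ξ : Plane) : ℂ :=
  -((2 / Real.sqrt 3 : ℝ) : ℂ) * ∑ k : Fin 3,
    Complex.exp (Complex.I * (inner ℝ kappa (bondVec k) : ℝ)) *
      Complex.exp (Complex.I * ((γ * inner ℝ ξ (rot ζ (bondVec k)) : ℝ) : ℂ))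

/-- The symbol of the Dirac operator. -/
def diracSymbol (ξ : Plane) : ℂ := ξ 0 - Complex.I * ξ 1

lemma norm_exp_I_sub_le (y : ℝ) :
    ‖Complex.exp (Complex.I * (y : ℂ)) - 1 - Complex.I * y‖ ≤ 3 * y ^ 2 := by
  have hn : ‖Complex.I * (y : ℂ)‖ = |y| := by simp
  rcases le_total |y| 1 with h | h
  · have := Complex.norm_exp_sub_one_sub_id_le (x := Complex.I * (y : ℂ)) (by rw [hn]; exact h)
    rw [hn, sq_abs] at this
    nlinarith [sq_nonneg y]
  · have h1 := norm_sub_le (Complex.exp (Complex.I * (y : ℂ)) - 1) (Complex.I * y)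
    have h2 := norm_sub_le (Complex.exp (Complex.I * (y : ℂ))) 1
    rw [norm_exp_I_mul, norm_one] at h2
    rw [hn] at h1
    nlinarith [sq_abs y]

lemma norm_exp_I_sub_one_le (y : ℝ) : ‖Complex.exp (Complex.I * (y : ℂ)) - 1‖ ≤ |y| := by
  have := Real.norm_exp_I_mul_ofReal_sub_one_le (x := y)
  simpa using this

lemma norm_bondVec_le (k : Fin 3) : ‖bondVec k‖ ≤ 1 := by
  rw [← sq_le_sq₀ (norm_nonneg _) zero_le_one, norm_sq_plane]
  have h3 := Real.sq_sqrt (show (0 : ℝ) ≤ 3 by norm_num)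
  have h3' : Real.sqrt 3 ≠ 0 := by positivity
  have e : 1 / Real.sqrt 3 = Real.sqrt 3 / 3 := by field_simp; linear_combination -h3
  fin_cases k
  · simp only [bondVec, tauVec, e]
    simp [abs_of_nonneg (Real.sqrt_nonneg 3), abs_div]
    nlinarith
  all_goals
    simp [bondVec, tauVec, aVec, -one_div]
    rw [e]
    nlinarith

lemma exp_two_pi_div_three :
    Complex.exp (Complex.I * ((2 * Real.pi / 3 : ℝ) : ℂ)) =
      -(1 / 2) + Complex.I * (Real.sqrt 3 / 2 : ℝ) := by
  have hc : Real.cos (2 * Real.pi / 3) = -(1 / 2) := by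
    rw [show 2 * Real.pi / 3 = Real.pi - Real.pi / 3 by ring, Real.cos_pi_sub, Real.cos_pi_div_three]
  have hs : Real.sin (2 * Real.pi / 3) = Real.sqrt 3 / 2 := by
    rw [show 2 * Real.pi / 3 = Real.pi - Real.pi / 3 by ring, Real.sin_pi_sub, Real.sin_pi_div_three]
  rw [mul_comm, Complex.exp_mul_I, ← Complex.ofReal_cos, ← Complex.ofReal_sin, hc, hs]
  push_cast
  ring

lemma exp_neg_two_pi_div_three :
    Complex.exp (Complex.I * ((-(2 * Real.pi / 3) : ℝ) : ℂ)) =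
      -(1 / 2) - Complex.I * (Real.sqrt 3 / 2 : ℝ) := by
  rw [← conj_exp_I_mul, exp_two_pi_div_three]
  simp only [map_add, map_neg, map_mul, Complex.conj_I, Complex.conj_ofReal, map_div₀, map_one,
    map_ofNat]
  ring

/-- The phases at the three nearest neighbours. -/
lemma bondPhase : (fun k => Complex.exp (Complex.I * (inner ℝ kappa (bondVec k) : ℝ))) =
    ![1, -(1 / 2) - Complex.I * (Real.sqrt 3 / 2 : ℝ),
      -(1 / 2) + Complex.I * (Real.sqrt 3 / 2 : ℝ)] := by
  have h0 : (inner ℝ kappa (bondVec 0) : ℝ) = 0 := by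
    simp [inner_plane, kappa, bondVec, tauVec]
  have h1 : (inner ℝ kappa (bondVec 1) : ℝ) = -(2 * Real.pi / 3) := by
    simp [inner_plane, kappa, bondVec, tauVec, aVec]; ring
  have h2 : (inner ℝ kappa (bondVec 2) : ℝ) = 2 * Real.pi / 3 := by
    simp [inner_plane, kappa, bondVec, tauVec, aVec]; ring
  ext k
  fin_cases k
  · simp [h0]
  · simp only [Fin.mk_one, h1, exp_neg_two_pi_div_three]; rfl
  · simp only [Fin.reduceFinMk, h2, exp_two_pi_div_three]; rfl

/-- The phases are the three cube roots of unity. Their sum vanishes, and weighting the bond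
directions by them leaves a multiple of `ξ₁ - iξ₂`, normalized by `2 / √3`. Rotating the bonds by
`ζ` multiplies the result by `e^{iζ}`. -/
lemma bondSymbol_linear (ζ : ℝ) (ξ : Plane) :
    -((2 / Real.sqrt 3 : ℝ) : ℂ) * ∑ k : Fin 3,
      Complex.exp (Complex.I * (inner ℝ kappa (bondVec k) : ℝ)) *
        (1 + Complex.I * (inner ℝ ξ (rot ζ (bondVec k)) : ℝ)) =
      Complex.exp (Complex.I * (ζ : ℂ)) * diracSymbol ξ := by
  have hp : ∀ k, Complex.exp (Complex.I * (inner ℝ kappa (bondVec k) : ℝ)) = _ :=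
    fun k => congrFun bondPhase k
  simp_rw [hp]
  have h3 := Real.sq_sqrt (show (0 : ℝ) ≤ 3 by norm_num)
  have h3' : Real.sqrt 3 ≠ 0 := by positivity
  have h3c : (Real.sqrt 3 : ℂ) ≠ 0 := by exact_mod_cast h3'
  have h3s : (Real.sqrt 3 : ℂ) ^ 2 = 3 := by exact_mod_cast h3
  have e : 1 / Real.sqrt 3 = Real.sqrt 3 / 3 := by field_simp; linear_combination -h3
  have e2 : 2 / Real.sqrt 3 = 2 * Real.sqrt 3 / 3 := by
    rw [div_eq_mul_one_div, e]; ring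
  have i0 : (inner ℝ ξ (rot ζ (bondVec 0)) : ℝ) =
      (-Real.sin ζ * ξ 0 + Real.cos ζ * ξ 1) * (Real.sqrt 3 / 3) := by
    simp only [inner_plane, bondVec, tauVec, rot_apply_zero, rot_apply_one, e]
    simp
    ring
  have i1 : (inner ℝ ξ (rot ζ (bondVec 1)) : ℝ) =
      -(Real.cos ζ * ξ 0 + Real.sin ζ * ξ 1) / 2 -
        (-Real.sin ζ * ξ 0 + Real.cos ζ * ξ 1) * (Real.sqrt 3 / 6) := by
    simp only [inner_plane, bondVec, tauVec, aVec, rot_apply_zero, rot_apply_one, e]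
    simp
    ring
  have i2 : (inner ℝ ξ (rot ζ (bondVec 2)) : ℝ) =
      (Real.cos ζ * ξ 0 + Real.sin ζ * ξ 1) / 2 -
        (-Real.sin ζ * ξ 0 + Real.cos ζ * ξ 1) * (Real.sqrt 3 / 6) := by
    simp only [inner_plane, bondVec, tauVec, aVec, rot_apply_zero, rot_apply_one, e]
    simp
    ring
  rw [Fin.sum_univ_three, i0, i1, i2, e2, mul_comm Complex.I (ζ : ℂ), Complex.exp_mul_I,
    ← Complex.ofReal_cos, ← Complex.ofReal_sin, diracSymbol]
  simp only [Matrix.cons_val_zero, Matrix.cons_val_one, Matrix.cons_val]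
  push_cast
  have hI := Complex.I_sq
  generalize (Real.sqrt 3 : ℂ) = q at *
  generalize Complex.cos (ζ : ℂ) = c at *
  generalize Complex.sin (ζ : ℂ) = s at *
  generalize ((ξ 0 : ℝ) : ℂ) = a at *
  generalize ((ξ 1 : ℝ) : ℂ) = b at *
  linear_combination (-(Complex.I^2 * (c * a + s * b) / 3) - Complex.I * (-s * a + c * b) / 3) * h3s
    - (c * a + 0 * s * b) * hI

lemma norm_diracSymbol_le (ξ : Plane) : ‖diracSymbol ξ‖ ≤ ‖ξ‖ := by
  rw [← sq_le_sq₀ (norm_nonneg _) (norm_nonneg _), norm_sq_plane, ← Complex.normSq_eq_norm_sq,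
    Complex.normSq_apply]
  simp [diracSymbol]
  apply le_of_eq
  ring

/-- Near the Dirac point the intralayer symbol is the symbol of the Dirac operator. -/
lemma norm_bondSymbol_sub_le {γ : ℝ} (hγ : 0 < γ) (ζ : ℝ) (ξ : Plane) :
    ‖bondSymbol γ ζ ξ - γ * diracSymbol ξ‖ ≤ (12 * γ ^ 2 + γ * |ζ|) * wt ξ := by
  have hsum : ∑ k : Fin 3, Complex.exp (Complex.I * (inner ℝ kappa (bondVec k) : ℝ)) = 0 := by
    have hp : ∀ k, Complex.exp (Complex.I * (inner ℝ kappa (bondVec k) : ℝ)) = _ :=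
      fun k => congrFun bondPhase k
    simp_rw [hp, Fin.sum_univ_three]
    simp only [Matrix.cons_val_zero, Matrix.cons_val_one, Matrix.cons_val]
    ring
  -- The second-order Taylor remainders of the exponentials, plus the cost of replacing `e^{iζ}` by
  -- 1.
  have hsplit : bondSymbol γ ζ ξ - γ * diracSymbol ξ =
      -((2 / Real.sqrt 3 : ℝ) : ℂ) * (∑ k : Fin 3,
        Complex.exp (Complex.I * (inner ℝ kappa (bondVec k) : ℝ)) *
          (Complex.exp (Complex.I * ((γ * inner ℝ ξ (rot ζ (bondVec k)) : ℝ) : ℂ)) - 1 -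
            Complex.I * ((γ * inner ℝ ξ (rot ζ (bondVec k)) : ℝ) : ℂ))) +
      γ * ((Complex.exp (Complex.I * (ζ : ℂ)) - 1) * diracSymbol ξ) := by
    rw [sub_mul (Complex.exp _), ← bondSymbol_linear, bondSymbol]
    rw [Fin.sum_univ_three] at hsum ⊢
    simp only [Fin.sum_univ_three]
    push_cast
    linear_combination (-(2 / (Real.sqrt 3 : ℂ)) + γ * (2 / (Real.sqrt 3 : ℂ))) * hsum
  have h2 : (2 / Real.sqrt 3 : ℝ) ≤ 4 / 3 := by
    rw [div_le_div_iff₀ (by positivity) (by norm_num)]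
    nlinarith [Real.sq_sqrt (show (0 : ℝ) ≤ 3 by norm_num), Real.sqrt_nonneg 3]
  have hterm : ∀ k : Fin 3, ‖Complex.exp (Complex.I * (inner ℝ kappa (bondVec k) : ℝ)) *
          (Complex.exp (Complex.I * ((γ * inner ℝ ξ (rot ζ (bondVec k)) : ℝ) : ℂ)) - 1 -
            Complex.I * ((γ * inner ℝ ξ (rot ζ (bondVec k)) : ℝ) : ℂ))‖ ≤ 3 * γ ^ 2 * ‖ξ‖ ^ 2 := by
    intro k
    rw [norm_mul, norm_exp_I_mul, one_mul]
    refine (norm_exp_I_sub_le _).trans ?_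
    have h : |(inner ℝ ξ (rot ζ (bondVec k)) : ℝ)| ≤ ‖ξ‖ := by
      refine (abs_real_inner_le_norm _ _).trans ?_
      rw [norm_rot]
      exact mul_le_of_le_one_right (norm_nonneg _) (norm_bondVec_le k)
    rw [mul_pow, mul_assoc]
    have := pow_le_pow_left₀ (abs_nonneg _) h 2
    rw [sq_abs] at this
    gcongr
  rw [hsplit]
  refine (norm_add_le _ _).trans ?_
  rw [norm_mul, norm_neg, Complex.norm_real, Real.norm_of_nonneg (by positivity), norm_mul,
    norm_mul, Complex.norm_real, Real.norm_of_nonneg hγ.le]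
  have hs := norm_sum_le_of_le Finset.univ fun k _ => hterm k
  simp only [Finset.sum_const, Finset.card_univ, Fintype.card_fin, nsmul_eq_mul] at hs
  have hd := mul_le_mul (norm_exp_I_sub_one_le ζ) (norm_diracSymbol_le ξ) (norm_nonneg _)
    (abs_nonneg _)
  have hw : ‖ξ‖ ^ 2 ≤ wt ξ := by unfold wt; linarith
  -- The constant 12 is the prefactor `4/3` times three bonds times the Taylor constant 3.
  calc _ ≤ 4 / 3 * ((3 : ℕ) * (3 * γ ^ 2 * ‖ξ‖ ^ 2)) + γ * (|ζ| * ‖ξ‖) := by gcongr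
    _ ≤ 4 / 3 * ((3 : ℕ) * (3 * γ ^ 2 * wt ξ)) + γ * (|ζ| * wt ξ) := by
      gcongr
      exact norm_le_wt ξ
    _ = _ := by push_cast; ring

lemma site_one_eq (θ : ℝ) (d : Plane) (i : Fin 2) (n : ℤ × ℤ) :
    site θ d i n 1 = site θ d i n 0 + rot (layerAngle θ i) (bondVec 0) := by
  simp only [site, tauLayer, bondVec, rot_add, Matrix.cons_val_zero, tauVec, Matrix.cons_val_one]
  have : rot (layerAngle θ i) 0 = 0 := by apply plane_ext <;> simp
  rw [this]
  module

lemma rot_sub (ζ : ℝ) (v w : Plane) : rot ζ (v - w) = rot ζ v - rot ζ w := by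
  apply plane_ext <;> simp <;> ring

lemma site_one_sub_fst (θ : ℝ) (d : Plane) (i : Fin 2) (n : ℤ × ℤ) :
    site θ d i (n.1 - 1, n.2) 1 = site θ d i n 0 + rot (layerAngle θ i) (bondVec 1) := by
  have h := site_one_eq θ d i n
  have h1 : site θ d i (n.1 - 1, n.2) 1 = site θ d i n 1 - aLayer θ i 0 := by
    simp only [site]; push_cast; module
  rw [h1, h]
  simp only [bondVec, Matrix.cons_val_zero, Matrix.cons_val_one, rot_sub, aLayer]
  module

lemma site_one_sub_snd (θ : ℝ) (d : Plane) (i : Fin 2) (n : ℤ × ℤ) :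
    site θ d i (n.1, n.2 - 1) 1 = site θ d i n 0 + rot (layerAngle θ i) (bondVec 2) := by
  have h := site_one_eq θ d i n
  have h1 : site θ d i (n.1, n.2 - 1) 1 = site θ d i n 1 - aLayer θ i 1 := by
    simp only [site]; push_cast; module
  rw [h1, h]
  simp only [bondVec, Matrix.cons_val_zero, Matrix.cons_val, rot_sub, aLayer]
  module

lemma site_zero_add_fst (θ : ℝ) (d : Plane) (i : Fin 2) (n : ℤ × ℤ) :
    site θ d i (n.1 + 1, n.2) 0 = site θ d i n 1 - rot (layerAngle θ i) (bondVec 1) := by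
  have h := site_one_sub_fst θ d i (n.1 + 1, n.2)
  simp only [add_sub_cancel_right] at h
  exact eq_sub_of_add_eq h.symm

lemma site_zero_add_snd (θ : ℝ) (d : Plane) (i : Fin 2) (n : ℤ × ℤ) :
    site θ d i (n.1, n.2 + 1) 0 = site θ d i n 1 - rot (layerAngle θ i) (bondVec 2) := by
  have h := site_one_sub_snd θ d i (n.1, n.2 + 1)
  simp only [add_sub_cancel_right] at h
  exact eq_sub_of_add_eq h.symm

/-! ### Envelopes in the Fourier representation -/

lemma sobolevNormScalar_le (k : ℕ) (u : Envelope) (i σ : Fin 2) :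
    sobolevNormScalar k (u i σ) ≤ sobolevNorm k u := by
  have : sobolevNorm k u ^ 2 = ∑ i : Fin 2, ∑ σ : Fin 2, sobolevNormScalar k (u i σ) ^ 2 := by
    rw [sobolevNorm, ← ENNReal.rpow_natCast, ← ENNReal.rpow_mul]
    norm_num
  apply ennreal_le_of_sq_le
  rw [this]
  refine le_trans ?_ (Finset.single_le_sum
    (f := fun i => ∑ σ, sobolevNormScalar k (u i σ) ^ 2) (fun _ _ => zero_le) (Finset.mem_univ i))
  exact Finset.single_le_sum (f := fun σ => sobolevNormScalar k (u i σ) ^ 2)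
    (fun _ _ => zero_le) (Finset.mem_univ σ)

/-- `φ` is the Fourier representation of the envelope `u`, with `m` weights. -/
structure Represents (m : ℕ) (φ u : Envelope) : Prop where
  weighted : ∀ i σ, Weighted m (φ i σ)
  eq_synth : ∀ i σ, u i σ = synth (φ i σ)
  wNorm_le : ∀ i σ, wNorm m (φ i σ) ≤ sobolevNorm (2 * m) u

lemma exists_represents {m : ℕ} (hm : 1 ≤ m) {u : Envelope} (hc : ∀ i σ, Continuous (u i σ))
    (hu : sobolevNorm (2 * m) u < ⊤) : ∃ φ : Envelope, Represents m φ u := by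
  have h : ∀ i σ, ∃ φ, Weighted m φ ∧ u i σ = synth φ ∧
      ENNReal.ofReal (2 * Real.pi) * wNorm m φ = sobolevNormScalar (2 * m) (u i σ) := fun i σ =>
    exists_synth_eq hm (hc i σ) ((sobolevNormScalar_le _ u i σ).trans_lt hu)
  choose φ h1 h2 h3 using h
  refine ⟨φ, h1, h2, fun i σ => ?_⟩
  refine le_trans ?_ (sobolevNormScalar_le (2 * m) u i σ)
  rw [← h3]
  refine le_mul_of_one_le_left' ?_
  rw [ENNReal.one_le_ofReal]
  linarith [Real.pi_gt_three]

/-- The constant in the sampling inequality. -/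
def sampleConst : ℝ≥0∞ := ENNReal.ofReal cellConst * (1 + aliasConst)

lemma sampleConst_lt_top : sampleConst < ⊤ :=
  ENNReal.mul_lt_top ENNReal.ofReal_lt_top
    (ENNReal.add_lt_top.2 ⟨ENNReal.one_lt_top, aliasConst_lt_top⟩)

lemma sampleNorm_le_wNorm {γ : ℝ} (hγ : 0 < γ) (hγ1 : γ ≤ 1) (ζ : ℝ) (y : Plane) {φ : Plane → ℂ}
    (h : Weighted 1 φ) : sampleNorm γ ζ y (synth φ) ≤ sampleConst * wNorm 1 φ := by
  refine (sampleNorm_synth_le hγ ζ y h).trans ?_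
  have h1 : ENNReal.ofReal (γ ^ 2) ≤ 1 := by
    rw [ENNReal.ofReal_le_one]; exact pow_le_one₀ hγ.le hγ1
  calc _ ≤ ENNReal.ofReal cellConst * (wNorm 1 φ + aliasConst * (1 * wNorm 1 φ)) := by
        rw [← wNorm_zero]
        gcongr
        exact wNorm_mono_weight zero_le_one φ
    _ = _ := by rw [sampleConst]; ring

/-- The carrier wave of layer `i`. -/
def carrier (θ : ℝ) (i : Fin 2) (x : Plane) : ℂ :=
  Complex.exp (Complex.I * (inner ℝ (kappaLayer θ i) x : ℝ))

lemma norm_carrier (θ : ℝ) (i : Fin 2) (x : Plane) : ‖carrier θ i x‖ = 1 := norm_exp_I_mul _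

/-- A symbol on one sublattice and its complex conjugate on the other. -/
def chiral (σ : Fin 2) (s : ℂ) : ℂ := (![s, (starRingEnd ℂ) s] : Fin 2 → ℂ) σ

lemma norm_chiral (σ : Fin 2) (s : ℂ) : ‖chiral σ s‖ = ‖s‖ := by
  fin_cases σ <;> simp [chiral]

lemma chiral_sub (σ : Fin 2) (s t : ℂ) : chiral σ (s - t) = chiral σ s - chiral σ t := by
  fin_cases σ <;> simp [chiral]

lemma continuous_chiral (σ : Fin 2) : Continuous (chiral σ) := by
  have hσ : σ = 0 ∨ σ = 1 := by omega
  rcases hσ with rfl | rfl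
  · exact continuous_id
  · exact Complex.continuous_conj

lemma chiral_ofReal_mul (σ : Fin 2) (r : ℝ) (s : ℂ) : chiral σ (r * s) = r * chiral σ s := by
  fin_cases σ <;> simp [chiral]

lemma continuous_diracSymbol : Continuous diracSymbol := by
  unfold diracSymbol; fun_prop

lemma continuous_bondSymbol (γ ζ : ℝ) : Continuous (bondSymbol γ ζ) := by
  unfold bondSymbol; fun_prop

lemma norm_diracSymbol_le_wt (ξ : Plane) : ‖diracSymbol ξ‖ ≤ 1 * wt ξ ^ 1 := by
  rw [one_mul, pow_one]
  exact (norm_diracSymbol_le ξ).trans (norm_le_wt ξ)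

lemma weighted_dirac {m : ℕ} {φ : Plane → ℂ} (h : Weighted (m + 1) φ) (σ : Fin 2) :
    Weighted m (fun ξ => chiral σ (diracSymbol ξ) * φ ξ) :=
  h.mul zero_le_one ((continuous_chiral σ).comp continuous_diracSymbol)
    (fun ξ => by rw [norm_chiral]; exact norm_diracSymbol_le_wt ξ)

lemma bmH_eq_synth (lam₀ γ θ : ℝ) (d : Plane) {φ u : Envelope} (h : Represents 4 φ u)
    (i σ : Fin 2) (X : Plane) :
    bmH lam₀ γ θ d u i σ X =
      synth (fun ξ => chiral σ (diracSymbol ξ) * φ i (other σ) ξ) X +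
      lam₀ * ∑ σ' : Fin 2, moireCoupling θ d i σ σ' (γ⁻¹ • X) * synth (φ (other i) σ') X := by
  have hd : ∀ i σ, ∀ k : Fin 2, fderiv ℝ (u i σ) X (EuclideanSpace.single k (1 : ℝ)) =
      synth (fun ξ => Complex.I * (ξ k : ℝ) * φ i σ ξ) X := by
    intro i σ k
    rw [h.eq_synth, fderiv_synth ((h.weighted i σ).mono (by norm_num))]
    congr 1; ext ξ
    rw [EuclideanSpace.inner_single_right]
    simp
  have hint : ∀ i σ, ∀ k : Fin 2, Integrable (fun ξ : Plane => (ξ k : ℂ) * φ i σ ξ) := by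
    intro i σ k
    refine Weighted.integrable (Weighted.mul (p := 1) zero_le_one (by fun_prop) (fun ξ => ?_)
      ((h.weighted i σ).mono (by norm_num)))
    rw [one_mul, pow_one, Complex.norm_real]
    exact (PiLp.norm_apply_le ξ k).trans (norm_le_wt ξ)
  rw [bmH]
  congr 1
  · simp only [dirac, hd, Fin.sum_univ_two, pauli]
    have e : ∀ i σ, ∀ k : Fin 2, synth (fun ξ => Complex.I * (ξ k : ℝ) * φ i σ ξ) X =
        Complex.I * synth (fun ξ => (ξ k : ℂ) * φ i σ ξ) X := by
      intro i σ k
      rw [← synth_const_mul]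
      simp only [mul_assoc]
    simp only [e]
    have hσ : σ = 0 ∨ σ = 1 := by omega
    rcases hσ with rfl | rfl
    · have e2 : (fun ξ : Plane => chiral 0 (diracSymbol ξ) * φ i (other 0) ξ) =
          fun ξ => (ξ 0 : ℂ) * φ i 1 ξ + (-Complex.I) * ((ξ 1 : ℂ) * φ i 1 ξ) := by
        ext ξ
        simp only [chiral, diracSymbol, other, Matrix.cons_val_zero]
        ring
      rw [e2, synth_add (hint i 1 0) ((hint i 1 1).const_mul _), synth_const_mul]
      simp
      linear_combination (-synth (fun ξ => (ξ 0 : ℂ) * φ i 1 ξ) X +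
        Complex.I * synth (fun ξ => (ξ 1 : ℂ) * φ i 1 ξ) X) * Complex.I_sq
    · have e2 : (fun ξ : Plane => chiral 1 (diracSymbol ξ) * φ i (other 1) ξ) =
          fun ξ => (ξ 0 : ℂ) * φ i 0 ξ + Complex.I * ((ξ 1 : ℂ) * φ i 0 ξ) := by
        ext ξ
        simp only [chiral, diracSymbol, other, Matrix.cons_val_one, map_sub, map_mul,
          Complex.conj_ofReal, Complex.conj_I]
        simp only [Matrix.cons_val_zero]
        ring
      rw [e2, synth_add (hint i 0 0) ((hint i 0 1).const_mul _), synth_const_mul]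
      simp
      linear_combination (-synth (fun ξ => (ξ 0 : ℂ) * φ i 0 ξ) X -
        Complex.I * synth (fun ξ => (ξ 1 : ℂ) * φ i 0 ξ) X) * Complex.I_sq
  · fin_cases i <;> fin_cases σ <;>
      simp [moireCoupling, scaledMoire, other, h.eq_synth] <;> ring

/-! ### The two contributions to the remainder -/

/-- The error of the Dirac approximation of the intralayer Hamiltonian. -/
def intraDefect (γ θ : ℝ) (d : Plane) (φ : Envelope) : State := fun i n σ =>
  γ * (carrier θ i (site θ d i n σ) *
    synth (fun ξ => chiral σ (bondSymbol γ (layerAngle θ i) ξ - γ * diracSymbol ξ) *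
      φ i (other σ) ξ) (γ • site θ d i n σ))

/-- The error of the moiré approximation of the interlayer Hamiltonian. -/
def interDefect (hs : ℝ → ℝ) (l lam₀ γ θ : ℝ) (d : Plane) (φ : Envelope) : State := fun i n σ =>
  ∑ σ' : Fin 2, ∑' k : Fin 2 → ℤ, hopPhase θ d (other i) σ' (site θ d i n σ) k *
    (γ * carrier θ (other i) (site θ d i n σ) *
      synth (fun ξ => hopDefect hs l lam₀ γ (layerAngle θ (other i)) k ξ * φ (other i) σ' ξ)
        (γ • site θ d i n σ))

/-- The regime `θ ≤ λ₁γ` makes the rotation error `γ|ζ|` of second order in `γ`. -/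
lemma compNorm_intraDefect_le {γ θ lam₁ : ℝ} (hγ : 0 < γ) (hγ1 : γ ≤ 1) (hθ : 0 ≤ θ)
    (hθ1 : θ ≤ lam₁ * γ) (d : Plane) {φ u : Envelope} (h : Represents 4 φ u) (i σ : Fin 2) :
    compNorm (intraDefect γ θ d φ) i σ ≤
      sampleConst * (ENNReal.ofReal ((12 + lam₁) * γ ^ 2) * sobolevNorm 8 u) := by
  have hζ : |layerAngle θ i| ≤ lam₁ * γ := by
    have : |layerAngle θ i| = θ / 2 := by
      fin_cases i <;> simp [layerAngle] <;> positivity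
    rw [this]; linarith
  have hlam : 0 ≤ lam₁ := by
    by_contra! hneg
    nlinarith
  have hb : ∀ ξ, ‖chiral σ (bondSymbol γ (layerAngle θ i) ξ - γ * diracSymbol ξ)‖ ≤
      (12 + lam₁) * γ ^ 2 * wt ξ ^ 1 := by
    intro ξ
    rw [norm_chiral, pow_one]
    refine (norm_bondSymbol_sub_le hγ _ ξ).trans ?_
    have := wt_pos ξ
    gcongr
    nlinarith
  have hc : Continuous fun ξ => chiral σ (bondSymbol γ (layerAngle θ i) ξ - γ * diracSymbol ξ) :=
    (continuous_chiral σ).comp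
      ((continuous_bondSymbol _ _).sub (continuous_const.mul continuous_diracSymbol))
  have hA : 0 ≤ (12 + lam₁) * γ ^ 2 := by positivity
  rw [compNorm, eLpNorm_eq_sampleNorm hγ θ d i σ
    (u := synth (fun ξ => chiral σ (bondSymbol γ (layerAngle θ i) ξ - γ * diracSymbol ξ) *
      φ i (other σ) ξ))]
  · refine (sampleNorm_le_wNorm hγ hγ1 _ _ (Weighted.mul hA hc hb
      ((h.weighted i (other σ)).mono (by norm_num)))).trans ?_
    gcongr
    refine (wNorm_mul_le hA hb 1).trans ?_
    gcongr
    exact (wNorm_mono_weight (by norm_num) _).trans (h.wNorm_le i (other σ))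
  · intro n
    rw [intraDefect, norm_mul, norm_mul, norm_carrier, one_mul, Complex.norm_real,
      Real.norm_of_nonneg hγ.le]

lemma continuous_hopDefect (hh : HoppingAssumption hs C₁ C₂ C₃ D₁ D₂ l₀) {l : ℝ} (hl : l₀ ≤ l)
    (lam₀ γ ζ : ℝ) (k : Fin 2 → ℤ) : Continuous (hopDefect hs l lam₀ γ ζ k) := by
  unfold hopDefect
  have := continuous_hopHat hh hl
  exact (this.comp (by fun_prop)).sub continuous_const

lemma norm_hopPhase (θ : ℝ) (d : Plane) (j σ' : Fin 2) (x : Plane) (k : Fin 2 → ℤ) :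
    ‖hopPhase θ d j σ' x k‖ = 1 := norm_exp_I_mul _

/-- Minkowski over the hops with weights `latWeight`, then the sampling inequality for each hop; the
factor 2 counts the sublattices of the other layer. -/
lemma compNorm_interDefect_le (hh : HoppingAssumption hs C₁ C₂ C₃ D₁ D₂ l₀)
    {l lam₀ γ θ A : ℝ} (hl : l₀ ≤ l) (hγ : 0 < γ) (hγ1 : γ ≤ 1) (hA : 0 ≤ A)
    (hD : ∀ (ζ : ℝ) (k : Fin 2 → ℤ) (ξ : Plane),
      ‖hopDefect hs l lam₀ γ ζ k ξ‖ ≤ A * latWeight k * wt ξ ^ 3)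
    (d : Plane) {φ u : Envelope} (h : Represents 4 φ u) (i σ : Fin 2) :
    compNorm (interDefect hs l lam₀ γ θ d φ) i σ ≤
      2 * (sampleConst * (ENNReal.ofReal A * sobolevNorm 8 u) *
        ∑' k, ENNReal.ofReal (latWeight k)) := by
  have hσ' : ∀ σ' : Fin 2, eLpNorm (fun n : ℤ × ℤ => ∑' k : Fin 2 → ℤ,
      hopPhase θ d (other i) σ' (site θ d i n σ) k *
      (γ * carrier θ (other i) (site θ d i n σ) *
      synth (fun ξ => hopDefect hs l lam₀ γ (layerAngle θ (other i)) k ξ * φ (other i) σ' ξ)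
        (γ • site θ d i n σ))) 2 Measure.count ≤
      sampleConst * (ENNReal.ofReal A * sobolevNorm 8 u) *
        ∑' k, ENNReal.ofReal (latWeight k) := by
    intro σ'
    refine eLpNorm_count_tsum_le (w := latWeight) latWeight_pos _ fun k => ?_
    rw [eLpNorm_eq_sampleNorm hγ θ d i σ (u := synth (fun ξ =>
      hopDefect hs l lam₀ γ (layerAngle θ (other i)) k ξ * φ (other i) σ' ξ))]
    · have hAk : 0 ≤ A * latWeight k := mul_nonneg hA (latWeight_pos k).le
      refine (sampleNorm_le_wNorm hγ hγ1 _ _ (Weighted.mul hAk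
        (continuous_hopDefect hh hl _ _ _ _) (hD _ k) (h.weighted _ _))).trans ?_
      rw [mul_assoc]
      gcongr
      refine (wNorm_mul_le hAk (hD _ k) 1).trans ?_
      rw [ENNReal.ofReal_mul hA, mul_right_comm]
      gcongr
      exact h.wNorm_le _ _
    · intro n
      rw [norm_mul, norm_mul, norm_mul, norm_carrier, norm_hopPhase, one_mul, mul_one,
        Complex.norm_real, Real.norm_of_nonneg hγ.le]
  rw [compNorm]
  simp only [interDefect, Fin.sum_univ_two]
  refine (eLpNorm_add_le (Measurable.of_discrete.aestronglyMeasurable)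
    (Measurable.of_discrete.aestronglyMeasurable) (by norm_num)).trans ?_
  rw [two_mul]
  exact add_le_add (hσ' 0) (hσ' 1)

/-! ### The action of the tight-binding Hamiltonian on wave packets -/

/-- The wave packet at a fixed time, in the Fourier representation. -/
def packet (γ θ : ℝ) (d : Plane) (φ : Envelope) : State := fun i n σ =>
  γ * synth (φ i σ) (γ • site θ d i n σ) * carrier θ i (site θ d i n σ)

lemma carrier_add (θ : ℝ) (i : Fin 2) (x v : Plane) :
    carrier θ i (x + rot (layerAngle θ i) v) =
      carrier θ i x * Complex.exp (Complex.I * (inner ℝ kappa v : ℝ)) := by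
  rw [carrier, carrier, inner_add_right, exp_I_mul_add, kappaLayer, inner_rot_rot]

/-- A translation by a bond multiplies the symbol by a phase, which is why nearest-neighbour hopping
is exactly a multiplier. -/
lemma packet_shift (γ θ : ℝ) (i : Fin 2) (φ : Plane → ℂ) (x v : Plane) :
    γ * synth φ (γ • (x + rot (layerAngle θ i) v)) * carrier θ i (x + rot (layerAngle θ i) v) =
      γ * (carrier θ i x * synth (fun ξ => Complex.exp (Complex.I * (inner ℝ kappa v : ℝ)) *
        Complex.exp (Complex.I * ((γ * inner ℝ ξ (rot (layerAngle θ i) v) : ℝ) : ℂ)) * φ ξ)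
          (γ • x)) := by
  simp only [mul_assoc (Complex.exp _)]
  rw [carrier_add, smul_add, synth_apply_add, synth_const_mul]
  simp only [real_inner_smul_right]
  ring

lemma rot_neg (ζ : ℝ) (v : Plane) : rot ζ (-v) = -rot ζ v := by
  apply plane_ext <;> simp <;> ring

/-- Seen from a `B` site the bonds are reversed, which conjugates the symbol since its prefactor is
real. -/
lemma chiral_bondSymbol_mul (γ ζ : ℝ) (φ : Plane → ℂ) (hφ : Weighted 1 φ) (x : Plane)
    (σ : Fin 2) :
    synth (fun ξ => chiral σ (bondSymbol γ ζ ξ) * φ ξ) x =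
      -((2 / Real.sqrt 3 : ℝ) : ℂ) * ∑ k : Fin 3, synth (fun ξ =>
        Complex.exp (Complex.I * (inner ℝ kappa ((![1, -1] : Fin 2 → ℝ) σ • bondVec k) : ℝ)) *
        Complex.exp (Complex.I * ((γ *
          inner ℝ ξ (rot ζ ((![1, -1] : Fin 2 → ℝ) σ • bondVec k)) : ℝ) : ℂ)) * φ ξ) x := by
  rw [← synth_finset_sum, ← synth_const_mul]
  · congr 1; ext ξ
    rw [← Finset.sum_mul, ← mul_assoc]
    congr 1
    have hσ : σ = 0 ∨ σ = 1 := by omega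
    rcases hσ with rfl | rfl
    · simp [chiral, bondSymbol]
    · have e : ∀ s, chiral 1 s = (starRingEnd ℂ) s := fun s => rfl
      have e1 : (![1, -1] : Fin 2 → ℝ) 1 = -1 := rfl
      simp only [e, e1, bondSymbol, map_mul, map_neg, Complex.conj_ofReal,
        map_sum, conj_exp_I_mul, neg_one_smul, rot_neg, inner_neg_right, mul_neg]
  · intro k _
    refine Weighted.integrable (Weighted.mul (p := 0) (A := 1) zero_le_one (by fun_prop)
      (fun ξ => ?_) hφ)
    rw [norm_mul, norm_exp_I_mul, norm_exp_I_mul]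
    simp

lemma intraH_packet (γ θ : ℝ) (d : Plane) {φ u : Envelope} (h : Represents 4 φ u)
    (i : Fin 2) (n : ℤ × ℤ) (σ : Fin 2) :
    intraH (packet γ θ d φ) i n σ = γ * (carrier θ i (site θ d i n σ) *
      synth (fun ξ => chiral σ (bondSymbol γ (layerAngle θ i) ξ) * φ i (other σ) ξ)
        (γ • site θ d i n σ)) := by
  rw [chiral_bondSymbol_mul _ _ _ ((h.weighted _ _).mono (by norm_num)), Fin.sum_univ_three]
  have key : ∀ (v y : Plane) (ψ : Plane → ℂ), y = site θ d i n σ + rot (layerAngle θ i) v →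
      (γ : ℂ) * (carrier θ i (site θ d i n σ) * synth (fun ξ =>
        Complex.exp (Complex.I * (inner ℝ kappa v : ℝ)) *
        Complex.exp (Complex.I * ((γ * inner ℝ ξ (rot (layerAngle θ i) v) : ℝ) : ℂ)) * ψ ξ)
          (γ • site θ d i n σ)) = γ * synth ψ (γ • y) * carrier θ i y := by
    intro v y ψ hy
    rw [hy, packet_shift]
  have hσ : σ = 0 ∨ σ = 1 := by omega
  rcases hσ with rfl | rfl
  · have k0 := key _ _ (φ i 1) (site_one_eq θ d i n)
    have k1 := key _ _ (φ i 1) (site_one_sub_fst θ d i n)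
    have k2 := key _ _ (φ i 1) (site_one_sub_snd θ d i n)
    simp only [intraH, Matrix.cons_val_zero, packet, one_smul, other]
    rw [← k0, ← k1, ← k2]
    ring
  · have e0 : site θ d i n 0 = site θ d i n 1 + rot (layerAngle θ i) (-bondVec 0) := by
      rw [site_one_eq, rot_neg]; abel
    have e1 : site θ d i (n.1 + 1, n.2) 0 =
        site θ d i n 1 + rot (layerAngle θ i) (-bondVec 1) := by
      rw [site_zero_add_fst, rot_neg]; abel
    have e2 : site θ d i (n.1, n.2 + 1) 0 =
        site θ d i n 1 + rot (layerAngle θ i) (-bondVec 2) := by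
      rw [site_zero_add_snd, rot_neg]; abel
    have k0 := key _ _ (φ i 0) e0
    have k1 := key _ _ (φ i 0) e1
    have k2 := key _ _ (φ i 0) e2
    simp only [intraH, Matrix.cons_val_one, packet, neg_one_smul, other, Matrix.cons_val_zero]
    rw [← k0, ← k1, ← k2]
    ring

lemma hasSum_interTerm_packet (hh : HoppingAssumption hs C₁ C₂ C₃ D₁ D₂ l₀) {l : ℝ} (hl : l₀ ≤ l)
    {γ : ℝ} (hγ : 0 < γ) (θ : ℝ) (d : Plane) {φ u : Envelope} (h : Represents 4 φ u)
    (i : Fin 2) (n : ℤ × ℤ) (σ : Fin 2) :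
    (∀ σ', Summable fun k : Fin 2 → ℤ => hopPhase θ d (other i) σ' (site θ d i n σ) k *
      (γ * carrier θ (other i) (site θ d i n σ) * synth (fun ξ =>
        hopHat hs (kappaLayer θ (other i) + γ • ξ + recip (layerAngle θ (other i)) k) l *
          φ (other i) σ' ξ) (γ • site θ d i n σ))) ∧
    HasSum (interTerm hs l θ d (packet γ θ d φ) i n σ) (((2 / Real.sqrt 3 : ℝ) : ℂ) *
      ∑ σ' : Fin 2, ∑' k : Fin 2 → ℤ, hopPhase θ d (other i) σ' (site θ d i n σ) k *
      (γ * carrier θ (other i) (site θ d i n σ) * synth (fun ξ =>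
        hopHat hs (kappaLayer θ (other i) + γ • ξ + recip (layerAngle θ (other i)) k) l *
          φ (other i) σ' ξ) (γ • site θ d i n σ))) := by
  have key := fun σ' => hasSum_hop_mul_packet hh hl hγ (layerAngle θ (other i))
    (kappaLayer θ (other i)) (site θ d i n σ) (tauLayer θ d (other i) σ')
    ((h.weighted (other i) σ').mono (show 1 ≤ 4 by norm_num))
  refine ⟨fun σ' => (key σ').1, ?_⟩
  rw [Finset.mul_sum]
  unfold interTerm
  refine hasSum_sum fun σ' _ => ?_
  have := (cellEquiv.hasSum_iff.2 (key σ').2)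
  convert this using 1
  swap
  · rfl
  ext m
  simp only [Function.comp, packet, site_eq, carrier]
  ring

lemma synth_hopHat_eq (hh : HoppingAssumption hs C₁ C₂ C₃ D₁ D₂ l₀) {l : ℝ} (hl : l₀ ≤ l)
    (lam₀ γ θ : ℝ) (j : Fin 2) (k : Fin 2 → ℤ) {φ : Plane → ℂ} (hφ : Weighted 4 φ)
    {A : ℝ} (hA : 0 ≤ A) (hD : ∀ ξ : Plane,
      ‖hopDefect hs l lam₀ γ (layerAngle θ j) k ξ‖ ≤ A * wt ξ ^ 3) (x : Plane) :
    synth (fun ξ => hopHat hs (kappaLayer θ j + γ • ξ + recip (layerAngle θ j) k) l * φ ξ) x =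
      synth (fun ξ => hopDefect hs l lam₀ γ (layerAngle θ j) k ξ * φ ξ) x +
        if k ∈ nearHops then ((lam₀ * γ : ℝ) : ℂ) * synth φ x else 0 := by
  have e : (fun ξ => hopHat hs (kappaLayer θ j + γ • ξ + recip (layerAngle θ j) k) l * φ ξ) =
      fun ξ => hopDefect hs l lam₀ γ (layerAngle θ j) k ξ * φ ξ +
        (if k ∈ nearHops then ((lam₀ * γ : ℝ) : ℂ) else 0) * φ ξ := by
    ext ξ
    rw [← add_mul, hopDefect, sub_add_cancel, kappaLayer]
  rw [e, synth_add, synth_const_mul]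
  · split_ifs <;> simp
  · exact Weighted.integrable (Weighted.mul (p := 3) hA (continuous_hopDefect hh hl _ _ _ _) hD hφ)
  · exact (Weighted.integrable (hφ.mono (by norm_num))).const_mul _

/-- Action of the full Hamiltonian on a wave packet. -/
lemma tbgH_packet (hh : HoppingAssumption hs C₁ C₂ C₃ D₁ D₂ l₀) {l : ℝ} (hl : l₀ ≤ l)
    {lam₀ γ : ℝ} (hγ : 0 < γ) (θ : ℝ) (d : Plane) {φ u : Envelope} (h : Represents 4 φ u)
    {A : (Fin 2 → ℤ) → ℝ} (hA : ∀ k, 0 ≤ A k)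
    (hD : ∀ (ζ : ℝ) (k : Fin 2 → ℤ) (ξ : Plane),
      ‖hopDefect hs l lam₀ γ ζ k ξ‖ ≤ A k * wt ξ ^ 3)
    (i : Fin 2) (n : ℤ × ℤ) (σ : Fin 2) :
    tbgH hs l θ d (packet γ θ d φ) i n σ =
      γ * (γ * bmH lam₀ γ θ d u i σ (γ • site θ d i n σ) * carrier θ i (site θ d i n σ)) +
      (intraDefect γ θ d φ i n σ + interDefect hs l lam₀ γ θ d φ i n σ) := by
  have hs3 : Real.sqrt 3 ≠ 0 := by positivity
  -- The prefactor of the Hamiltonian cancels the lattice density produced by Poisson summation.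
  have hconst : ((Real.sqrt 3 / 2 : ℝ) : ℂ) * ((2 / Real.sqrt 3 : ℝ) : ℂ) = 1 := by
    rw [← Complex.ofReal_mul, show Real.sqrt 3 / 2 * (2 / Real.sqrt 3) = 1 by field_simp]
    simp
  obtain ⟨hsum, hhas⟩ := hasSum_interTerm_packet hh hl hγ θ d h i n σ
  have hintra : synth (fun ξ => chiral σ (bondSymbol γ (layerAngle θ i) ξ) * φ i (other σ) ξ)
        (γ • site θ d i n σ) =
      synth (fun ξ => chiral σ (bondSymbol γ (layerAngle θ i) ξ - γ * diracSymbol ξ) *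
        φ i (other σ) ξ) (γ • site θ d i n σ) +
      γ * synth (fun ξ => chiral σ (diracSymbol ξ) * φ i (other σ) ξ) (γ • site θ d i n σ) := by
    rw [← synth_const_mul, ← synth_add]
    · congr 1; ext ξ
      rw [chiral_sub, chiral_ofReal_mul]
      ring
    · refine Weighted.integrable (Weighted.mul (p := 1)
        (A := 12 * γ ^ 2 + γ * |layerAngle θ i|) (by positivity)
        ((continuous_chiral σ).comp
          ((continuous_bondSymbol _ _).sub (continuous_const.mul continuous_diracSymbol)))
        (fun ξ => ?_) ((h.weighted i (other σ)).mono (by norm_num)))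
      rw [norm_chiral, pow_one]
      exact norm_bondSymbol_sub_le hγ _ ξ
    · exact (Weighted.integrable (weighted_dirac
        ((h.weighted i (other σ)).mono (by norm_num)) σ)).const_mul _
  have hinter : ∀ σ' : Fin 2, ∑' k : Fin 2 → ℤ, hopPhase θ d (other i) σ' (site θ d i n σ) k *
      (γ * carrier θ (other i) (site θ d i n σ) * synth (fun ξ =>
        hopHat hs (kappaLayer θ (other i) + γ • ξ + recip (layerAngle θ (other i)) k) l *
          φ (other i) σ' ξ) (γ • site θ d i n σ)) =
      ∑' k : Fin 2 → ℤ, hopPhase θ d (other i) σ' (site θ d i n σ) k *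
        (γ * carrier θ (other i) (site θ d i n σ) * synth (fun ξ =>
          hopDefect hs l lam₀ γ (layerAngle θ (other i)) k ξ * φ (other i) σ' ξ)
            (γ • site θ d i n σ)) +
      γ * (γ * (lam₀ * (moireCoupling θ d i σ σ' (site θ d i n σ) *
        synth (φ (other i) σ') (γ • site θ d i n σ))) * carrier θ i (site θ d i n σ)) := by
    intro σ'
    have hS := hsum σ'
    simp_rw [fun k => synth_hopHat_eq hh hl lam₀ γ θ (other i) k (h.weighted (other i) σ')
      (hA k) (hD _ k) (γ • site θ d i n σ), mul_add] at hS ⊢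
    have hfin : Summable fun k : Fin 2 → ℤ => hopPhase θ d (other i) σ' (site θ d i n σ) k *
        (γ * carrier θ (other i) (site θ d i n σ) * if k ∈ nearHops then
          ((lam₀ * γ : ℝ) : ℂ) * synth (φ (other i) σ') (γ • site θ d i n σ) else 0) :=
      summable_of_ne_finset_zero (s := nearHops) fun k hk => by simp [hk]
    -- The full series converges by Poisson summation and the leading part is a finite sum, so the
    -- series of defects converges as well.
    have hS' := hS.sub hfin
    simp only [add_sub_cancel_right] at hS'
    rw [hS'.tsum_add hfin]
    congr 1
    -- Only the three near hops remain, and on atomic sites they make up the moiré coupling.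
    rw [tsum_eq_sum (s := nearHops) fun k hk => by simp [hk]]
    have hm := moireCoupling_mul_exp θ d i n σ σ'
    rw [← carrier, ← carrier] at hm
    rw [Finset.sum_congr rfl (g := fun k => hopPhase θ d (other i) σ' (site θ d i n σ) k *
        (γ * carrier θ (other i) (site θ d i n σ) *
          (((lam₀ * γ : ℝ) : ℂ) * synth (φ (other i) σ') (γ • site θ d i n σ))))
        fun k hk => by rw [if_pos hk], ← Finset.sum_mul]
    push_cast
    linear_combination (-(γ : ℂ) * γ * lam₀ * synth (φ (other i) σ') (γ • site θ d i n σ)) * hm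
  rw [tbgH, hhas.tsum_eq, ← mul_assoc, hconst, one_mul, intraH_packet γ θ d h, hintra,
    bmH_eq_synth lam₀ γ θ d h]
  simp_rw [hinter]
  rw [inv_smul_smul₀ hγ.ne', intraDefect, interDefect]
  simp only [Fin.sum_univ_two]
  ring

/-! ### Decomposition of the residual -/

lemma wavePacket_eq_packet (γ θ : ℝ) (d : Plane) {f : ℝ → Envelope} {τ : ℝ} {m : ℕ}
    {φ : Envelope} (h : Represents m φ (f (γ * τ))) :
    wavePacket γ θ d f τ = packet γ θ d φ := by
  funext i n σ
  rw [wavePacket, packet, h.eq_synth, carrier]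

lemma derivWithin_wavePacket {γ τ : ℝ} (hγ : 0 < γ) (hτ : 0 ≤ τ) (θ : ℝ) (d : Plane)
    {f : ℝ → Envelope} (hf : RegularAt f (γ * τ)) (i : Fin 2) (n : ℤ × ℤ) (σ : Fin 2) :
    derivWithin (fun t => wavePacket γ θ d f t i n σ) (Set.Ici 0) τ =
      γ * (γ * timeDeriv f (γ * τ) i σ (γ • site θ d i n σ)) * carrier θ i (site θ d i n σ) := by
  have h1 := (hf.differentiable i σ (γ • site θ d i n σ)).hasDerivWithinAt
  have h2 : HasDerivWithinAt (fun t => γ * t) γ (Set.Ici 0) τ := by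
    simpa using ((hasDerivAt_id τ).const_mul γ).hasDerivWithinAt
  have h3 := h1.scomp τ h2 (fun t ht => mul_nonneg hγ.le ht)
  have h4 := ((h3.const_mul (γ : ℂ)).mul_const (carrier θ i (site θ d i n σ))).derivWithin
    (uniqueDiffOn_Ici 0 τ hτ)
  rw [Complex.real_smul] at h4
  exact h4

lemma residual_eq (hh : HoppingAssumption hs C₁ C₂ C₃ D₁ D₂ l₀) {l : ℝ} (hl : l₀ ≤ l)
    {lam₀ γ τ : ℝ} (hγ : 0 < γ) (hτ : 0 ≤ τ) (θ : ℝ) (d : Plane) {f : ℝ → Envelope}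
    (hf : RegularAt f (γ * τ)) {φ : Envelope} (h : Represents 4 φ (f (γ * τ)))
    {A : (Fin 2 → ℤ) → ℝ} (hA : ∀ k, 0 ≤ A k)
    (hD : ∀ (ζ : ℝ) (k : Fin 2 → ℤ) (ξ : Plane),
      ‖hopDefect hs l lam₀ γ ζ k ξ‖ ≤ A k * wt ξ ^ 3)
    (i : Fin 2) (n : ℤ × ℤ) (σ : Fin 2) :
    residual hs l γ θ d f τ i n σ = leading lam₀ γ θ d f τ i n σ +
      (intraDefect γ θ d φ i n σ + interDefect hs l lam₀ γ θ d φ i n σ) := by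
  rw [residual, derivWithin_wavePacket hγ hτ θ d hf, wavePacket_eq_packet γ θ d h,
    tbgH_packet hh hl hγ θ d h hA hD, leading, bmDefect, ← carrier]
  ring

lemma compNorm_packet_lt_top {γ : ℝ} (hγ : 0 < γ) (hγ1 : γ ≤ 1) (θ : ℝ) (d : Plane)
    {φ u : Envelope} (h : Represents 4 φ u) (i σ : Fin 2) :
    compNorm (packet γ θ d φ) i σ < ⊤ := by
  have h1 := (h.weighted i σ).mono (show 1 ≤ 4 by norm_num)
  rw [compNorm, eLpNorm_eq_sampleNorm hγ θ d i σ (u := synth (φ i σ))]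
  · exact (sampleNorm_le_wNorm hγ hγ1 _ _ h1).trans_lt
      (ENNReal.mul_lt_top sampleConst_lt_top h1.lt_top)
  · intro n
    rw [packet, norm_mul, norm_mul, norm_carrier, mul_one, Complex.norm_real,
      Real.norm_of_nonneg hγ.le]

lemma compNorm_add_le (ψ χ : State) (i σ : Fin 2) :
    compNorm (fun i n σ => ψ i n σ + χ i n σ) i σ ≤ compNorm ψ i σ + compNorm χ i σ :=
  eLpNorm_add_le (Measurable.of_discrete.aestronglyMeasurable)
    (Measurable.of_discrete.aestronglyMeasurable) (by norm_num)

/-- Decomposition of the residual into its leading part and a remainder of higher order. -/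
theorem exists_residual_decomposition (hh : HoppingAssumption hs C₁ C₂ C₃ D₁ D₂ l₀)
    {lam₀ lam₁ : ℝ} (hlam₀ : 0 < lam₀) (hlam₁ : 0 < lam₁) :
    ∃ γ₀ C c : ℝ, 0 < γ₀ ∧ 0 < C ∧ 0 < c ∧
      ∀ (γ θ l : ℝ) (d : Plane) (f : ℝ → Envelope) (τ : ℝ),
        Scaling hs l₀ lam₀ lam₁ γ θ l → γ ≤ γ₀ → 0 ≤ τ → RegularAt f (γ * τ) →
        hNorm (wavePacket γ θ d f τ) < ⊤ ∧
        (∀ i n σ, Summable (interTerm hs l θ d (wavePacket γ θ d f τ) i n σ)) ∧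
        ∃ ρ : State,
          (∀ i n σ, residual hs l γ θ d f τ i n σ = leading lam₀ γ θ d f τ i n σ + ρ i n σ) ∧
          hNorm ρ ≤ ENNReal.ofReal (C * γ ^ (1 + c)) * sobolevNorm 8 (f (γ * τ)) := by
  obtain ⟨C, c, hC, hc, hc1, hdef⟩ := exists_norm_hopDefect_le hh hlam₀ lam₁
  set W : ℝ≥0∞ := ∑' k : Fin 2 → ℤ, ENNReal.ofReal (latWeight k) with hW
  have hWtop : W < ⊤ := by
    rw [hW, ← ENNReal.ofReal_tsum_of_nonneg (fun k => (latWeight_pos k).le) summable_latWeight]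
    exact ENNReal.ofReal_lt_top
  -- Four components, two layers by two sublattices; in each, one intralayer and one interlayer
  -- error.
  set K : ℝ≥0∞ := 4 * (sampleConst * (ENNReal.ofReal (12 + lam₁) +
    2 * (ENNReal.ofReal C * W))) with hK
  have hKtop : K < ⊤ := by
    refine ENNReal.mul_lt_top (by norm_num) (ENNReal.mul_lt_top sampleConst_lt_top ?_)
    exact ENNReal.add_lt_top.2 ⟨ENNReal.ofReal_lt_top,
      ENNReal.mul_lt_top (by norm_num) (ENNReal.mul_lt_top ENNReal.ofReal_lt_top hWtop)⟩
  -- The symbol bounds hold for all `γ ≤ 1`; adding 1 makes the constant positive.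
  refine ⟨1, K.toReal + 1, c, one_pos, by positivity, hc, ?_⟩
  intro γ θ l d f τ hsc hγ1 hτ hf
  have hγ := hsc.γ_pos
  have hp : 0 < γ ^ (1 + c) := Real.rpow_pos_of_pos hγ _
  obtain ⟨φ, hφ⟩ := exists_represents (m := 4) (by norm_num) hf.continuous hf.sobolev
  have hD : ∀ (ζ : ℝ) (k : Fin 2 → ℤ) (ξ : Plane), ‖hopDefect hs l lam₀ γ ζ k ξ‖ ≤
      C * γ ^ (1 + c) * latWeight k * wt ξ ^ 3 := fun ζ k ξ => hdef γ θ l ζ hsc hγ1 k ξ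
  refine ⟨?_, ?_, fun i n σ => intraDefect γ θ d φ i n σ + interDefect hs l lam₀ γ θ d φ i n σ,
    ?_, ?_⟩
  · rw [wavePacket_eq_packet γ θ d hφ]
    refine (hNorm_le_sum _).trans_lt ?_
    exact ENNReal.sum_lt_top.2 fun i _ => ENNReal.sum_lt_top.2 fun σ _ =>
      compNorm_packet_lt_top hγ hγ1 θ d hφ i σ
  · intro i n σ
    rw [wavePacket_eq_packet γ θ d hφ]
    exact (hasSum_interTerm_packet hh hsc.l₀_le hγ θ d hφ i n σ).2.summable
  · intro i n σ
    exact residual_eq hh hsc.l₀_le hγ hτ θ d hf hφ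
      (fun k => mul_nonneg (by positivity) (latWeight_pos k).le) hD i n σ
  · have hcomp : ∀ i σ : Fin 2,
        compNorm (fun i n σ => intraDefect γ θ d φ i n σ + interDefect hs l lam₀ γ θ d φ i n σ)
          i σ ≤ sampleConst * (ENNReal.ofReal (12 + lam₁) + 2 * (ENNReal.ofReal C * W)) *
            (ENNReal.ofReal (γ ^ (1 + c)) * sobolevNorm 8 (f (γ * τ))) := by
      intro i σ
      refine (compNorm_add_le _ _ i σ).trans ?_
      have h1 := compNorm_intraDefect_le hγ hγ1 hsc.θ_pos.le hsc.θ_le d hφ i σ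
      have h2 := compNorm_interDefect_le (θ := θ) hh hsc.l₀_le hγ hγ1
        (by positivity : 0 ≤ C * γ ^ (1 + c)) hD d hφ i σ
      -- Since `c ≤ 1` and `γ ≤ 1`, the intralayer error `γ²` is dominated by `γ^{1+c}`.
      have h3 : ENNReal.ofReal ((12 + lam₁) * γ ^ 2) ≤
          ENNReal.ofReal (12 + lam₁) * ENNReal.ofReal (γ ^ (1 + c)) := by
        rw [← ENNReal.ofReal_mul (by positivity)]
        apply ENNReal.ofReal_le_ofReal
        gcongr
        rw [← Real.rpow_natCast]
        exact Real.rpow_le_rpow_of_exponent_ge hγ hγ1 (by push_cast; linarith)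
      rw [ENNReal.ofReal_mul hC.le] at h2
      calc _ ≤ sampleConst * (ENNReal.ofReal (12 + lam₁) * ENNReal.ofReal (γ ^ (1 + c)) *
              sobolevNorm 8 (f (γ * τ))) + _ := add_le_add (h1.trans (by gcongr)) h2
        _ = _ := by ring
    refine (hNorm_le_sum _).trans ?_
    refine (Finset.sum_le_sum fun i _ => Finset.sum_le_sum fun σ _ => hcomp i σ).trans ?_
    simp only [Finset.sum_const, Finset.card_univ, Fintype.card_fin, nsmul_eq_mul]
    have hKle : K ≤ ENNReal.ofReal (K.toReal + 1) := by
      rw [← ENNReal.ofReal_toReal hKtop.ne]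
      apply ENNReal.ofReal_le_ofReal
      rw [ENNReal.toReal_ofReal ENNReal.toReal_nonneg]
      linarith
    rw [ENNReal.ofReal_mul (by positivity), mul_assoc (ENNReal.ofReal _)]
    calc _ = K * (ENNReal.ofReal (γ ^ (1 + c)) * sobolevNorm 8 (f (γ * τ))) := by
          rw [hK]; push_cast; ring
      _ ≤ _ := by gcongr

/-! ### The BM Hamiltonian in the Fourier representation -/

lemma wNorm_add_le {m : ℕ} {φ ψ : Plane → ℂ} (hφ : Weighted m φ) (hψ : Weighted m ψ) :
    wNorm m (fun ξ => φ ξ + ψ ξ) ≤ wNorm m φ + wNorm m ψ := by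
  simp only [wNorm, smul_add]
  exact eLpNorm_add_le hφ.memLp_smul.1 hψ.memLp_smul.1 (by norm_num)

lemma Weighted.add {m : ℕ} {φ ψ : Plane → ℂ} (hφ : Weighted m φ) (hψ : Weighted m ψ) :
    Weighted m (fun ξ => φ ξ + ψ ξ) :=
  ⟨hφ.aesm.add hψ.aesm, (wNorm_add_le hφ hψ).trans_lt (ENNReal.add_lt_top.2 ⟨hφ.2, hψ.2⟩)⟩

lemma wNorm_const_mul_le (m : ℕ) (c : ℂ) (φ : Plane → ℂ) :
    wNorm m (fun ξ => c * φ ξ) ≤ ENNReal.ofReal ‖c‖ * wNorm m φ :=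
  wNorm_mul_le (p := 0) (norm_nonneg c) (fun ξ => by simp) m

lemma Weighted.const_mul {m : ℕ} {φ : Plane → ℂ} (h : Weighted m φ) (c : ℂ) :
    Weighted m (fun ξ => c * φ ξ) :=
  Weighted.mul (p := 0) (norm_nonneg c) continuous_const (fun ξ => by simp) h

lemma weighted_finset_sum {ι : Type*} [DecidableEq ι] {m : ℕ} (s : Finset ι) {φ : ι → Plane → ℂ}
    {B : ℝ≥0∞} (h : ∀ k, Weighted m (φ k)) (hB : ∀ k, wNorm m (φ k) ≤ B) :
    Weighted m (fun ξ => ∑ k ∈ s, φ k ξ) ∧ wNorm m (fun ξ => ∑ k ∈ s, φ k ξ) ≤ s.card * B := by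
  induction s using Finset.induction_on with
  | empty =>
    have : wNorm m (fun _ : Plane => (0 : ℂ)) = 0 := by simp [wNorm]
    simp only [Finset.sum_empty, this]
    exact ⟨⟨aestronglyMeasurable_const, by rw [this]; exact ENNReal.zero_lt_top⟩, zero_le⟩
  | insert k s hk ih =>
    simp only [Finset.sum_insert hk, Finset.card_insert_of_notMem hk]
    refine ⟨(h k).add ih.1, (wNorm_add_le (h k) ih.1).trans ?_⟩
    push_cast
    rw [add_mul, one_mul, add_comm]
    exact add_le_add ih.2 (hB k)

lemma wNorm_translate_le (φ : Plane → ℂ) (hφ : AEStronglyMeasurable φ) (p : Plane) :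
    wNorm 1 (fun ξ => φ (ξ + p)) ≤ ENNReal.ofReal (2 * wt p) * wNorm 1 φ := by
  have hmp := measurePreserving_add_right (volume : Measure Plane) p
  have h1 : wNorm 1 φ = eLpNorm (fun ξ => (wt (ξ + p) ^ 1 : ℝ) • φ (ξ + p)) 2 volume :=
    (eLpNorm_comp_measurePreserving
      ((continuous_wt.pow 1).aestronglyMeasurable.smul hφ) hmp).symm
  have h2 := eLpNorm_const_smul (2 * wt p : ℝ)
    (fun ξ => (wt (ξ + p) ^ 1 : ℝ) • φ (ξ + p)) 2 (volume : Measure Plane)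
  have hwp := wt_pos p
  rw [h1, ← ofReal_norm, Real.norm_of_nonneg (by positivity)] at *
  rw [← h2]
  refine eLpNorm_mono fun ξ => ?_
  have h3 := wt_add_le (ξ + p) (-p)
  have h4 : wt (-p) = wt p := by simp [wt]
  rw [add_neg_cancel_right, h4] at h3
  rw [Pi.smul_apply, norm_smul, norm_smul, norm_smul, pow_one, pow_one,
    Real.norm_of_nonneg (wt_pos _).le, Real.norm_of_nonneg (wt_pos _).le,
    Real.norm_of_nonneg (by positivity), ← mul_assoc]
  gcongr

lemma Weighted.translate {φ : Plane → ℂ} (h : Weighted 1 φ) (p : Plane) :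
    Weighted 1 (fun ξ => φ (ξ + p)) :=
  ⟨h.aesm.comp_measurePreserving (measurePreserving_add_right volume p),
    (wNorm_translate_le φ h.aesm p).trans_lt (ENNReal.mul_lt_top ENNReal.ofReal_lt_top h.lt_top)⟩

/-! ### Dependence of the BM Hamiltonian on the twist angle -/

/-- Rotation by `-π/2`. -/
def quarterTurn (v : Plane) : Plane := !₂[v 1, -v 0]

/-- Directions of the momentum hops. -/
def hopDir : Fin 3 → Plane :=
  ![quarterTurn kappa, quarterTurn (kappa + bVec 1), quarterTurn (kappa - bVec 0)]

lemma rot_neg_sub_rot (a : ℝ) (v : Plane) :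
    rot (-a) v - rot a v = (2 * Real.sin a) • quarterTurn v := by
  apply plane_ext <;> simp [quarterTurn] <;> ring

/-- Each hop is the difference of the two rotated copies of one monolayer momentum, hence
perpendicular to that momentum and of size `2 sin(θ/2)` times its length. -/
lemma sVec_eq (θ : ℝ) (j : Fin 3) : sVec θ j = (2 * Real.sin (θ / 2)) • hopDir j := by
  have l0 : layerAngle θ 0 = -(θ / 2) := rfl
  have l1 : layerAngle θ 1 = θ / 2 := rfl
  have hj : j = 0 ∨ j = 1 ∨ j = 2 := by omega
  rcases hj with rfl | rfl | rfl
  · exact rot_neg_sub_rot _ _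
  · rw [sVec_one, show hopDir 1 = quarterTurn (kappa + bVec 1) from rfl, ← rot_neg_sub_rot,
      rot_add, rot_add, kappaLayer, kappaLayer, bLayer, bLayer, l0, l1]
    abel
  · rw [sVec_two, show hopDir 2 = quarterTurn (kappa - bVec 0) from rfl, ← rot_neg_sub_rot,
      rot_sub, rot_sub, kappaLayer, kappaLayer, bLayer, bLayer, l0, l1]
    abel

/-- Every inner product pairs two vectors of the same layer, so the rotation cancels. -/
lemma hopMat_eq (θ : ℝ) (d : Plane) : hopMat θ d = hopMat 0 d := by
  simp only [hopMat, bLayer, tauLayer, inner_rot_rot]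

lemma norm_hopMat (θ : ℝ) (d : Plane) (j : Fin 3) (σ σ' : Fin 2) : ‖hopMat θ d j σ σ'‖ = 1 := by
  have hj : j = 0 ∨ j = 1 ∨ j = 2 := by omega
  rcases hj with rfl | rfl | rfl
  · exact norm_one
  · exact norm_exp_I_mul _
  · exact norm_exp_I_mul _

/-- Coefficients of the momentum hops into layer `i`. -/
def hopCoeff (d : Plane) (i σ σ' : Fin 2) (j : Fin 3) : ℂ :=
  (![hopMat 0 d j σ σ', (starRingEnd ℂ) (hopMat 0 d j σ' σ)] : Fin 2 → ℂ) i

lemma norm_hopCoeff (d : Plane) (i σ σ' : Fin 2) (j : Fin 3) : ‖hopCoeff d i σ σ' j‖ = 1 := by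
  have hi : i = 0 ∨ i = 1 := by omega
  rcases hi with rfl | rfl
  · exact norm_hopMat 0 d j σ σ'
  · exact (RCLike.norm_conj _).trans (norm_hopMat 0 d j σ' σ)

/-- Sign of the momentum hops into layer `i`. -/
def hopSign (i : Fin 2) : ℝ := (![1, -1] : Fin 2 → ℝ) i

/-- The coupling depends on the parameters only through `β = 2 sin(θ/2) / γ`. -/
lemma moireCoupling_smul {γ θ β : ℝ} (hγ : 0 < γ) (hβ : 2 * Real.sin (θ / 2) = β * γ)
    (d : Plane) (i σ σ' : Fin 2) (X : Plane) :
    moireCoupling θ d i σ σ' (γ⁻¹ • X) = ∑ j : Fin 3, hopCoeff d i σ σ' j *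
      Complex.exp (-Complex.I * (inner ℝ ((hopSign i * β) • hopDir j) X : ℝ)) := by
  have hm : ∀ σ σ', moire θ d (γ⁻¹ • X) σ σ' = ∑ j : Fin 3,
      Complex.exp (Complex.I * ((-(β * inner ℝ (hopDir j) X) : ℝ) : ℂ)) * hopMat 0 d j σ σ' := by
    intro σ σ'
    rw [moire_apply, hopMat_eq]
    refine Finset.sum_congr rfl fun j _ => ?_
    rw [sVec_eq, hβ, real_inner_smul_left, real_inner_smul_right]
    congr 4
    field_simp
  have hi : i = 0 ∨ i = 1 := by omega
  rcases hi with rfl | rfl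
  · rw [moireCoupling, Matrix.cons_val_zero, hm]
    refine Finset.sum_congr rfl fun j _ => ?_
    rw [mul_comm, real_inner_smul_left]
    congr 2
    simp [hopSign]
  · have : moireCoupling θ d 1 σ σ' (γ⁻¹ • X) = (starRingEnd ℂ) (moire θ d (γ⁻¹ • X) σ' σ) := rfl
    rw [this, hm, map_sum]
    refine Finset.sum_congr rfl fun j _ => ?_
    rw [map_mul, conj_exp_I_mul, mul_comm, real_inner_smul_left]
    congr 2
    simp [hopSign]

/-- The Fourier representation of the BM defect. -/
def defectSymbol (lam₀ β : ℝ) (d : Plane) (φ ψ : Envelope) : Envelope := fun i σ ξ =>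
  (-Complex.I * ψ i σ ξ + chiral σ (diracSymbol ξ) * φ i (other σ) ξ) +
    ∑ p : Fin 2 × Fin 3, (lam₀ * hopCoeff d i σ p.1 p.2) *
      φ (other i) p.1 (ξ + (hopSign i * β) • hopDir p.2)

lemma weighted_defectTerm {φ u : Envelope} (hφ : Represents 4 φ u) (lam₀ β : ℝ) (d : Plane)
    (i σ : Fin 2) (p : Fin 2 × Fin 3) :
    Weighted 1 (fun ξ => (lam₀ * hopCoeff d i σ p.1 p.2) *
      φ (other i) p.1 (ξ + (hopSign i * β) • hopDir p.2)) :=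
  (((hφ.weighted _ _).mono (show 1 ≤ 4 by norm_num)).translate _).const_mul _

/-- Multiplication by the moiré plane waves translates symbols, so the defect, potential included,
is again a superposition to which the sampling inequalities apply. -/
lemma bmDefect_eq_synth {lam₀ γ θ β T : ℝ} (hγ : 0 < γ) (hβ : 2 * Real.sin (θ / 2) = β * γ)
    (d : Plane) {f : ℝ → Envelope} {φ ψ : Envelope} (hφ : Represents 4 φ (f T))
    (hψ : Represents 1 ψ (timeDeriv f T)) (i σ : Fin 2) :
    bmDefect lam₀ γ θ d f T i σ = synth (defectSymbol lam₀ β d φ ψ i σ) := by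
  have hψi := (hψ.weighted i σ).integrable
  have hdi := (weighted_dirac ((hφ.weighted i (other σ)).mono (show 1 + 1 ≤ 4 by norm_num))
    σ).integrable
  have hti := fun p => (weighted_defectTerm hφ lam₀ β d i σ p).integrable
  ext X
  unfold defectSymbol
  have hadd : Integrable fun ξ =>
      -Complex.I * ψ i σ ξ + chiral σ (diracSymbol ξ) * φ i (other σ) ξ :=
    (hψi.const_mul _).add hdi
  rw [synth_add hadd (integrable_finsetSum _ fun p _ => hti p),
    synth_add (hψi.const_mul _) hdi, synth_const_mul, synth_finset_sum _ fun p _ => hti p,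
    bmDefect, hψ.eq_synth, bmH_eq_synth lam₀ γ θ d hφ]
  have ht : ∑ p : Fin 2 × Fin 3, synth (fun ξ => (lam₀ * hopCoeff d i σ p.1 p.2) *
      φ (other i) p.1 (ξ + (hopSign i * β) • hopDir p.2)) X =
      lam₀ * ∑ σ' : Fin 2, moireCoupling θ d i σ σ' (γ⁻¹ • X) * synth (φ (other i) σ') X := by
    rw [Fintype.sum_prod_type, Finset.mul_sum]
    refine Finset.sum_congr rfl fun σ' _ => ?_
    rw [moireCoupling_smul hγ hβ, Finset.sum_mul, Finset.mul_sum]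
    refine Finset.sum_congr rfl fun j _ => ?_
    rw [synth_const_mul, mul_assoc (hopCoeff d i σ σ' j), exp_mul_synth, mul_assoc]
  rw [ht]
  ring

/-- The 2 counts the time derivative and the Dirac term, the 6 the translated terms (two
sublattices, three hops). A translation by `p` costs `2 wt p`, which `M` bounds. -/
lemma weighted_defectSymbol {lam₀ β M T : ℝ} (hlam₀ : 0 ≤ lam₀)
    (hM : ∀ j, wt (β • hopDir j) ≤ M)
    (d : Plane) {f : ℝ → Envelope} {φ ψ : Envelope} (hφ : Represents 4 φ (f T))
    (hψ : Represents 1 ψ (timeDeriv f T)) {B : ℝ≥0∞} (hB : sobolevNorm 8 (f T) ≤ B)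
    (hB' : sobolevNorm 2 (timeDeriv f T) ≤ B) (i σ : Fin 2) :
    Weighted 1 (defectSymbol lam₀ β d φ ψ i σ) ∧
      wNorm 1 (defectSymbol lam₀ β d φ ψ i σ) ≤
        (2 + 6 * ENNReal.ofReal (lam₀ * (2 * M))) * B := by
  have hψw := (hψ.weighted i σ).const_mul (-Complex.I)
  have hd : Weighted 2 (φ i (other σ)) := (hφ.weighted i (other σ)).mono (by norm_num)
  have hdw := weighted_dirac (m := 1) hd σ
  have hwφ : ∀ i σ, ∀ m ≤ 4, wNorm m (φ i σ) ≤ B := fun i σ m hm =>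
    (wNorm_mono_weight hm _).trans ((hφ.wNorm_le i σ).trans hB)
  have hsum := weighted_finset_sum (m := 1) (Finset.univ : Finset (Fin 2 × Fin 3))
    (B := ENNReal.ofReal (lam₀ * (2 * M)) * B) (weighted_defectTerm hφ lam₀ β d i σ) (by
      intro p
      refine (wNorm_const_mul_le 1 _ _).trans ?_
      rw [norm_mul, norm_hopCoeff, mul_one, Complex.norm_real, Real.norm_of_nonneg hlam₀,
        ENNReal.ofReal_mul hlam₀, mul_assoc]
      gcongr
      refine (wNorm_translate_le _ (hφ.weighted _ _).aesm _).trans ?_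
      refine mul_le_mul' (ENNReal.ofReal_le_ofReal ?_) (hwφ _ _ 1 (by norm_num))
      have : wt ((hopSign i * β) • hopDir p.2) = wt (β • hopDir p.2) := by
        fin_cases i <;> simp [hopSign, wt]
      rw [this]
      linarith [hM p.2])
  refine ⟨(hψw.add hdw).add hsum.1, ?_⟩
  refine (wNorm_add_le (hψw.add hdw) hsum.1).trans ?_
  have h1 : wNorm 1 (fun ξ => -Complex.I * ψ i σ ξ) ≤ B := by
    refine (wNorm_const_mul_le 1 _ _).trans ?_
    rw [norm_neg, Complex.norm_I, ENNReal.ofReal_one, one_mul]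
    exact (hψ.wNorm_le i σ).trans hB'
  have h2 : wNorm 1 (fun ξ => chiral σ (diracSymbol ξ) * φ i (other σ) ξ) ≤ B := by
    refine (wNorm_mul_le zero_le_one
      (fun ξ => by rw [norm_chiral]; exact norm_diracSymbol_le_wt ξ) 1).trans ?_
    rw [ENNReal.ofReal_one, one_mul]
    exact hwφ _ _ 2 (by norm_num)
  refine (add_le_add ((wNorm_add_le hψw hdw).trans (add_le_add h1 h2)) hsum.2).trans ?_
  apply le_of_eq
  simp
  ring

/-! ### Comparison of the residual with the BM defect -/

lemma l2Norm_sq (u : Envelope) :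
    l2Norm u ^ 2 = ∑ i : Fin 2, ∑ σ : Fin 2, eLpNorm (u i σ) 2 volume ^ 2 := by
  rw [l2Norm, ← ENNReal.rpow_natCast, ← ENNReal.rpow_mul]
  norm_num

lemma eLpNorm_le_l2Norm (u : Envelope) (i σ : Fin 2) :
    eLpNorm (u i σ) 2 volume ≤ l2Norm u := by
  apply ennreal_le_of_sq_le
  rw [l2Norm_sq]
  refine le_trans ?_ (Finset.single_le_sum (f := fun i => ∑ σ, eLpNorm (u i σ) 2 volume ^ 2)
    (fun _ _ => zero_le) (Finset.mem_univ i))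
  exact Finset.single_le_sum (f := fun σ => eLpNorm (u i σ) 2 volume ^ 2)
    (fun _ _ => zero_le) (Finset.mem_univ σ)

lemma l2Norm_le_sum (u : Envelope) :
    l2Norm u ≤ ∑ i : Fin 2, ∑ σ : Fin 2, eLpNorm (u i σ) 2 volume := by
  apply ennreal_le_of_sq_le
  rw [l2Norm_sq]
  simp only [Fin.sum_univ_two]
  refine le_trans ?_ (ennreal_sq_add_sq_le _ _)
  gcongr <;> exact ennreal_sq_add_sq_le _ _

lemma compNorm_leading {γ : ℝ} (hγ : 0 < γ) (lam₀ θ : ℝ) (d : Plane) (f : ℝ → Envelope) (τ : ℝ)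
    (i σ : Fin 2) :
    compNorm (leading lam₀ γ θ d f τ) i σ = ENNReal.ofReal γ *
      sampleNorm γ (layerAngle θ i) (γ • tauLayer θ d i σ)
        (bmDefect lam₀ γ θ d f (γ * τ) i σ) := by
  have h := eLpNorm_const_smul (γ : ℂ) (fun n : ℤ × ℤ =>
    (γ : ℂ) * bmDefect lam₀ γ θ d f (γ * τ) i σ (γ • site θ d i n σ) *
      carrier θ i (site θ d i n σ)) 2 Measure.count
  rw [← ofReal_norm, Complex.norm_real, Real.norm_of_nonneg hγ.le] at h
  exact h.trans (congrArg _ (eLpNorm_eq_sampleNorm hγ θ d i σ fun n => by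
    rw [norm_mul, norm_mul, norm_carrier, mul_one, Complex.norm_real, Real.norm_of_nonneg hγ.le]))

lemma compNorm_le_of_eq_add {r ψ ρ : State} (h : ∀ i n σ, r i n σ = ψ i n σ + ρ i n σ)
    (i σ : Fin 2) : compNorm r i σ ≤ compNorm ψ i σ + hNorm ρ := by
  have : r = fun i n σ => ψ i n σ + ρ i n σ := by funext i n σ; exact h i n σ
  rw [this]
  exact (compNorm_add_le ψ ρ i σ).trans (add_le_add le_rfl (compNorm_le_hNorm ρ i σ))

lemma compNorm_le_of_add_eq {r ψ ρ : State} (h : ∀ i n σ, r i n σ = ψ i n σ + ρ i n σ)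
    (i σ : Fin 2) : compNorm ψ i σ ≤ hNorm r + hNorm ρ := by
  have hn : compNorm (fun i n σ => -ρ i n σ) i σ = compNorm ρ i σ := by
    unfold compNorm
    exact eLpNorm_neg (fun n => ρ i n σ) 2 Measure.count
  have h2 := compNorm_add_le r (fun i n σ => -ρ i n σ) i σ
  have e : (fun i n σ => r i n σ + -ρ i n σ) = ψ := by
    funext i n σ; rw [h]; ring
  rw [e, hn] at h2
  exact h2.trans (add_le_add (compNorm_le_hNorm r i σ) (compNorm_le_hNorm ρ i σ))

section Comparison

variable {γ lam₀ θ τ : ℝ} {d : Plane} {f : ℝ → Envelope} {r ρ : State} {e : ℝ≥0∞}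

lemma hNorm_div_le (hγ : 0 < γ)
    (hr : ∀ i n σ, r i n σ = leading lam₀ γ θ d f τ i n σ + ρ i n σ)
    (hρ : hNorm ρ ≤ ENNReal.ofReal γ * e) {b : ℝ≥0∞}
    (hs : ∀ i σ, sampleNorm γ (layerAngle θ i) (γ • tauLayer θ d i σ)
      (bmDefect lam₀ γ θ d f (γ * τ) i σ) ≤ b) :
    hNorm r / ENNReal.ofReal γ ≤ 4 * (b + e) := by
  apply ENNReal.div_le_of_le_mul
  refine (hNorm_le_sum r).trans ?_
  have h : ∀ i σ, compNorm r i σ ≤ ENNReal.ofReal γ * (b + e) := fun i σ => by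
    refine (compNorm_le_of_eq_add hr i σ).trans ?_
    rw [compNorm_leading hγ, mul_add]
    exact add_le_add (mul_le_mul_right (hs i σ) _) hρ
  refine (Finset.sum_le_sum fun i _ => Finset.sum_le_sum fun σ _ => h i σ).trans (le_of_eq ?_)
  simp only [Finset.sum_const, Finset.card_univ, Fintype.card_fin, nsmul_eq_mul]
  push_cast
  ring

lemma sampleNorm_le_hNorm_div (hγ : 0 < γ)
    (hr : ∀ i n σ, r i n σ = leading lam₀ γ θ d f τ i n σ + ρ i n σ)
    (hρ : hNorm ρ ≤ ENNReal.ofReal γ * e) (i σ : Fin 2) :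
    sampleNorm γ (layerAngle θ i) (γ • tauLayer θ d i σ)
      (bmDefect lam₀ γ θ d f (γ * τ) i σ) ≤ hNorm r / ENNReal.ofReal γ + e := by
  have hg : ENNReal.ofReal γ ≠ 0 := by simpa using hγ
  have h := (compNorm_le_of_add_eq hr i σ).trans (add_le_add le_rfl hρ)
  rw [compNorm_leading hγ] at h
  refine (ENNReal.mul_le_mul_iff_right hg ENNReal.ofReal_ne_top).1 (h.trans (le_of_eq ?_))
  rw [mul_add, ENNReal.mul_div_cancel hg ENNReal.ofReal_ne_top]

end Comparison

lemma tendsto_zero_of_le {a b e : ℕ → ℝ≥0∞} {K L : ℝ≥0∞} (hK : K ≠ ⊤) (hL : L ≠ ⊤)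
    (h : ∀ᶠ n in atTop, a n ≤ K * (L * b n + e n)) (hb : Tendsto b atTop (𝓝 0))
    (he : Tendsto e atTop (𝓝 0)) : Tendsto a atTop (𝓝 0) := by
  have h1 := ENNReal.Tendsto.const_mul (a := L) hb (Or.inr hL)
  have h2 := ENNReal.Tendsto.const_mul (a := K) (h1.add he) (Or.inr hK)
  simp only [mul_zero, add_zero] at h2
  exact tendsto_of_tendsto_of_tendsto_of_le_of_le' tendsto_const_nhds h2
    (Eventually.of_forall fun _ => zero_le) h

lemma tendsto_ofReal_mul_zero {g : ℕ → ℝ} (hg : Tendsto g atTop (𝓝 0)) {S : ℝ≥0∞} (hS : S ≠ ⊤) :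
    Tendsto (fun n => ENNReal.ofReal (g n) * S) atTop (𝓝 0) := by
  have h := ENNReal.Tendsto.mul_const (b := S) (ENNReal.tendsto_ofReal hg) (Or.inr hS)
  simpa using h

lemma tendsto_const_mul_rpow {γ : ℕ → ℝ} (hγ : Tendsto γ atTop (𝓝 0)) {c : ℝ} (hc : 0 < c)
    (C : ℝ) : Tendsto (fun n => C * γ n ^ c) atTop (𝓝 0) := by
  have := (hγ.rpow_const (p := c) (Or.inr hc.le)).const_mul C
  rwa [Real.zero_rpow hc.ne', mul_zero] at this

lemma ofReal_mul_rpow_one_add {γ : ℝ} (hγ : 0 < γ) (C c : ℝ) (S : ℝ≥0∞) :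
    ENNReal.ofReal (C * γ ^ (1 + c)) * S =
      ENNReal.ofReal γ * (ENNReal.ofReal (C * γ ^ c) * S) := by
  rw [← mul_assoc, ← ENNReal.ofReal_mul hγ.le, Real.rpow_add hγ, Real.rpow_one]
  congr 2
  ring

/-- Keeps the scaled momentum hops in a bounded set, so that the bounds are uniform along a sequence
of parameters. -/
lemma Scaling.abs_div_le {lam₀ lam₁ γ θ l : ℝ} (h : Scaling hs l₀ lam₀ lam₁ γ θ l) :
    |2 * Real.sin (θ / 2) / γ| ≤ lam₁ := by
  have hγ := h.γ_pos
  rw [abs_div, abs_of_pos hγ, div_le_iff₀ hγ, abs_mul, abs_two]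
  have h1 : |Real.sin (θ / 2)| ≤ |θ / 2| := Real.abs_sin_le_abs
  rw [abs_of_pos (half_pos h.θ_pos)] at h1
  linarith [h.θ_le]

/-- For bounded families, the residual is `o(γ)` iff the BM defect tends to zero in `L²`. -/
theorem tendsto_residual_iff (hh : HoppingAssumption hs C₁ C₂ C₃ D₁ D₂ l₀)
    {lam₀ lam₁ : ℝ} (hlam₀ : 0 < lam₀) (hlam₁ : 0 < lam₁)
    (γ θ l τ : ℕ → ℝ) (d : ℕ → Plane) (f : ℕ → ℝ → Envelope) (B : ℝ≥0)
    (hsc : ∀ n, Scaling hs l₀ lam₀ lam₁ (γ n) (θ n) (l n)) (hγ0 : Tendsto γ atTop (𝓝 0))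
    (hτ : ∀ n, 0 ≤ τ n) (hf : ∀ n, RegularAt (f n) (γ n * τ n))
    (hB : ∀ n, sobolevNorm 8 (f n (γ n * τ n)) ≤ B)
    (hc' : ∀ n i σ, Continuous (timeDeriv (f n) (γ n * τ n) i σ))
    (hB' : ∀ n, sobolevNorm 2 (timeDeriv (f n) (γ n * τ n)) ≤ B) :
    Tendsto (fun n => hNorm (residual hs (l n) (γ n) (θ n) (d n) (f n) (τ n)) /
        ENNReal.ofReal (γ n)) atTop (𝓝 0) ↔
      Tendsto (fun n => l2Norm (bmDefect lam₀ (γ n) (θ n) (d n) (f n) (γ n * τ n)))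
        atTop (𝓝 0) := by
  obtain ⟨γ₀, C, c, hγ₀, hC, hc, H⟩ := exists_residual_decomposition hh hlam₀ hlam₁
  set M : ℝ := 1 + lam₁ ^ 2 * ∑ j, ‖hopDir j‖ ^ 2 with hM
  have hMj : ∀ n j, wt ((2 * Real.sin (θ n / 2) / γ n) • hopDir j) ≤ M := by
    intro n j
    have h1 := pow_le_pow_left₀ (abs_nonneg _) (hsc n).abs_div_le 2
    have h2 : ‖hopDir j‖ ^ 2 ≤ ∑ j, ‖hopDir j‖ ^ 2 :=
      Finset.single_le_sum (f := fun j => ‖hopDir j‖ ^ 2) (fun _ _ => by positivity)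
        (Finset.mem_univ j)
    rw [wt, norm_smul, mul_pow, Real.norm_eq_abs, hM]
    gcongr
  set K₀ : ℝ≥0∞ := (2 + 6 * ENNReal.ofReal (lam₀ * (2 * M))) * B with hK₀
  have hK₀top : K₀ ≠ ⊤ := (ENNReal.mul_lt_top (ENNReal.add_lt_top.2 ⟨by norm_num,
    ENNReal.mul_lt_top (by norm_num) ENNReal.ofReal_lt_top⟩) ENNReal.coe_lt_top).ne
  have hψ : ∀ n, ∃ χ : Envelope, ∀ i σ, Weighted 1 (χ i σ) ∧ wNorm 1 (χ i σ) ≤ K₀ ∧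
      bmDefect lam₀ (γ n) (θ n) (d n) (f n) (γ n * τ n) i σ = synth (χ i σ) := by
    intro n
    have hγ := (hsc n).γ_pos
    obtain ⟨φ, hφ⟩ := exists_represents (m := 4) (by norm_num) (hf n).continuous (hf n).sobolev
    obtain ⟨ψ, hψ⟩ := exists_represents (m := 1) le_rfl (hc' n)
      ((hB' n).trans_lt ENNReal.coe_lt_top)
    refine ⟨defectSymbol lam₀ (2 * Real.sin (θ n / 2) / γ n) (d n) φ ψ, fun i σ => ?_⟩
    have hw := weighted_defectSymbol hlam₀.le (hMj n) (d n) hφ hψ (hB n) (hB' n) i σ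
    exact ⟨hw.1, hw.2, bmDefect_eq_synth hγ (by field_simp) (d n) hφ hψ i σ⟩
  choose χ hχ using hψ
  have hcell := cellConst_pos
  -- Here `e₁` is the remainder of the decomposition divided by `γ`, and `e₂` is the aliasing error
  -- of the defect.
  set e₁ : ℕ → ℝ≥0∞ := fun n => ENNReal.ofReal (C * γ n ^ c) * B with he₁
  set e₂ : ℕ → ℝ≥0∞ := fun n => ENNReal.ofReal (γ n ^ 2) *
    (ENNReal.ofReal cellConst * (aliasConst * K₀)) with he₂
  have he₁0 : Tendsto e₁ atTop (𝓝 0) :=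
    tendsto_ofReal_mul_zero (tendsto_const_mul_rpow hγ0 hc C) ENNReal.coe_ne_top
  have he₂0 : Tendsto e₂ atTop (𝓝 0) := by
    refine tendsto_ofReal_mul_zero (by simpa using hγ0.pow 2) ?_
    exact ENNReal.mul_ne_top ENNReal.ofReal_ne_top
      (ENNReal.mul_ne_top aliasConst_lt_top.ne hK₀top)
  have he : Tendsto (fun n => e₂ n + e₁ n) atTop (𝓝 0) := by simpa using he₂0.add he₁0
  have hev : ∀ᶠ n in atTop, γ n ≤ γ₀ := (hγ0.eventually (gt_mem_nhds hγ₀)).mono fun n h => h.le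
  have hdec : ∀ᶠ n in atTop, ∃ ρ : State,
      (∀ i m σ, residual hs (l n) (γ n) (θ n) (d n) (f n) (τ n) i m σ =
        leading lam₀ (γ n) (θ n) (d n) (f n) (τ n) i m σ + ρ i m σ) ∧
      hNorm ρ ≤ ENNReal.ofReal (γ n) * e₁ n := by
    filter_upwards [hev] with n hn
    obtain ⟨-, -, ρ, h1, h2⟩ := H (γ n) (θ n) (l n) (d n) (f n) (τ n) (hsc n) hn (hτ n) (hf n)
    refine ⟨ρ, h1, h2.trans ?_⟩
    rw [ofReal_mul_rpow_one_add (hsc n).γ_pos]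
    gcongr
    exact mul_le_mul_right (hB n) _
  have hl2 : ∀ n i σ, eLpNorm (bmDefect lam₀ (γ n) (θ n) (d n) (f n) (γ n * τ n) i σ) 2 volume =
      ENNReal.ofReal (2 * Real.pi) * eLpNorm (χ n i σ) 2 volume := by
    intro n i σ
    rw [(hχ n i σ).2.2, eLpNorm_synth (hχ n i σ).1]
  constructor
  -- Lower sampling inequality: samples control the `L²` norm of the symbol, and Plancherel that of
  -- the defect.
  · intro ha
    refine tendsto_zero_of_le (K := 4 * (ENNReal.ofReal (2 * Real.pi) *
      (ENNReal.ofReal cellConst)⁻¹)) (L := 1) ?_ ENNReal.one_ne_top ?_ ha he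
    · refine ENNReal.mul_ne_top (by norm_num) (ENNReal.mul_ne_top ENNReal.ofReal_ne_top ?_)
      simpa using hcell
    filter_upwards [hdec] with n ⟨ρ, h1, h2⟩
    refine (l2Norm_le_sum _).trans ?_
    have h : ∀ i σ, eLpNorm (χ n i σ) 2 volume ≤ (ENNReal.ofReal cellConst)⁻¹ *
        (1 * (hNorm (residual hs (l n) (γ n) (θ n) (d n) (f n) (τ n)) / ENNReal.ofReal (γ n)) +
          (e₂ n + e₁ n)) := by
      intro i σ
      have h3 := sampleNorm_le_hNorm_div (hsc n).γ_pos h1 h2 i σ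
      rw [(hχ n i σ).2.2] at h3
      have h4 := (le_sampleNorm_synth (hsc n).γ_pos (layerAngle (θ n) i)
        (γ n • tauLayer (θ n) (d n) i σ) (hχ n i σ).1).trans (add_le_add h3 (le_refl _))
      have hc0 : ENNReal.ofReal cellConst ≠ 0 := by simpa using hcell
      rw [← ENNReal.mul_le_mul_iff_right hc0 ENNReal.ofReal_ne_top, ← mul_assoc,
        ENNReal.mul_inv_cancel hc0 ENNReal.ofReal_ne_top, one_mul, one_mul]
      refine h4.trans ?_
      rw [add_assoc, add_comm (e₂ n)]
      gcongr
      rw [he₂]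
      calc _ ≤ ENNReal.ofReal cellConst * (aliasConst * (ENNReal.ofReal (γ n ^ 2) * K₀)) := by
            gcongr
            exact (hχ n i σ).2.1
        _ = _ := by ring
    simp only [hl2]
    refine (Finset.sum_le_sum fun i _ => Finset.sum_le_sum fun σ _ =>
      mul_le_mul_right (h i σ) _).trans (le_of_eq ?_)
    simp only [Finset.sum_const, Finset.card_univ, Fintype.card_fin, nsmul_eq_mul]
    push_cast
    ring
  -- Upper sampling inequality, then the decomposition of the residual.
  · intro hb
    refine tendsto_zero_of_le (K := 4) (L := ENNReal.ofReal cellConst) (by norm_num)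
      ENNReal.ofReal_ne_top ?_ hb he
    filter_upwards [hdec] with n ⟨ρ, h1, h2⟩
    rw [← add_assoc]
    refine hNorm_div_le (hsc n).γ_pos h1 h2 fun i σ => ?_
    rw [(hχ n i σ).2.2]
    refine (sampleNorm_synth_le (hsc n).γ_pos _ _ (hχ n i σ).1).trans ?_
    rw [mul_add]
    refine add_le_add ?_ ?_
    · gcongr
      refine le_trans ?_ (eLpNorm_le_l2Norm _ i σ)
      rw [hl2]
      refine le_mul_of_one_le_left' ?_
      rw [ENNReal.one_le_ofReal]
      linarith [Real.pi_gt_three]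
    · rw [he₂]
      calc _ ≤ ENNReal.ofReal cellConst * (aliasConst * (ENNReal.ofReal (γ n ^ 2) * K₀)) := by
            gcongr
            exact (hχ n i σ).2.1
        _ = _ := by ring

/-! ### Sampling a continuous function on a fine lattice -/

lemma rot_rot_neg (ζ : ℝ) (v : Plane) : rot ζ (rot (-ζ) v) = v := by
  have h := Real.sin_sq_add_cos_sq ζ
  apply plane_ext
  · simp
    linear_combination v 0 * h
  · simp
    linear_combination v 1 * h

/-- Every point is within distance `2` of the lattice. -/
lemma exists_latPoint_near (ζ : ℝ) (v : Plane) : ∃ m : Fin 2 → ℤ, ‖latPoint ζ m - v‖ ≤ 2 := by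
  set w := rot (-ζ) v with hw
  set s : ℝ := w 0 + w 1 / Real.sqrt 3
  set t : ℝ := -w 0 + w 1 / Real.sqrt 3
  have hwst : w = s • aVec 0 + t • aVec 1 := by
    have h3 : Real.sqrt 3 ≠ 0 := by positivity
    apply plane_ext
    · simp [aVec, s, t]
      ring
    · simp [aVec, s, t]
      field_simp
      ring
  have hv : v = s • rot ζ (aVec 0) + t • rot ζ (aVec 1) := by
    rw [← rot_rot_neg ζ v, ← hw, hwst, rot_add, rot_smul, rot_smul]
  refine ⟨![⌊s⌋, ⌊t⌋], ?_⟩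
  have e : latPoint ζ ![⌊s⌋, ⌊t⌋] - v =
      ((⌊s⌋ : ℝ) - s) • rot ζ (aVec 0) + ((⌊t⌋ : ℝ) - t) • rot ζ (aVec 1) := by
    rw [hv]
    simp only [latPoint, Matrix.cons_val_zero, Matrix.cons_val_one]
    module
  have hf : ∀ x : ℝ, |(⌊x⌋ : ℝ) - x| ≤ 1 := fun x => by
    rw [abs_le]
    constructor <;> linarith [Int.floor_le x, Int.lt_floor_add_one x]
  rw [e]
  refine (norm_add_le _ _).trans ?_
  rw [norm_smul, norm_smul, norm_rot, norm_rot, norm_aVec, norm_aVec, mul_one, mul_one,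
    Real.norm_eq_abs, Real.norm_eq_abs]
  linarith [hf s, hf t]

lemma norm_latPoint_add_sub_le (ζ : ℝ) (v : Plane) {m : Fin 2 → ℤ}
    (hm : ‖latPoint ζ m - v‖ ≤ 2) {N : ℕ} (p : Fin N × Fin N) :
    ‖latPoint ζ (m + ![(p.1 : ℤ), (p.2 : ℤ)]) - v‖ ≤ 2 + 2 * N := by
  have e : latPoint ζ (m + ![(p.1 : ℤ), (p.2 : ℤ)]) - v = (latPoint ζ m - v) +
      (((p.1 : ℕ) : ℝ) • rot ζ (aVec 0) + ((p.2 : ℕ) : ℝ) • rot ζ (aVec 1)) := by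
    simp only [latPoint, Pi.add_apply, Matrix.cons_val_zero, Matrix.cons_val_one]
    push_cast
    module
  have h1 : ((p.1 : ℕ) : ℝ) ≤ N := by exact_mod_cast p.1.2.le
  have h2 : ((p.2 : ℕ) : ℝ) ≤ N := by exact_mod_cast p.2.2.le
  rw [e]
  refine (norm_add_le _ _).trans (add_le_add hm ((norm_add_le _ _).trans ?_))
  rw [norm_smul, norm_smul, norm_rot, norm_rot, norm_aVec, norm_aVec, mul_one, mul_one,
    Real.norm_of_nonneg (by positivity), Real.norm_of_nonneg (by positivity)]
  linarith

/-- A continuous function that does not vanish identically has samples bounded below. -/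
lemma exists_le_sampleNorm {g : Plane → ℂ} (hg : Continuous g) {X₀ : Plane} (hX₀ : g X₀ ≠ 0) :
    ∃ ε γ₁ : ℝ, 0 < ε ∧ 0 < γ₁ ∧ ∀ γ, 0 < γ → γ ≤ γ₁ → ∀ (ζ : ℝ) (y : Plane),
      ENNReal.ofReal ε ≤ sampleNorm γ ζ y g := by
  have hδ : 0 < ‖g X₀‖ / 2 := half_pos (norm_pos_iff.2 hX₀)
  obtain ⟨s, hs, hball⟩ := Metric.continuousAt_iff.1 hg.continuousAt (‖g X₀‖ / 2) hδ
  set δ := ‖g X₀‖ / 2 with hδdef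
  have hlow : ∀ x, dist x X₀ < s → δ ≤ ‖g x‖ := by
    intro x hx
    have h1 := hball hx
    rw [dist_eq_norm] at h1
    have h2 := norm_sub_norm_le (g X₀) (g x)
    rw [norm_sub_rev] at h2
    linarith
  refine ⟨s / 8 * δ, s / 8, by positivity, by positivity, fun γ hγ hγs ζ y => ?_⟩
  -- An `N × N` block of lattice points around `X₀` with `s/8 ≤ γN ≤ s/4`. It lies within `γ(2 + 2N)
  -- ≤ 3s/4 < s` of `X₀`, and its `N²` samples contribute at least `(γNδ)² ≥ (sδ/8)²`.
  set N : ℕ := ⌊s / (4 * γ)⌋₊ with hN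
  have hN1 : (N : ℝ) ≤ s / (4 * γ) := Nat.floor_le (by positivity)
  have hN2 : s / (4 * γ) < N + 1 := Nat.lt_floor_add_one _
  have hN1' : γ * N ≤ s / 4 := by
    rw [le_div_iff₀ (by positivity)] at hN1
    linarith
  have hN2' : s / 8 ≤ γ * N := by
    rw [div_lt_iff₀ (by positivity)] at hN2
    linarith
  obtain ⟨m, hm⟩ := exists_latPoint_near ζ (γ⁻¹ • (X₀ - y))
  have hpt : ∀ p : Fin N × Fin N,
      δ ≤ ‖g (γ • latPoint ζ (m + ![(p.1 : ℤ), (p.2 : ℤ)]) + y)‖ := by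
    intro p
    apply hlow
    have h1 := norm_latPoint_add_sub_le ζ _ hm p
    have e : γ • latPoint ζ (m + ![(p.1 : ℤ), (p.2 : ℤ)]) + y - X₀ =
        γ • (latPoint ζ (m + ![(p.1 : ℤ), (p.2 : ℤ)]) - γ⁻¹ • (X₀ - y)) := by
      rw [smul_sub, smul_inv_smul₀ hγ.ne']
      abel
    rw [dist_eq_norm, e, norm_smul, Real.norm_of_nonneg hγ.le]
    nlinarith
  have hinj : Function.Injective fun p : Fin N × Fin N => m + ![(p.1 : ℤ), (p.2 : ℤ)] := by
    intro p q hpq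
    have h0 := congrFun hpq 0
    have h1 := congrFun hpq 1
    simp only [Pi.add_apply, Matrix.cons_val_zero, Matrix.cons_val_one, add_right_inj,
      Nat.cast_inj] at h0 h1
    exact Prod.ext (Fin.ext h0) (Fin.ext h1)
  apply ennreal_le_of_sq_le
  rw [sampleNorm, mul_pow, eLpNorm_two_count_sq]
  calc ENNReal.ofReal (s / 8 * δ) ^ 2
      ≤ ENNReal.ofReal (γ * N * δ) ^ 2 := by gcongr
    _ = ENNReal.ofReal γ ^ 2 * ∑' _p : Fin N × Fin N, ENNReal.ofReal δ ^ 2 := by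
        rw [tsum_fintype, Finset.sum_const, Finset.card_univ, Fintype.card_prod, Fintype.card_fin,
          nsmul_eq_mul, ENNReal.ofReal_mul (by positivity), ENNReal.ofReal_mul hγ.le,
          ENNReal.ofReal_natCast]
        push_cast
        ring
    _ ≤ ENNReal.ofReal γ ^ 2 * ∑' p : Fin N × Fin N,
          ‖g (γ • latPoint ζ (m + ![(p.1 : ℤ), (p.2 : ℤ)]) + y)‖ₑ ^ 2 := by
        gcongr with p
        rw [← ofReal_norm]
        exact ENNReal.ofReal_le_ofReal (hpt p)
    _ ≤ _ := by
        gcongr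
        exact ENNReal.tsum_comp_le_tsum_of_injective hinj
          fun n => ‖g (γ • latPoint ζ n + y)‖ₑ ^ 2

/-! ### The equivalence for a fixed envelope -/

lemma bmH_congr {lam₀ γ θ γ' θ' β : ℝ} (hγ : 0 < γ) (hγ' : 0 < γ')
    (h : 2 * Real.sin (θ / 2) = β * γ) (h' : 2 * Real.sin (θ' / 2) = β * γ') (d : Plane)
    {φ u : Envelope} (hφ : Represents 4 φ u) : bmH lam₀ γ θ d u = bmH lam₀ γ' θ' d u := by
  funext i σ X
  rw [bmH_eq_synth lam₀ γ θ d hφ, bmH_eq_synth lam₀ γ' θ' d hφ]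
  simp_rw [moireCoupling_smul hγ h, moireCoupling_smul hγ' h']

lemma continuous_bmH {lam₀ γ θ : ℝ} (hγ : 0 < γ) (d : Plane) {φ u : Envelope}
    (hφ : Represents 4 φ u) (i σ : Fin 2) : Continuous (bmH lam₀ γ θ d u i σ) := by
  have h : 2 * Real.sin (θ / 2) = 2 * Real.sin (θ / 2) / γ * γ := by field_simp
  have hc : ∀ i σ, Continuous (synth (φ i σ)) := fun i σ =>
    continuous_synth ((hφ.weighted i σ).mono (by norm_num)).integrable
  have hd : Continuous (synth fun ξ => chiral σ (diracSymbol ξ) * φ i (other σ) ξ) :=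
    continuous_synth (weighted_dirac
      ((hφ.weighted i (other σ)).mono (show 1 + 1 ≤ 4 by norm_num)) σ).integrable
  rw [funext fun X => bmH_eq_synth lam₀ γ θ d hφ i σ X]
  simp_rw [moireCoupling_smul hγ h]
  refine hd.add (continuous_const.mul (continuous_finsetSum _ fun σ' _ => ?_))
  refine Continuous.mul ?_ (hc _ _)
  fun_prop

/-- For a fixed envelope and a fixed scaled moiré length, the residual is `o(γ)` iff the BM
equation holds. -/
theorem tendsto_residual_iff_eq (hh : HoppingAssumption hs C₁ C₂ C₃ D₁ D₂ l₀)
    {lam₀ lam₁ : ℝ} (hlam₀ : 0 < lam₀) (hlam₁ : 0 < lam₁)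
    (γ θ l : ℕ → ℝ) (d : Plane) (f : ℝ → Envelope) (T β : ℝ)
    (hsc : ∀ n, Scaling hs l₀ lam₀ lam₁ (γ n) (θ n) (l n)) (hγ0 : Tendsto γ atTop (𝓝 0))
    (hβ : ∀ n, 2 * Real.sin (θ n / 2) = β * γ n)
    (hT : 0 ≤ T) (hf : RegularAt f T) (hc' : ∀ i σ, Continuous (timeDeriv f T i σ)) :
    Tendsto (fun n => hNorm (residual hs (l n) (γ n) (θ n) d f (T / γ n)) /
        ENNReal.ofReal (γ n)) atTop (𝓝 0) ↔
      ∀ n i σ X, Complex.I * timeDeriv f T i σ X =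
        bmH lam₀ (γ n) (θ n) d (f T) i σ X := by
  obtain ⟨γ₀, C, c, hγ₀, hC, hc, H⟩ := exists_residual_decomposition hh hlam₀ hlam₁
  obtain ⟨φ, hφ⟩ := exists_represents (m := 4) (by norm_num) hf.continuous hf.sobolev
  have hγ := fun n => (hsc n).γ_pos
  have hTn : ∀ n, γ n * (T / γ n) = T := fun n => mul_div_cancel₀ T (hγ n).ne'
  set e₁ : ℕ → ℝ≥0∞ := fun n => ENNReal.ofReal (C * γ n ^ c) * sobolevNorm 8 (f T) with he₁
  have he₁0 : Tendsto e₁ atTop (𝓝 0) :=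
    tendsto_ofReal_mul_zero (tendsto_const_mul_rpow hγ0 hc C) hf.sobolev.ne
  have hdec : ∀ᶠ n in atTop, ∃ ρ : State,
      (∀ i m σ, residual hs (l n) (γ n) (θ n) d f (T / γ n) i m σ =
        leading lam₀ (γ n) (θ n) d f (T / γ n) i m σ + ρ i m σ) ∧
      hNorm ρ ≤ ENNReal.ofReal (γ n) * e₁ n := by
    filter_upwards [hγ0.eventually (gt_mem_nhds hγ₀)] with n hn
    obtain ⟨-, -, ρ, h1, h2⟩ := H (γ n) (θ n) (l n) d f (T / γ n) (hsc n) hn.le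
      (div_nonneg hT (hγ n).le) (by rwa [hTn])
    refine ⟨ρ, h1, h2.trans (le_of_eq ?_)⟩
    rw [ofReal_mul_rpow_one_add (hγ n), hTn]
  have hbm : ∀ n, bmH lam₀ (γ n) (θ n) d (f T) = bmH lam₀ (γ 0) (θ 0) d (f T) := fun n =>
    bmH_congr (hγ n) (hγ 0) (hβ n) (hβ 0) d hφ
  set g : Envelope := bmDefect lam₀ (γ 0) (θ 0) d f T with hg
  have hgn : ∀ n, bmDefect lam₀ (γ n) (θ n) d f T = g := by
    intro n
    funext i σ X
    rw [hg, bmDefect, bmDefect, hbm n]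
  constructor
  · intro ha n i σ X
    have hgc : Continuous (g i σ) :=
      ((continuous_const.mul (hc' i σ)).sub (continuous_bmH (hγ 0) d hφ i σ)).neg
    suffices hz : g i σ X = 0 by
      rw [← hgn n, bmDefect, neg_eq_zero, sub_eq_zero] at hz
      exact hz
    -- No integrability of `∂_T f` is available, so the argument is local: a nonzero value of the
    -- continuous defect bounds its samples from below, uniformly in small `γ`.
    by_contra hne
    obtain ⟨ε, γ₁, hε, hγ₁, hlow⟩ := exists_le_sampleNorm hgc hne
    have hlim : Tendsto (fun n => hNorm (residual hs (l n) (γ n) (θ n) d f (T / γ n)) /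
        ENNReal.ofReal (γ n) + e₁ n) atTop (𝓝 0) := by simpa using ha.add he₁0
    have hε' : (0 : ℝ≥0∞) < ENNReal.ofReal ε := by simpa using hε
    obtain ⟨n, ⟨h1, h2⟩, ρ, h3, h4⟩ := ((hlim.eventually (gt_mem_nhds hε')).and
      (hγ0.eventually (gt_mem_nhds hγ₁)) |>.and hdec).exists
    have h5 := sampleNorm_le_hNorm_div (hγ n) h3 h4 i σ
    rw [hTn, hgn] at h5
    exact absurd ((hlow _ (hγ n) h2.le _ _).trans h5) (not_le.2 h1)
  -- The leading part vanishes identically, and the residual reduces to the remainder.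
  · intro heq
    refine tendsto_zero_of_le (K := 4) (L := 1) (b := fun _ => 0) (by norm_num)
      ENNReal.one_ne_top ?_ tendsto_const_nhds he₁0
    filter_upwards [hdec] with n ⟨ρ, h1, h2⟩
    rw [one_mul]
    refine hNorm_div_le (hγ n) h1 h2 fun i σ => ?_
    have hz : bmDefect lam₀ (γ n) (θ n) d f (γ n * (T / γ n)) i σ = fun _ => 0 := by
      funext X
      rw [hTn, bmDefect, heq n, sub_self, neg_zero]
    rw [hz]
    simp [sampleNorm]

end TBG

end

theorem mainTheorem2 (hs : ℝ → ℝ) (C₁ C₂ C₃ D₁ D₂ l₀ lam₀ lam₁ : ℝ)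
    (hh : HoppingAssumption hs C₁ C₂ C₃ D₁ D₂ l₀) (hlam₀ : 0 < lam₀) (hlam₁ : 0 < lam₁) :
    -- decomposition of the residual
    (∃ γ₀ C c : ℝ, 0 < γ₀ ∧ 0 < C ∧ 0 < c ∧
      ∀ (γ θ l : ℝ) (d : Plane) (f : ℝ → Envelope) (τ : ℝ),
        Scaling hs l₀ lam₀ lam₁ γ θ l → γ ≤ γ₀ → 0 ≤ τ → RegularAt f (γ * τ) →
        hNorm (wavePacket γ θ d f τ) < ⊤ ∧
        (∀ i n σ, Summable (interTerm hs l θ d (wavePacket γ θ d f τ) i n σ)) ∧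
        ∃ ρ : State,
          (∀ i n σ, residual hs l γ θ d f τ i n σ = leading lam₀ γ θ d f τ i n σ + ρ i n σ) ∧
          hNorm ρ ≤ ENNReal.ofReal (C * γ ^ (1 + c)) * sobolevNorm 8 (f (γ * τ))) ∧
    -- for bounded families, `r = o(γ)` iff the BM equation holds up to an `o(1)` error in `L²`
    (∀ (γ θ l τ : ℕ → ℝ) (d : ℕ → Plane) (f : ℕ → ℝ → Envelope) (B : ℝ≥0),
      (∀ n, Scaling hs l₀ lam₀ lam₁ (γ n) (θ n) (l n)) → Tendsto γ atTop (𝓝 0) →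
      (∀ n, 0 ≤ τ n) → (∀ n, RegularAt (f n) (γ n * τ n)) →
      (∀ n, sobolevNorm 8 (f n (γ n * τ n)) ≤ B) →
      (∀ n i σ, Continuous (timeDeriv (f n) (γ n * τ n) i σ)) →
      (∀ n, sobolevNorm 2 (timeDeriv (f n) (γ n * τ n)) ≤ B) →
      (Tendsto (fun n => hNorm (residual hs (l n) (γ n) (θ n) (d n) (f n) (τ n)) /
          ENNReal.ofReal (γ n)) atTop (𝓝 0) ↔
        Tendsto (fun n => l2Norm (bmDefect lam₀ (γ n) (θ n) (d n) (f n) (γ n * τ n)))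
          atTop (𝓝 0))) ∧
    -- for fixed envelopes and a fixed scaled moiré length, `r = o(γ)` iff the BM equation holds
    (∀ (γ θ l : ℕ → ℝ) (d : Plane) (f : ℝ → Envelope) (T β : ℝ),
      (∀ n, Scaling hs l₀ lam₀ lam₁ (γ n) (θ n) (l n)) → Tendsto γ atTop (𝓝 0) →
      (∀ n, 2 * Real.sin (θ n / 2) = β * γ n) →
      0 ≤ T → RegularAt f T → (∀ i σ, Continuous (timeDeriv f T i σ)) →
      (Tendsto (fun n => hNorm (residual hs (l n) (γ n) (θ n) d f (T / γ n)) /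
          ENNReal.ofReal (γ n)) atTop (𝓝 0) ↔
        ∀ n i σ X, Complex.I * timeDeriv f T i σ X =
          bmH lam₀ (γ n) (θ n) d (f T) i σ X)) := by
  exact ⟨exists_residual_decomposition hh hlam₀ hlam₁,
    fun γ θ l τ d f B => tendsto_residual_iff hh hlam₀ hlam₁ γ θ l τ d f B,
    fun γ θ l d f T β => tendsto_residual_iff_eq hh hlam₀ hlam₁ γ θ l d f T β⟩
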